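/- Let $K$ be a number field of degree $d$ with ring of integers $\mathcal O$, let $\mathrm{Tr}=\mathrm{Tr}_{K/\mathbb Q}$, and let $\mathcal O^\vee=\{\xi\in K:\mathrm{Tr}(\xi n)\in\mathbb Z\ \forall n\in\mathcal O\}$. Fix a $\mathbb Z$-basis $(\omega_j)$ of $\mathcal O$ with dual basis $(\omega_j^\vee)$ for the trace form, and write $\iota(x)=\sum_j x_j\omega_j$, $\iota^\vee(y)=\sum_j y_j\omega_j^\vee$. Let $q\in\mathcal O$ have all its conjugates of modulus $>1$, let $Q=|N_{K/\mathbb Q}(q)|$, and let $\mathcal D\ni 0$ be a set of representatives of $\mathcal O/(q)$ such that every $n\in\mathcal O$ is a finite sum $\sum_j b_jq^j$ with $b_j\in\mathcal D$. For $\kappa\in\mathbb N=\{0,1,2,\dots\}$ put $\mathcal N_\kappa=\{\sum_{j<\kappa}b_jq^j: b_j\in\mathcal D\}$. Let $\mathscr F\subset\mathbb R^d$ be the closure of $\iota^{-1}\{\sum_{j=1}^r b_jq^{-j}: r\ge1,\ b_j\in\mathcal D\}$, and let $q$ act on $\mathbb R^d$ by extending $x\mapsto\iota^{-1}(q\,\iota(x))$.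 Let $f:\mathcal O\to\mathbb C$ satisfy $|f(n)|=1$ for all $n$. For $\lambda\in\mathbb N$ let $f_\lambda(n)=f(r)$, where $r$ is the element of $\mathcal N_\lambda$ congruent to $n$ modulo $q^\lambda$. Assume: - (Carry property) $\eta_1>0$, and for all $\kappa,\lambda,\rho\in\mathbb N$ with $\rho\le\lambda$, the number of $v\in\mathcal N_\lambda$ such that $f(u_1+u_2+vq^\kappa)\overline{f(u_1+vq^\kappa)}\ne f_{\kappa+\rho}(u_1+u_2+vq^\kappa)\overline{f_{\kappa+\rho}(u_1+vq^\kappa)}$ for some $u_1,u_2\in\mathcal N_\kappa$ is at most $C_1Q^{\lambda-\eta_1\rho}$; - (Fourier property) $\gamma:\mathbb N\to[0,\infty)$ is non-decreasing, $c>0$, and $\big|\sum_{v\in\mathcal N_\lambda}f(vq^\kappa)e^{2\pi i\mathrm{Tr}(tv)}\big|\le C_2Q^{\lambda-\gamma(\lambda)}$ for all $\lambda,\kappa\in\mathbb N$ with $\kappa\le c\lambda$ and all $t\in K$. Let $V_0:\mathbb R^d\to\mathbb C$ be smooth with compact support contained in $\mathbb R^d\smallsetminus\{0\}$, let $V=V_0\circ\iota^{-1}:K\to\mathbb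 C$ and $\hat V=\hat V_0\circ(\iota^\vee)^{-1}$ on $K$, where $\hat V_0(y)=\int_{\mathbb R^d}V_0(x)e^{2\pi i\langle y,x\rangle}\,dx$. For $k\in\mathbb N$ put $$\Sigma_{V,k}=\sum_{\xi\in q^{-k}\mathcal O^\vee}|\hat V(\xi)|,\qquad \Sigma_V=\Sigma_{V,0}.$$ Every bounded subset of $\mathbb R^d$ is contained in $q^k\mathscr F$ for some $k\in\mathbb N$. If $k\in\mathbb N$ is such that $V_0$ vanishes outside $q^k\mathscr F$, then for all $\mu,\nu\in\mathbb N$ with $\mu\le\frac{c}{c+2}\nu$, $$\sum_{m\in\mathcal N_\mu}\Big|\sum_{n\in\mathcal O}V\Big(\frac{mn}{q^{\mu+\nu}}\Big)f(mn)\Big|\le C\,\Sigma_{V,k}\,\mu^{d+1}\,Q^{\mu+\nu-\frac{\eta_1}{1+\eta_1}\gamma(\nu-\mu)},$$ where $C$ depends only on $K$, $(\omega_j)$, $(q,\mathcal D)$, $C_1$ and $C_2$. In particular, if $V_0$ vanishes outside $\mathscr F$, the bound holds with $\Sigma_V$. -/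

import Mathlib

open NumberField
open scoped FourierTransform ContDiff

namespace DigitSystem

noncomputable section

variable {K : Type*} [Field K] [NumberField K]

open Classical in
/-- `𝒩_κ`: the set of all `∑_{j < κ} b_j q ^ j` with digits `b_j ∈ D`. -/
def digitSet (q : 𝓞 K) (D : Finset (𝓞 K)) (κ : ℕ) : Finset (𝓞 K) :=
  Finset.univ.image fun b : Fin κ → D => ∑ j, (b j : 𝓞 K) * q ^ (j : ℕ)

/-- `(q, D)` is a number system with the finiteness property. -/
structure IsFNS (q : 𝓞 K) (D : Finset (𝓞 K)) : Prop where
  zero_mem : (0 : 𝓞 K) ∈ D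
  /-- `D` is a set of representatives of `𝓞 K / (q)`. -/
  existsUnique_digit : ∀ n : 𝓞 K, ∃! b, b ∈ D ∧ q ∣ n - b
  /-- All conjugates of `q` have modulus larger than `1`. -/
  one_lt_conj : ∀ σ : K →+* ℂ, 1 < ‖σ (q : K)‖
  /-- Every integer of `K` has a finite expansion. -/
  exists_expansion : ∀ n : 𝓞 K, ∃ κ, n ∈ digitSet q D κ

/-- `Q = N(q)`, the absolute value of the norm of `q`. -/
def absNorm (q : 𝓞 K) : ℝ := |((Algebra.norm ℤ q : ℤ) : ℝ)|

open Classical in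
/-- The number formed with the digits of `n` of indices `0, …, l - 1`: the element of `𝒩_l` that is
congruent to `n` modulo `q ^ l` (it exists and is unique in a number system). -/
def lowDigits (q : 𝓞 K) (D : Finset (𝓞 K)) (l : ℕ) (n : 𝓞 K) : 𝓞 K :=
  if h : ∃ r ∈ digitSet q D l, q ^ l ∣ n - r then h.choose else 0

/-- The truncated function `f_l(n) = f(lowDigits l n)`. -/
def truncated (q : 𝓞 K) (D : Finset (𝓞 K)) (f : 𝓞 K → ℂ) (l : ℕ) (n : 𝓞 K) : ℂ :=
  f (lowDigits q D l n)

open Classical in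
/-- The Carry property, with exponent `η₁` and implied constant `C₁`. -/
def CarryProperty (q : 𝓞 K) (D : Finset (𝓞 K)) (f : 𝓞 K → ℂ) (η₁ C₁ : ℝ) : Prop :=
  0 < η₁ ∧ ∀ κ l ρ : ℕ, ρ ≤ l →
    (((digitSet q D l).filter fun v => ∃ u₁ ∈ digitSet q D κ, ∃ u₂ ∈ digitSet q D κ,
        f (u₁ + u₂ + v * q ^ κ) * star (f (u₁ + v * q ^ κ)) ≠
          truncated q D f (κ + ρ) (u₁ + u₂ + v * q ^ κ) *
            star (truncated q D f (κ + ρ) (u₁ + v * q ^ κ))).card : ℝ) ≤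
      C₁ * absNorm q ^ ((l : ℝ) - η₁ * ρ)

/-- The Fourier property, with gain `γ`, range `c` and implied constant `C₂`. -/
def FourierProperty (q : 𝓞 K) (D : Finset (𝓞 K)) (f : 𝓞 K → ℂ) (γ : ℕ → ℝ) (c C₂ : ℝ) : Prop :=
  Monotone γ ∧ (∀ l, 0 ≤ γ l) ∧ 0 < c ∧ ∀ (l κ : ℕ) (t : K), (κ : ℝ) ≤ c * l →
    ‖∑ v ∈ digitSet q D l, f (v * q ^ κ) *
        Complex.exp (2 * Real.pi * Complex.I * (Algebra.trace ℚ K (t * (v : K)) : ℚ))‖ ≤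
      C₂ * absNorm q ^ ((l : ℝ) - γ l)

variable {d : ℕ}

/-- A `ℤ`-basis of `𝓞 K`, regarded as a `ℚ`-basis of `K`. -/
def ratBasis (w : Module.Basis (Fin d) ℤ (𝓞 K)) : Module.Basis (Fin d) ℚ K :=
  w.localizationLocalization ℚ (nonZeroDivisors ℤ) K

/-- `ι⁻¹ : K → ℝ ^ d`, the coordinates in the basis `w`. -/
def coord (w : Module.Basis (Fin d) ℤ (𝓞 K)) (x : K) : EuclideanSpace ℝ (Fin d) :=
  WithLp.toLp 2 fun i => (((ratBasis w).repr x i : ℚ) : ℝ)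

/-- `(ι^∨)⁻¹ : K → ℝ ^ d`, the coordinates in the basis dual to `w` for the trace form. -/
def dualCoord (w : Module.Basis (Fin d) ℤ (𝓞 K)) (ξ : K) : EuclideanSpace ℝ (Fin d) :=
  WithLp.toLp 2 fun i => (((ratBasis w).traceDual.repr ξ i : ℚ) : ℝ)

/-- `V̂(ξ) = V̂₀((ι^∨)⁻¹ ξ)`, where `V̂₀(y) = ∫ V₀(x) e(⟨y, x⟩) dx`. With the sign `+` in the
exponential this integral is the one that Mathlib writes `𝓕⁻`. -/
def hatV (w : Module.Basis (Fin d) ℤ (𝓞 K)) (V₀ : EuclideanSpace ℝ (Fin d) → ℂ) (ξ : K) : ℂ :=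
  𝓕⁻ V₀ (dualCoord w ξ)

/-- The lattice `q ^ (-k) 𝓞^∨`, where `𝓞^∨` is the dual of `𝓞 K` for the trace form. -/
def dualLattice (q : 𝓞 K) (k : ℕ) : Set K :=
  {ξ | (q : K) ^ k * ξ ∈ Submodule.traceDual ℤ ℚ (1 : Submodule (𝓞 K) K)}

/-- The sum of `|V̂(ξ)|` over `ξ ∈ q ^ (-k) 𝓞^∨`; for `k = 0` this is `Σ_V`. -/
def sigmaV (q : 𝓞 K) (w : Module.Basis (Fin d) ℤ (𝓞 K)) (V₀ : EuclideanSpace ℝ (Fin d) → ℂ)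
    (k : ℕ) : ℝ :=
  ∑' ξ : dualLattice q k, ‖hatV w V₀ ξ‖

/-- The fundamental tile in `K`: all `∑_{j = 1}^{r} b_j q ^ (-j)` with `r ≥ 1` and `b_j ∈ D`. -/
def ratTile (q : 𝓞 K) (D : Finset (𝓞 K)) : Set K :=
  {x | ∃ r : ℕ, 1 ≤ r ∧ ∃ b : Fin r → D, x = ∑ j, ((b j : 𝓞 K) : K) * ((q : K) ^ ((j : ℕ) + 1))⁻¹}

/-- The tile scaled by `q ^ k`, as a closed subset of `ℝ ^ d`. -/
def tile (q : 𝓞 K) (D : Finset (𝓞 K)) (w : Module.Basis (Fin d) ℤ (𝓞 K)) (k : ℕ) :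
    Set (EuclideanSpace ℝ (Fin d)) :=
  closure ((fun x => coord w ((q : K) ^ k * x)) '' ratTile q D)

/-- The type I sum `∑_{m ∈ 𝒩_μ} |∑_{n ∈ 𝓞} V(mn / q ^ (μ + ν)) f(mn)|` with `V = V₀ ∘ ι⁻¹`. -/
def typeISum (q : 𝓞 K) (D : Finset (𝓞 K)) (w : Module.Basis (Fin d) ℤ (𝓞 K)) (f : 𝓞 K → ℂ)
    (V₀ : EuclideanSpace ℝ (Fin d) → ℂ) (μ ν : ℕ) : ℝ :=
  ∑ m ∈ digitSet q D μ,
    ‖∑' n : 𝓞 K, V₀ (coord w (((m * n : 𝓞 K) : K) / (q : K) ^ (μ + ν))) * f (m * n)‖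

end

end DigitSystem

/-! The tile condition turns the smooth weight into additive characters. If `n / q^J` lies in `q^k`
times the tile, then `n ∈ 𝒩_{J+k}` (`mem_digitSet_of_coord_mem_tile`), and `𝒩_{J+k}` has one element
in each class modulo `q^(J+k)`. So at the points `n / q^J` with `n ∈ 𝒩_{J+k}`, `V` agrees with its
`q^k 𝓞`-periodization, whose Fourier series has frequencies `ξ ∈ q^(-k) 𝓞^∨` and coefficients
`Q^(-k) V̂(ξ)` (`hasSum_hatV`). It remains to bound, uniformly in `t`, the sum over `m` of `|∑ f(n)
e(Tr(tn))|`, where `n` runs over the multiples of `m` in `𝒩_{μ+ν+k}` (`typeISum_le`).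

Write `n = u + v q^κ` with `κ = 2μ`, `u ∈ 𝒩_κ`, `v ∈ 𝒩_l`, `l = ν - μ + k`. By the Carry property,
outside a small set of `v`, `f(n)` is `f(v q^κ)` times a factor depending only on `u` and on `v`
modulo `q^ρ`. Detecting `m ∣ n` by the characters `ψ` of `𝓞/(m)` and fixing `v` modulo `q^ρ`
separates the variables. The sum over `v` is bounded by the Fourier property, whose arbitrary `t`
absorbs both `ψ` and the congruence on `v`. The sum over `u` has unstructured coefficients and is
bounded on average over `m` and `ψ` by a large sieve (`large_sieve`): characters trivial on
multiples of some `m ∈ 𝒩_μ` are separated at the scale dual to `𝒩_{2μ}`, whence `κ = 2μ`. Grouping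
by conductors costs only powers of `μ` (`exists_sum_perp_norm_le`). Exceptional `v` are bounded by
counting `u` (`card_filter_dvd_le`).

The saving is `Q^(ρ-γ(l)) + Q^(-η₁ρ)`, balanced by `ρ ≈ γ(l)/(1+η₁)` (`exists_balance`).

Bounded sets are covered by dilated tiles because integers with bounded conjugates have expansions
of bounded length. -/

set_option linter.unusedSectionVars false

namespace DigitSystem

noncomputable section

/-! ### Digit expansions and residues modulo powers of `q`. -/

section Digits

variable {K : Type*} [Field K] {q : 𝓞 K} {D : Finset (𝓞 K)}

theorem mem_digitSet {κ : ℕ} {n : 𝓞 K} :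
    n ∈ digitSet q D κ ↔ ∃ b : Fin κ → D, ∑ j, (b j : 𝓞 K) * q ^ (j : ℕ) = n := by
  simp [digitSet]

@[simp]
theorem digitSet_zero : digitSet q D 0 = {0} := by
  ext n
  simp [mem_digitSet, eq_comm]

theorem mem_digitSet_succ {κ : ℕ} {n : 𝓞 K} :
    n ∈ digitSet q D (κ + 1) ↔ ∃ b ∈ D, ∃ u ∈ digitSet q D κ, n = b + q * u := by
  simp only [mem_digitSet]
  constructor
  · rintro ⟨b, rfl⟩
    refine ⟨b 0, (b 0).2, _, ⟨fun j => b j.succ, rfl⟩, ?_⟩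
    rw [Fin.sum_univ_succ, Finset.mul_sum]
    simp only [Fin.val_zero, pow_zero, mul_one, Fin.val_succ, add_right_inj]
    exact Finset.sum_congr rfl fun j _ => by ring
  · rintro ⟨b, hb, _, ⟨c, rfl⟩, rfl⟩
    refine ⟨Fin.cons ⟨b, hb⟩ c, ?_⟩
    rw [Fin.sum_univ_succ, Finset.mul_sum]
    simp only [Fin.val_zero, pow_zero, mul_one, Fin.val_succ, Fin.cons_zero, Fin.cons_succ,
      add_right_inj]
    exact Finset.sum_congr rfl fun j _ => by ring

theorem mem_digitSet_add {κ l : ℕ} {n : 𝓞 K} :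
    n ∈ digitSet q D (κ + l) ↔
      ∃ u ∈ digitSet q D κ, ∃ v ∈ digitSet q D l, n = u + v * q ^ κ := by
  induction κ generalizing n with
  | zero => simp
  | succ κ ih =>
    rw [show κ + 1 + l = κ + l + 1 by ring, mem_digitSet_succ]
    constructor
    · rintro ⟨b, hb, n, hn, rfl⟩
      obtain ⟨u, hu, v, hv, rfl⟩ := ih.1 hn
      exact ⟨b + q * u, mem_digitSet_succ.2 ⟨b, hb, u, hu, rfl⟩, v, hv, by ring⟩
    · rintro ⟨u', hu', v, hv, rfl⟩
      obtain ⟨b, hb, u, hu, rfl⟩ := mem_digitSet_succ.1 hu'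
      exact ⟨b, hb, u + v * q ^ κ, ih.2 ⟨u, hu, v, hv, rfl⟩, by ring⟩

namespace IsFNS

variable [NumberField K]

theorem zero_mem_digitSet (h : IsFNS q D) (κ : ℕ) : (0 : 𝓞 K) ∈ digitSet q D κ := by
  induction κ with
  | zero => simp
  | succ κ ih => exact mem_digitSet_succ.2 ⟨0, h.zero_mem, 0, ih, by simp⟩

theorem ne_zero (h : IsFNS q D) : q ≠ 0 := by
  rintro rfl
  have := h.one_lt_conj (Classical.arbitrary _)
  simp at this
  linarith

theorem coe_ne_zero (h : IsFNS q D) : (q : K) ≠ 0 := by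
  simpa using h.ne_zero

theorem digitSet_mono (h : IsFNS q D) {κ l : ℕ} (hkl : κ ≤ l) :
    digitSet q D κ ⊆ digitSet q D l := by
  obtain ⟨p, rfl⟩ := Nat.exists_eq_add_of_le hkl
  intro n hn
  exact mem_digitSet_add.2 ⟨n, hn, 0, h.zero_mem_digitSet p, by simp⟩

theorem exists_mem_digitSet_dvd_sub (h : IsFNS q D) (κ : ℕ) (n : 𝓞 K) :
    ∃ r ∈ digitSet q D κ, q ^ κ ∣ n - r := by
  induction κ generalizing n with
  | zero => exact ⟨0, by simp, by simp⟩
  | succ κ ih =>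
    obtain ⟨b, ⟨hb, n', hn'⟩, -⟩ := h.existsUnique_digit n
    obtain ⟨r, hr, s, hs⟩ := ih n'
    refine ⟨b + q * r, mem_digitSet_succ.2 ⟨b, hb, r, hr, rfl⟩, s, ?_⟩
    linear_combination hn' + q * hs

theorem digitSet_unique (h : IsFNS q D) {κ : ℕ} {r r' : 𝓞 K} (hr : r ∈ digitSet q D κ)
    (hr' : r' ∈ digitSet q D κ) (hd : q ^ κ ∣ r - r') : r = r' := by
  induction κ generalizing r r' with
  | zero =>
    simp only [digitSet_zero, Finset.mem_singleton] at hr hr'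
    rw [hr, hr']
  | succ κ ih =>
    obtain ⟨b, hb, u, hu, rfl⟩ := mem_digitSet_succ.1 hr
    obtain ⟨b', hb', u', hu', rfl⟩ := mem_digitSet_succ.1 hr'
    obtain ⟨s, hs⟩ := hd
    have hbb : b = b' := by
      refine (h.existsUnique_digit b).unique ⟨hb, by simp⟩ ⟨hb', q ^ κ * s - (u - u'), ?_⟩
      linear_combination hs
    subst hbb
    rw [ih hu hu' ⟨s, mul_left_cancel₀ h.ne_zero (by linear_combination hs)⟩]

theorem add_mul_pow_inj (h : IsFNS q D) {κ : ℕ} {u u' v v' : 𝓞 K} (hu : u ∈ digitSet q D κ)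
    (hu' : u' ∈ digitSet q D κ) (he : u + v * q ^ κ = u' + v' * q ^ κ) : u = u' ∧ v = v' := by
  have huu : u = u' := h.digitSet_unique hu hu' ⟨v' - v, by linear_combination he⟩
  subst huu
  exact ⟨rfl, mul_right_cancel₀ (pow_ne_zero κ h.ne_zero) (add_left_cancel he)⟩

theorem sum_digitSet_add (h : IsFNS q D) {M : Type*} [AddCommMonoid M] (κ l : ℕ) (F : 𝓞 K → M) :
    ∑ n ∈ digitSet q D (κ + l), F n =
      ∑ v ∈ digitSet q D l, ∑ u ∈ digitSet q D κ, F (u + v * q ^ κ) := by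
  rw [← Finset.sum_product']
  symm
  refine Finset.sum_bij (fun p _ => p.2 + p.1 * q ^ κ) ?_ ?_ ?_ (fun _ _ => rfl)
  · rintro ⟨v, u⟩ hp
    rw [Finset.mem_product] at hp
    exact mem_digitSet_add.2 ⟨u, hp.2, v, hp.1, rfl⟩
  · rintro ⟨v, u⟩ hp ⟨v', u'⟩ hp' he
    rw [Finset.mem_product] at hp hp'
    obtain ⟨h1, h2⟩ := h.add_mul_pow_inj hp.2 hp'.2 he
    exact Prod.ext h2 h1
  · intro n hn
    obtain ⟨u, hu, v, hv, rfl⟩ := mem_digitSet_add.1 hn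
    exact ⟨(v, u), Finset.mk_mem_product hv hu, rfl⟩

theorem lowDigits_mem (h : IsFNS q D) (l : ℕ) (n : 𝓞 K) : lowDigits q D l n ∈ digitSet q D l := by
  have hex := h.exists_mem_digitSet_dvd_sub l n
  rw [lowDigits, dif_pos hex]
  exact hex.choose_spec.1

theorem dvd_sub_lowDigits (h : IsFNS q D) (l : ℕ) (n : 𝓞 K) : q ^ l ∣ n - lowDigits q D l n := by
  have hex := h.exists_mem_digitSet_dvd_sub l n
  rw [lowDigits, dif_pos hex]
  exact hex.choose_spec.2

theorem lowDigits_eq (h : IsFNS q D) {l : ℕ} {n r : 𝓞 K} (hr : r ∈ digitSet q D l)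
    (hd : q ^ l ∣ n - r) :
    lowDigits q D l n = r := by
  refine h.digitSet_unique (h.lowDigits_mem l n) hr ?_
  have := dvd_sub hd (h.dvd_sub_lowDigits l n)
  rwa [sub_sub_sub_cancel_left] at this

theorem lowDigits_congr (h : IsFNS q D) {l : ℕ} {n n' : 𝓞 K} (hd : q ^ l ∣ n - n') :
    lowDigits q D l n = lowDigits q D l n' := by
  refine h.lowDigits_eq (h.lowDigits_mem l n') ?_
  have := dvd_add hd (h.dvd_sub_lowDigits l n')
  rwa [sub_add_sub_cancel] at this

end IsFNS

end Digits

/-! ### Norms, conjugates and the size of digit sets. -/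

section Norm

variable {K : Type*} [Field K] [NumberField K]

theorem absNorm_eq_ideal (x : 𝓞 K) : absNorm x = (Ideal.absNorm (Ideal.span {x}) : ℝ) := by
  rw [Ideal.absNorm_span_singleton, absNorm, Nat.cast_natAbs, Int.cast_abs]

theorem absNorm_eq_prod (x : 𝓞 K) : absNorm x = ∏ σ : K →+* ℂ, ‖σ (x : K)‖ := by
  have h1 := Algebra.norm_eq_prod_embeddings ℚ ℂ (x : K)
  rw [← norm_prod, ← Fintype.prod_equiv (RingHom.equivRatAlgHom (R := K) (S := ℂ)).symm
    (fun σ : K →ₐ[ℚ] ℂ => σ (x : K))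
    (fun σ : K →+* ℂ => σ (x : K)) (fun σ => rfl), ← h1, absNorm,
    ← Algebra.coe_norm_int]
  simp

theorem absNorm_mul (x y : 𝓞 K) : absNorm (x * y) = absNorm x * absNorm y := by
  simp [absNorm, abs_mul]

theorem absNorm_pow (x : 𝓞 K) (n : ℕ) : absNorm (x ^ n) = absNorm x ^ n := by
  simp [absNorm, abs_pow]

theorem absNorm_pos {x : 𝓞 K} (hx : x ≠ 0) : 0 < absNorm x := by
  simpa [absNorm] using hx

theorem one_le_absNorm {x : 𝓞 K} (hx : x ≠ 0) : 1 ≤ absNorm x := by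
  have h := absNorm_pos hx
  rw [absNorm_eq_ideal] at h ⊢
  exact_mod_cast h

theorem IsFNS.one_lt_absNorm {q : 𝓞 K} {D : Finset (𝓞 K)} (h : IsFNS q D) : 1 < absNorm q := by
  rw [absNorm_eq_prod]
  classical
  obtain ⟨σ₀⟩ : Nonempty (K →+* ℂ) := inferInstance
  calc (1 : ℝ) < ‖σ₀ (q : K)‖ := h.one_lt_conj σ₀
    _ ≤ _ := by
      rw [← Finset.mul_prod_erase _ _ (Finset.mem_univ σ₀)]
      refine le_mul_of_one_le_right (norm_nonneg _) ?_
      simpa using Finset.prod_le_prod (s := Finset.univ.erase σ₀) (f := fun _ => (1 : ℝ))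
        (fun _ _ => zero_le_one) fun σ _ => (h.one_lt_conj σ).le

theorem trace_eq_sum (x : K) : ((Algebra.trace ℚ K x : ℚ) : ℂ) = ∑ σ : K →+* ℂ, σ x := by
  rw [← Fintype.sum_equiv (RingHom.equivRatAlgHom (R := K) (S := ℂ)).symm (fun σ : K →ₐ[ℚ] ℂ => σ x)
    (fun σ : K →+* ℂ => σ x) (fun σ => rfl), ← trace_eq_sum_embeddings ℂ]
  simp

theorem abs_trace_le (x : K) : |((Algebra.trace ℚ K x : ℚ) : ℝ)| ≤ ∑ σ : K →+* ℂ, ‖σ x‖ := by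
  have := norm_sum_le Finset.univ fun σ : K →+* ℂ => σ x
  rw [← trace_eq_sum] at this
  simpa [Complex.norm_ratCast] using this

theorem finite_bounded (R : ℝ) : {x : 𝓞 K | ∀ σ : K →+* ℂ, ‖σ (x : K)‖ ≤ R}.Finite := by
  refine Set.Finite.of_finite_image ((Embeddings.finite_of_norm_le K ℂ R).subset ?_)
    (f := fun x : 𝓞 K => (x : K)) RingOfIntegers.coe_injective.injOn
  rintro _ ⟨x, hx, rfl⟩
  exact ⟨x.isIntegral_coe, hx⟩

theorem card_quotient (x : 𝓞 K) : (Nat.card (𝓞 K ⧸ Ideal.span {x}) : ℝ) = absNorm x := by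
  rw [absNorm_eq_ideal, Ideal.absNorm_apply, Submodule.cardQuot_apply]

variable {q : 𝓞 K} {D : Finset (𝓞 K)}

theorem IsFNS.card_digitSet (h : IsFNS q D) (κ : ℕ) :
    ((digitSet q D κ).card : ℝ) = absNorm q ^ κ := by
  rw [← absNorm_pow, ← card_quotient, ← Fintype.card_coe,
    ← Nat.card_eq_fintype_card]
  congr 1
  refine Nat.card_congr (Equiv.ofBijective
    (fun r : digitSet q D κ => Ideal.Quotient.mk (Ideal.span {q ^ κ}) (r : 𝓞 K)) ⟨?_, ?_⟩)
  · intro r r' hrr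
    rw [Ideal.Quotient.mk_eq_mk_iff_sub_mem, Ideal.mem_span_singleton] at hrr
    exact Subtype.ext (h.digitSet_unique r.2 r'.2 hrr)
  · intro x
    obtain ⟨n, rfl⟩ := Ideal.Quotient.mk_surjective x
    obtain ⟨r, hr, hd⟩ := h.exists_mem_digitSet_dvd_sub κ n
    refine ⟨⟨r, hr⟩, ?_⟩
    rw [Eq.comm, Ideal.Quotient.mk_eq_mk_iff_sub_mem, Ideal.mem_span_singleton]
    exact hd

/-- A geometric series in each embedding. Multiplying by `‖σ q‖ - 1 > 0` makes the induction close;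
the constant is uniform because there are finitely many embeddings. -/
theorem IsFNS.exists_norm_le (h : IsFNS q D) :
    ∃ C : ℝ, 1 ≤ C ∧ ∀ κ, ∀ u ∈ digitSet q D κ, ∀ σ : K →+* ℂ,
      ‖σ (u : K)‖ ≤ C * ‖σ (q : K)‖ ^ κ := by
  obtain ⟨B, hB0, hB⟩ : ∃ B : ℝ, 0 ≤ B ∧ ∀ b ∈ D, ∀ σ : K →+* ℂ, ‖σ (b : K)‖ ≤ B := by
    refine ⟨∑ b ∈ D, ∑ σ : K →+* ℂ, ‖σ (b : K)‖, by positivity, fun b hb σ => ?_⟩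
    refine le_trans ?_ (Finset.single_le_sum (f := fun b : 𝓞 K => ∑ σ : K →+* ℂ, ‖σ (b : K)‖)
      (fun _ _ => by positivity) hb)
    exact Finset.single_le_sum (f := fun σ : K →+* ℂ => ‖σ (b : K)‖)
      (fun _ _ => by positivity) (Finset.mem_univ σ)
  have key : ∀ κ, ∀ u ∈ digitSet q D κ, ∀ σ : K →+* ℂ,
      ‖σ (u : K)‖ * (‖σ (q : K)‖ - 1) ≤ B * (‖σ (q : K)‖ ^ κ - 1) := by
    intro κ
    induction κ with
    | zero => simp
    | succ κ ih =>
      intro n hn σ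
      obtain ⟨b, hb, u, hu, rfl⟩ := mem_digitSet_succ.1 hn
      have h1 := h.one_lt_conj σ
      have h2 : ‖σ ((b + q * u : 𝓞 K) : K)‖ ≤ B + ‖σ (q : K)‖ * ‖σ (u : K)‖ := by
        push_cast
        rw [map_add, map_mul]
        refine (norm_add_le _ _).trans ?_
        rw [norm_mul]
        gcongr
        exact hB b hb σ
      have h3 := ih u hu σ
      calc _ ≤ (B + ‖σ (q : K)‖ * ‖σ (u : K)‖) * (‖σ (q : K)‖ - 1) := by
            gcongr
        _ = B * (‖σ (q : K)‖ - 1) + ‖σ (q : K)‖ * (‖σ (u : K)‖ * (‖σ (q : K)‖ - 1)) := by ring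
        _ ≤ B * (‖σ (q : K)‖ - 1) + ‖σ (q : K)‖ * (B * (‖σ (q : K)‖ ^ κ - 1)) := by gcongr
        _ = _ := by ring
  have hnn : ∀ σ : K →+* ℂ, 0 ≤ B / (‖σ (q : K)‖ - 1) := fun σ =>
    div_nonneg hB0 (by linarith [h.one_lt_conj σ])
  refine ⟨1 + ∑ σ : K →+* ℂ, B / (‖σ (q : K)‖ - 1), ?_, fun κ u hu σ => ?_⟩
  · linarith [Finset.sum_nonneg fun (σ : K →+* ℂ) (_ : σ ∈ Finset.univ) => hnn σ]
  · have h1 : 0 < ‖σ (q : K)‖ - 1 := by linarith [h.one_lt_conj σ]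
    calc ‖σ (u : K)‖ ≤ B * (‖σ (q : K)‖ ^ κ - 1) / (‖σ (q : K)‖ - 1) := by
          rw [le_div_iff₀ h1]
          exact key κ u hu σ
      _ ≤ B / (‖σ (q : K)‖ - 1) * ‖σ (q : K)‖ ^ κ := by
          rw [div_mul_eq_mul_div]
          gcongr
          linarith
      _ ≤ _ := by
          gcongr
          have := Finset.single_le_sum (f := fun σ : K →+* ℂ => B / (‖σ (q : K)‖ - 1))
            (fun σ _ => hnn σ) (Finset.mem_univ σ)
          linarith

/-- Only finitely many integers have all conjugates at most `R`, so the longest of their expansions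
serves for all. This is the only use of the finiteness of expansions. -/
theorem IsFNS.exists_mem_digitSet_of_bounded (h : IsFNS q D) (R : ℝ) :
    ∃ p, ∀ x : 𝓞 K, (∀ σ : K →+* ℂ, ‖σ (x : K)‖ ≤ R) → x ∈ digitSet q D p := by
  choose p hp using h.exists_expansion
  refine ⟨(finite_bounded (K := K) R).toFinset.sup p, fun x hx => ?_⟩
  exact h.digitSet_mono (Finset.le_sup (by simpa using hx)) (hp x)

end Norm

/-! ### Additive characters of the ring of integers. -/

section Characters

variable {K : Type*} [Field K] [NumberField K] {d : ℕ}

@[simp]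
theorem ratBasis_apply (w : Module.Basis (Fin d) ℤ (𝓞 K)) (i : Fin d) :
    ratBasis w i = (w i : K) := by
  simp [ratBasis]

/-- The additive character `x ↦ e(Tr(t x))` of `𝓞 K`. -/
def trChar (t : K) : AddChar (𝓞 K) ℂ where
  toFun x := Complex.exp (2 * Real.pi * Complex.I * (Algebra.trace ℚ K (t * (x : K)) : ℚ))
  map_zero_eq_one' := by simp
  map_add_eq_mul' x y := by
    rw [← Complex.exp_add]
    congr 1
    push_cast
    rw [mul_add, map_add]
    push_cast
    ring

theorem trChar_apply (t : K) (x : 𝓞 K) :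
    trChar t x = Complex.exp (2 * Real.pi * Complex.I * (Algebra.trace ℚ K (t * (x : K)) : ℚ)) :=
  rfl

theorem trChar_add (s t : K) : trChar (s + t) = trChar s * trChar t := by
  ext x
  rw [AddChar.mul_apply, trChar_apply, trChar_apply, trChar_apply, ← Complex.exp_add]
  congr 1
  rw [add_mul, map_add]
  push_cast
  ring

theorem trChar_mul_apply (t : K) (a x : 𝓞 K) : trChar t (a * x) = trChar (t * a) x := by
  rw [trChar_apply, trChar_apply]
  push_cast
  rw [mul_assoc t]

theorem trChar_apply_eq_exp_mul_I (t : K) (x : 𝓞 K) :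
    trChar t x =
      Complex.exp (((2 * Real.pi * ((Algebra.trace ℚ K (t * (x : K)) : ℚ) : ℝ) : ℝ) : ℂ) *
        Complex.I) := by
  rw [trChar_apply]
  congr 1
  push_cast
  ring

@[simp]
theorem norm_trChar (t : K) (x : 𝓞 K) : ‖trChar t x‖ = 1 := by
  rw [trChar_apply_eq_exp_mul_I, Complex.norm_exp_ofReal_mul_I]

theorem trChar_apply_eq_one_iff (t : K) (x : 𝓞 K) :
    trChar t x = 1 ↔ ∃ n : ℤ, Algebra.trace ℚ K (t * (x : K)) = n := by
  rw [trChar_apply, Complex.exp_eq_one_iff]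
  refine exists_congr fun n => ?_
  have h2 : (2 * Real.pi * Complex.I : ℂ) ≠ 0 := Complex.two_pi_I_ne_zero
  rw [mul_comm (n : ℂ), mul_right_inj' h2]
  norm_cast

theorem half_le_re_trChar {t : K} {x : 𝓞 K}
    (h : |((Algebra.trace ℚ K (t * (x : K)) : ℚ) : ℝ)| ≤ 1 / 8) : 1 / 2 ≤ (trChar t x).re := by
  rw [trChar_apply_eq_exp_mul_I, Complex.exp_ofReal_mul_I_re]
  set a := ((Algebra.trace ℚ K (t * (x : K)) : ℚ) : ℝ)
  rw [← Real.cos_abs, ← Real.cos_pi_div_three]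
  have h0 := abs_nonneg a
  have hp := Real.pi_pos
  have h1 : |2 * Real.pi * a| = 2 * Real.pi * |a| := by
    rw [abs_mul, abs_of_pos (by positivity)]
  rw [h1]
  refine Real.cos_le_cos_of_nonneg_of_le_pi (by positivity) (by linarith) ?_
  nlinarith

theorem trace_sum_smul_traceDual_mul (w : Module.Basis (Fin d) ℤ (𝓞 K)) (a : Fin d → ℚ)
    (j : Fin d) :
    Algebra.trace ℚ K ((∑ i, a i • (ratBasis w).traceDual i) * (w j : K)) = a j := by
  rw [← ratBasis_apply, Finset.sum_mul, map_sum]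
  simp only [smul_mul_assoc, map_smul, Module.Basis.trace_traceDual_mul]
  simp

theorem eq_zero_of_forall_trace_mul_eq_zero (w : Module.Basis (Fin d) ℤ (𝓞 K)) {z : K}
    (h : ∀ i, Algebra.trace ℚ K (z * (w i : K)) = 0) : z = 0 := by
  refine (ratBasis w).traceDual.repr.injective (Finsupp.ext fun i => ?_)
  rw [Module.Basis.traceDual_repr_apply, map_zero, Finsupp.zero_apply, ratBasis_apply]
  exact h i

/-- The characters of `𝓞 K` that are trivial on the nonzero ideal `I`. -/
def perp (I : Ideal (𝓞 K)) : Finset (AddChar (𝓞 K) ℂ) :=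
  open Classical in
  if h : {ψ : AddChar (𝓞 K) ℂ | ∀ x ∈ I, ψ x = 1}.Finite then h.toFinset else ∅

theorem exists_addChar_quotient {I : Ideal (𝓞 K)} {ψ : AddChar (𝓞 K) ℂ}
    (h : ∀ x ∈ I, ψ x = 1) :
    ∃ φ : AddChar (𝓞 K ⧸ I) ℂ,
      φ.compAddMonoidHom (Ideal.Quotient.mk I).toAddMonoidHom = ψ := by
  have hc : ∀ x y, Ideal.Quotient.mk I x = Ideal.Quotient.mk I y → ψ x = ψ y := by
    intro x y hxy
    rw [Ideal.Quotient.mk_eq_mk_iff_sub_mem] at hxy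
    rw [← sub_add_cancel x y, AddChar.map_add_eq_mul, h _ hxy, one_mul]
  have hs := Ideal.Quotient.mk_surjective (I := I)
  have hinv : ∀ x, ψ (Function.surjInv hs (Ideal.Quotient.mk I x)) = ψ x :=
    fun x => hc _ _ (Function.surjInv_eq hs _)
  refine ⟨⟨fun a => ψ (Function.surjInv hs a), ?_, ?_⟩, ?_⟩
  · rw [← map_zero (Ideal.Quotient.mk I), hinv, AddChar.map_zero_eq_one]
  · intro a b
    obtain ⟨x, rfl⟩ := hs a
    obtain ⟨y, rfl⟩ := hs b
    rw [← map_add, hinv, hinv, hinv, AddChar.map_add_eq_mul]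
  · ext x
    exact hinv x

theorem finite_quotient {I : Ideal (𝓞 K)} (hI : I ≠ ⊥) : Finite (𝓞 K ⧸ I) :=
  Ideal.finiteQuotientOfFreeOfNeBot I hI

theorem mem_perp {I : Ideal (𝓞 K)} (hI : I ≠ ⊥) {ψ : AddChar (𝓞 K) ℂ} :
    ψ ∈ perp I ↔ ∀ x ∈ I, ψ x = 1 := by
  have hfin : {ψ : AddChar (𝓞 K) ℂ | ∀ x ∈ I, ψ x = 1}.Finite := by
    have := finite_quotient hI
    refine (Set.finite_range fun φ : AddChar (𝓞 K ⧸ I) ℂ =>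
      φ.compAddMonoidHom (Ideal.Quotient.mk I).toAddMonoidHom).subset ?_
    intro ψ hψ
    exact exists_addChar_quotient hψ
  rw [perp, dif_pos hfin, Set.Finite.mem_toFinset, Set.mem_ofPred_eq]

theorem sum_perp_eq {M : Type*} [AddCommMonoid M] {I : Ideal (𝓞 K)} (hI : I ≠ ⊥)
    [Fintype (AddChar (𝓞 K ⧸ I) ℂ)] (F : AddChar (𝓞 K) ℂ → M) :
    ∑ ψ ∈ perp I, F ψ = ∑ φ : AddChar (𝓞 K ⧸ I) ℂ,
      F (φ.compAddMonoidHom (Ideal.Quotient.mk I).toAddMonoidHom) := by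
  symm
  refine Finset.sum_bij (fun φ _ => φ.compAddMonoidHom (Ideal.Quotient.mk I).toAddMonoidHom)
    ?_ ?_ ?_ (fun _ _ => rfl)
  · intro φ _
    rw [mem_perp hI]
    intro x hx
    have : Ideal.Quotient.mk I x = 0 := Ideal.Quotient.eq_zero_iff_mem.2 hx
    simp [AddChar.compAddMonoidHom_apply, this]
  · intro φ _ φ' _ he
    exact AddChar.compAddMonoidHom_injective_left _ Ideal.Quotient.mk_surjective he
  · intro ψ hψ
    obtain ⟨φ, hφ⟩ := exists_addChar_quotient ((mem_perp hI).1 hψ)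
    exact ⟨φ, Finset.mem_univ _, hφ⟩

theorem sum_perp_apply {I : Ideal (𝓞 K)} (hI : I ≠ ⊥) (x : 𝓞 K) [Decidable (x ∈ I)] :
    ∑ ψ ∈ perp I, ψ x = if x ∈ I then (Ideal.absNorm I : ℂ) else 0 := by
  classical
  have := finite_quotient hI
  have := Fintype.ofFinite (𝓞 K ⧸ I)
  have := Fintype.ofFinite (AddChar (𝓞 K ⧸ I) ℂ)
  rw [sum_perp_eq hI]
  have h := AddChar.sum_apply_eq_ite (Ideal.Quotient.mk I x)
  rw [Ideal.Quotient.eq_zero_iff_mem] at h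
  rw [Ideal.absNorm_apply, Submodule.cardQuot_apply, Nat.card_eq_fintype_card]
  convert h
  rfl

theorem card_perp {I : Ideal (𝓞 K)} (hI : I ≠ ⊥) : (perp I).card = Ideal.absNorm I := by
  classical
  have h := sum_perp_apply hI 0
  simp only [AddChar.map_zero_eq_one, Finset.sum_const, Submodule.zero_mem, if_true,
    nsmul_eq_mul, mul_one] at h
  exact_mod_cast h

theorem mem_perp_span {m : 𝓞 K} (hm : m ≠ 0) {ψ : AddChar (𝓞 K) ℂ} :
    ψ ∈ perp (Ideal.span {m}) ↔ ∀ x, ψ (m * x) = 1 := by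
  rw [mem_perp (by simpa using hm)]
  constructor
  · intro h x
    exact h _ (Ideal.mem_span_singleton.2 (dvd_mul_right m x))
  · intro h x hx
    obtain ⟨y, rfl⟩ := Ideal.mem_span_singleton.1 hx
    exact h y

theorem sum_perp_span_apply {m : 𝓞 K} (hm : m ≠ 0) (x : 𝓞 K) [Decidable (m ∣ x)] :
    ∑ ψ ∈ perp (Ideal.span {m}), ψ x = if m ∣ x then (absNorm m : ℂ) else 0 := by
  classical
  rw [sum_perp_apply (by simpa using hm), absNorm_eq_ideal]
  simp only [Ideal.mem_span_singleton, Complex.ofReal_natCast]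

theorem card_perp_span {m : 𝓞 K} (hm : m ≠ 0) :
    ((perp (Ideal.span {m})).card : ℝ) = absNorm m := by
  rw [card_perp (by simpa using hm), absNorm_eq_ideal]

theorem addChar_map_sum {A ι : Type*} [AddCommMonoid A] (ψ : AddChar A ℂ) (s : Finset ι)
    (x : ι → A) : ψ (∑ i ∈ s, x i) = ∏ i ∈ s, ψ (x i) := by
  classical
  induction s using Finset.induction_on with
  | empty => simp
  | insert i s hi ih => rw [Finset.sum_insert hi, Finset.prod_insert hi, AddChar.map_add_eq_mul, ih]

/-- The norm `N` of `I` lies in `I`, so `ψ` takes values `e(a_i / N)` on an integral basis, and the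
dual basis assembles the exponents into `t`. Thus the Fourier property, which allows every `t ∈ K`,
applies to sums twisted by characters modulo `m` or `q^ρ`. -/
theorem exists_eq_trChar {I : Ideal (𝓞 K)} (hI : I ≠ ⊥) {ψ : AddChar (𝓞 K) ℂ}
    (hψ : ψ ∈ perp I) : ∃ t : K, ψ = trChar t := by
  set w := RingOfIntegers.basis K
  set N := Ideal.absNorm I
  have hN : N ≠ 0 := by
    have := finite_quotient hI
    exact (Ideal.absNorm_ne_zero_iff I).2 this
  have : NeZero N := ⟨hN⟩
  have hpow : ∀ i, ψ (w i) ^ N = 1 := by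
    intro i
    rw [← AddChar.map_nsmul_eq_pow, nsmul_eq_mul]
    exact (mem_perp hI).1 hψ _ (I.mul_mem_right _ (Ideal.absNorm_mem I))
  have hex : ∀ i, ∃ a : ℕ, ψ (w i) = Complex.exp (2 * Real.pi * Complex.I * ((a / N : ℚ) : ℂ)) := by
    intro i
    obtain ⟨a, -, ha⟩ := (Complex.isPrimitiveRoot_exp N hN).eq_pow_of_pow_eq_one (hpow i)
    refine ⟨a, ?_⟩
    rw [← ha, ← Complex.exp_nat_mul]
    congr 1
    push_cast
    ring
  choose a ha using hex
  let b : Module.Basis _ ℚ K := w.localizationLocalization ℚ (nonZeroDivisors ℤ) K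
  classical
  let t : K := ∑ i, (a i / N : ℚ) • b.traceDual i
  have ht : ∀ j, Algebra.trace ℚ K (t * (w j : K)) = a j / N := by
    intro j
    have hb : b j = (w j : K) := by simp [b]
    rw [← hb, Finset.sum_mul, map_sum]
    simp
  refine ⟨t, ?_⟩
  ext x
  rw [← w.sum_repr x, addChar_map_sum, addChar_map_sum]
  refine Finset.prod_congr rfl fun j _ => ?_
  rw [AddChar.map_zsmul_eq_zpow, AddChar.map_zsmul_eq_zpow, ha, trChar_apply, ht]

theorem norm_apply_of_mem_perp {I : Ideal (𝓞 K)} (hI : I ≠ ⊥) {ψ : AddChar (𝓞 K) ℂ}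
    (hψ : ψ ∈ perp I) (x : 𝓞 K) : ‖ψ x‖ = 1 := by
  obtain ⟨t, rfl⟩ := exists_eq_trChar hI hψ
  exact norm_trChar t x

end Characters

/-! ### A large sieve inequality for digit sets. -/

section LargeSieve

variable {K : Type*} [Field K] [NumberField K]

/-- Parseval on `𝓞/(X)`: by `hU`, each residue class contains at most one point of `U`. -/
theorem sum_perp_norm_sq {X : 𝓞 K} (hX : X ≠ 0) (U : Finset (𝓞 K))
    (hU : ∀ u ∈ U, ∀ v ∈ U, X ∣ u - v → u = v) (b : 𝓞 K → ℂ) :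
    ∑ χ ∈ perp (Ideal.span {X}), ‖∑ u ∈ U, b u * χ u‖ ^ 2 = absNorm X * ∑ u ∈ U, ‖b u‖ ^ 2 := by
  classical
  have hI : Ideal.span {X} ≠ ⊥ := by simpa using hX
  have h1 : ∀ χ ∈ perp (Ideal.span {X}), ((‖∑ u ∈ U, b u * χ u‖ ^ 2 : ℝ) : ℂ) =
      ∑ u ∈ U, ∑ v ∈ U, b u * (starRingEnd ℂ) (b v) * χ (u - v) := by
    intro χ hχ
    rw [Complex.ofReal_pow, ← Complex.mul_conj', map_sum, Finset.sum_mul_sum]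
    refine Finset.sum_congr rfl fun u _ => Finset.sum_congr rfl fun v _ => ?_
    have hv : (starRingEnd ℂ) (χ v) = χ (-v) := by
      rw [AddChar.map_neg_eq_inv, Complex.inv_def, Complex.normSq_eq_norm_sq,
        norm_apply_of_mem_perp hI hχ]
      simp
    rw [map_mul, hv, sub_eq_add_neg, AddChar.map_add_eq_mul]
    ring
  have h2 : ((∑ χ ∈ perp (Ideal.span {X}), ‖∑ u ∈ U, b u * χ u‖ ^ 2 : ℝ) : ℂ) =
      ((absNorm X * ∑ u ∈ U, ‖b u‖ ^ 2 : ℝ) : ℂ) := by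
    rw [Complex.ofReal_sum, Finset.sum_congr rfl h1, Finset.sum_comm, Complex.ofReal_mul,
      Complex.ofReal_sum, Finset.mul_sum]
    refine Finset.sum_congr rfl fun u hu => ?_
    rw [Finset.sum_comm, Finset.sum_eq_single u]
    · rw [← Finset.mul_sum, sum_perp_span_apply hX, if_pos (by simp), Complex.ofReal_pow,
        ← Complex.mul_conj']
      ring
    · intro v hv hvu
      rw [← Finset.mul_sum, sum_perp_span_apply hX, if_neg fun hd => hvu (hU u hu v hv hd).symm,
        mul_zero]
    · exact fun h => absurd hu h
  exact_mod_cast h2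

/-- A discrete form of thickening each frequency to a ball. Since every `B i` is close to `1` on
`U`, the sum `g` of the `B i` satisfies `|g| ≥ n/2` there. Dividing the coefficients by `g` writes
the sum at `α` as a sum of values `F(α * B i)`. Cauchy–Schwarz in `i`, then Parseval over the
distinct characters `α * B i` modulo `X`, gives the bound. -/
theorem sum_norm_sq_le_of_disjoint_translates {ι : Type*} [Fintype ι] [Nonempty ι] {X : 𝓞 K}
    (hX : X ≠ 0) (U : Finset (𝓞 K)) (hU : ∀ u ∈ U, ∀ v ∈ U, X ∣ u - v → u = v)
    (A : Finset (AddChar (𝓞 K) ℂ)) (B : ι → AddChar (𝓞 K) ℂ)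
    (hmem : ∀ α ∈ A, ∀ i, α * B i ∈ perp (Ideal.span {X}))
    (hinj : ∀ α ∈ A, ∀ β ∈ A, ∀ i j, α * B i = β * B j → α = β ∧ i = j)
    (hre : ∀ u ∈ U, ∀ i, 1 / 2 ≤ (B i u).re) (a : 𝓞 K → ℂ) :
    ∑ α ∈ A, ‖∑ u ∈ U, a u * α u‖ ^ 2 ≤
      4 * (absNorm X / Fintype.card ι) * ∑ u ∈ U, ‖a u‖ ^ 2 := by
  classical
  set n : ℝ := ((Fintype.card ι : ℕ) : ℝ) with hn
  have hnpos : 0 < n := by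
    rw [hn]
    exact_mod_cast Fintype.card_pos
  let g : 𝓞 K → ℂ := fun u => ∑ i, B i u
  have hg : ∀ u ∈ U, n / 2 ≤ ‖g u‖ := by
    intro u hu
    refine le_trans ?_ (Complex.re_le_norm _)
    rw [Complex.re_sum]
    have := Finset.sum_le_sum fun i (_ : i ∈ (Finset.univ : Finset ι)) => hre u hu i
    simp only [Finset.sum_const, Finset.card_univ, nsmul_eq_mul] at this
    linarith
  let F : AddChar (𝓞 K) ℂ → ℂ := fun χ => ∑ u ∈ U, a u / g u * χ u
  have hF : ∀ α : AddChar (𝓞 K) ℂ, ∑ u ∈ U, a u * α u = ∑ i, F (α * B i) := by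
    intro α
    rw [Finset.sum_comm]
    refine Finset.sum_congr rfl fun u hu => ?_
    have hgu : g u ≠ 0 := by
      have := hg u hu
      exact norm_pos_iff.1 (by linarith)
    simp only [AddChar.mul_apply]
    calc a u * α u = a u / g u * α u * g u := by field_simp
      _ = _ := by
        rw [Finset.mul_sum]
        exact Finset.sum_congr rfl fun i _ => by ring
  have h1 : ∀ α ∈ A, ‖∑ u ∈ U, a u * α u‖ ^ 2 ≤ n * ∑ i, ‖F (α * B i)‖ ^ 2 := by
    intro α _
    rw [hF]
    refine (pow_le_pow_left₀ (norm_nonneg _) (norm_sum_le _ _) 2).trans ?_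
    exact sq_sum_le_card_mul_sum_sq
  have h2 : ∑ α ∈ A, ∑ i, ‖F (α * B i)‖ ^ 2 ≤ ∑ χ ∈ perp (Ideal.span {X}), ‖F χ‖ ^ 2 := by
    rw [← Finset.sum_product']
    rw [← Finset.sum_image (s := A ×ˢ Finset.univ) (g := fun p : AddChar (𝓞 K) ℂ × ι => p.1 * B p.2)
      (f := fun χ => ‖F χ‖ ^ 2)]
    · refine Finset.sum_le_sum_of_subset_of_nonneg ?_ fun _ _ _ => by positivity
      intro χ hχ
      obtain ⟨⟨α, i⟩, hp, rfl⟩ := Finset.mem_image.1 hχ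
      exact hmem α (Finset.mem_product.1 hp).1 i
    · rintro ⟨α, i⟩ hp ⟨β, j⟩ hp' he
      obtain ⟨h1, h2⟩ := hinj α (Finset.mem_product.1 hp).1 β (Finset.mem_product.1 hp').1 i j he
      exact Prod.ext h1 h2
  have h3 : ∑ u ∈ U, ‖a u / g u‖ ^ 2 ≤ (2 / n) ^ 2 * ∑ u ∈ U, ‖a u‖ ^ 2 := by
    rw [Finset.mul_sum]
    refine Finset.sum_le_sum fun u hu => ?_
    rw [norm_div, ← mul_pow]
    refine pow_le_pow_left₀ (by positivity) ?_ 2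
    have := hg u hu
    rw [div_le_iff₀ (by linarith)]
    calc ‖a u‖ = 2 / n * ‖a u‖ * (n / 2) := by field_simp
      _ ≤ _ := by gcongr
  calc ∑ α ∈ A, ‖∑ u ∈ U, a u * α u‖ ^ 2 ≤ ∑ α ∈ A, n * ∑ i, ‖F (α * B i)‖ ^ 2 :=
        Finset.sum_le_sum h1
    _ = n * ∑ α ∈ A, ∑ i, ‖F (α * B i)‖ ^ 2 := by rw [Finset.mul_sum]
    _ ≤ n * ∑ χ ∈ perp (Ideal.span {X}), ‖F χ‖ ^ 2 := by gcongr
    _ = n * (absNorm X * ∑ u ∈ U, ‖a u / g u‖ ^ 2) := by rw [sum_perp_norm_sq hX U hU]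
    _ ≤ n * (absNorm X * ((2 / n) ^ 2 * ∑ u ∈ U, ‖a u‖ ^ 2)) := by
        have := absNorm_pos hX
        gcongr
    _ = _ := by
        field_simp
        ring

variable {d : ℕ} {q : 𝓞 K} {D : Finset (𝓞 K)}

/-- The characters of `𝓞 K` that are trivial on the multiples of some nonzero `m ∈ 𝒩_μ`. -/
def sieveSet (q : 𝓞 K) (D : Finset (𝓞 K)) (μ : ℕ) : Finset (AddChar (𝓞 K) ℂ) :=
  open Classical in
  ((digitSet q D μ).erase 0).biUnion fun m => perp (Ideal.span {m})

theorem mem_sieveSet {μ : ℕ} {ψ : AddChar (𝓞 K) ℂ} :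
    ψ ∈ sieveSet q D μ ↔ ∃ m ∈ digitSet q D μ, m ≠ 0 ∧ ψ ∈ perp (Ideal.span {m}) := by
  simp only [sieveSet, Finset.mem_biUnion, Finset.mem_erase]
  exact exists_congr fun m => by tauto

theorem absNorm_natCast (w : Module.Basis (Fin d) ℤ (𝓞 K)) (n : ℕ) :
    absNorm (n : 𝓞 K) = (n : ℝ) ^ d := by
  have h := Algebra.norm_algebraMap_of_basis w (n : ℤ)
  rw [Fintype.card_fin] at h
  rw [absNorm, show ((n : 𝓞 K)) = algebraMap ℤ (𝓞 K) (n : ℤ) by simp, h]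
  simp

theorem exists_basis_bound (w : Module.Basis (Fin d) ℤ (𝓞 K)) :
    ∃ W : ℝ, 0 ≤ W ∧ ∀ (σ : K →+* ℂ) (i : Fin d),
      ‖σ (w i : K)‖ ≤ W ∧ ‖σ ((ratBasis w).traceDual i)‖ ≤ W := by
  let F : (K →+* ℂ) × Fin d → ℝ := fun p => ‖p.1 (w p.2 : K)‖ + ‖p.1 ((ratBasis w).traceDual p.2)‖
  have hF : ∀ p, 0 ≤ F p := fun p => by positivity
  refine ⟨∑ p, F p, Finset.sum_nonneg fun p _ => hF p, fun σ i => ?_⟩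
  have h := Finset.single_le_sum (fun p _ => hF p) (Finset.mem_univ (σ, i))
  have h1 : ‖σ (w i : K)‖ + ‖σ ((ratBasis w).traceDual i)‖ ≤ ∑ p, F p := h
  constructor
  · linarith [norm_nonneg (σ ((ratBasis w).traceDual i))]
  · linarith [norm_nonneg (σ (w i : K))]

theorem norm_sum_smul_traceDual_le {w : Module.Basis (Fin d) ℤ (𝓞 K)} {W : ℝ}
    (hW : ∀ (σ : K →+* ℂ) (i : Fin d), ‖σ ((ratBasis w).traceDual i)‖ ≤ W) (σ : K →+* ℂ)
    {c : Fin d → ℚ} {ε : ℝ} (hε : 0 ≤ ε) (hc : ∀ i, |(c i : ℝ)| ≤ ε) :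
    ‖σ (∑ i, c i • (ratBasis w).traceDual i)‖ ≤ d * (ε * W) := by
  rw [map_sum]
  refine (norm_sum_le _ _).trans ?_
  have : ∀ i ∈ Finset.univ, ‖σ (c i • (ratBasis w).traceDual i)‖ ≤ ε * W := by
    intro i _
    rw [Algebra.smul_def, map_mul, norm_mul]
    have h1 : ‖σ (algebraMap ℚ K (c i))‖ = |(c i : ℝ)| := by
      simp [Complex.norm_ratCast]
    rw [h1]
    exact mul_le_mul (hc i) (hW σ i) (norm_nonneg _) hε
  refine (Finset.sum_le_sum this).trans ?_
  simp

theorem mem_perp_span_of_dvd {m X : 𝓞 K} (hX : X ≠ 0) (hd : m ∣ X) {ψ : AddChar (𝓞 K) ℂ}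
    (hψ : ψ ∈ perp (Ideal.span {m})) : ψ ∈ perp (Ideal.span {X}) := by
  obtain ⟨c, rfl⟩ := hd
  rw [mem_perp_span hX]
  intro x
  rw [mul_assoc]
  exact (mem_perp_span (left_ne_zero_of_mul hX)).1 hψ _

/-- The translates are by the characters of frequency `y n`, which run over a grid of `P^d` points
in a small box around `0`, shrunk by `q^(2μ)`. All characters involved live modulo `X`, of norm
`Q^(2μ) (L P)^d`. Dividing by the number of translates removes `P`, and only `L`, independent of
`μ`, remains in the constant. -/
theorem IsFNS.large_sieve (h : IsFNS q D) (w : Module.Basis (Fin d) ℤ (𝓞 K)) :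
    ∃ C : ℝ, 0 < C ∧ ∀ (μ : ℕ) (a : 𝓞 K → ℂ),
      ∑ α ∈ sieveSet q D μ, ‖∑ u ∈ digitSet q D (2 * μ), a u * α u‖ ^ 2 ≤
        C * absNorm q ^ (2 * μ) * ∑ u ∈ digitSet q D (2 * μ), ‖a u‖ ^ 2 := by
  obtain ⟨C, hC1, hC⟩ := h.exists_norm_le
  obtain ⟨W, hW0, hW⟩ := exists_basis_bound w
  set s : ℝ := ((Fintype.card (K →+* ℂ) : ℕ) : ℝ) with hs
  -- `L` must be large enough for both smallness conditions below: real parts at least `1/2` on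
  -- `𝒩_{2μ}` (`hbound1`), and separation of the translates (`hbound2`).
  obtain ⟨L, hL⟩ := exists_nat_gt (8 * (s * (d * W * (C ^ 2 * (1 + W)))))
  have hL0 : (0 : ℝ) < L := lt_of_le_of_lt (by positivity) hL
  have hbound1 : s * (d * (1 / L * W) * C) ≤ 1 / 8 := by
    have : s * (d * W * C) ≤ s * (d * W * (C ^ 2 * (1 + W))) := by
      gcongr
      nlinarith
    calc s * (d * (1 / L * W) * C) = s * (d * W * C) / L := by ring
      _ ≤ 1 / 8 := by
        rw [div_le_iff₀ hL0]
        linarith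
  have hbound2 : s * (d * (1 / L * W) * C ^ 2 * W) < 1 := by
    have : s * (d * W * (C ^ 2 * W)) ≤ s * (d * W * (C ^ 2 * (1 + W))) := by
      gcongr
      linarith
    calc s * (d * (1 / L * W) * C ^ 2 * W) = s * (d * W * (C ^ 2 * W)) / L := by ring
      _ < 1 := by
        rw [div_lt_iff₀ hL0]
        nlinarith [show 0 ≤ s * (d * W * (C ^ 2 * (1 + W))) by positivity]
  refine ⟨4 * (L : ℝ) ^ d, by positivity, fun μ a => ?_⟩
  classical
  -- A common multiple of all nonzero `m ∈ 𝒩_μ`, so that a single modulus `X` carries every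
  -- character of the sieve set.
  let P : ℕ := ∏ m ∈ (digitSet q D μ).erase 0, Ideal.absNorm (Ideal.span {m})
  have hP : P ≠ 0 := by
    refine Finset.prod_ne_zero_iff.2 fun m hm => ?_
    have := absNorm_pos (Finset.mem_erase.1 hm).1
    rw [absNorm_eq_ideal] at this
    exact_mod_cast this.ne'
  have hP0 : (0 : ℝ) < P := by exact_mod_cast Nat.pos_of_ne_zero hP
  have : NeZero P := ⟨hP⟩
  have hLN : L ≠ 0 := by exact_mod_cast hL0.ne'
  let X : 𝓞 K := q ^ (2 * μ) * (L * P : ℕ)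
  have hqp : q ^ (2 * μ) ≠ 0 := pow_ne_zero _ h.ne_zero
  have hX : X ≠ 0 := mul_ne_zero hqp (Nat.cast_ne_zero.2 (mul_ne_zero hLN hP))
  have hqK : (q : K) ≠ 0 := h.coe_ne_zero
  have hmX : ∀ m ∈ digitSet q D μ, m ≠ 0 → m ∣ X := by
    intro m hm hm0
    have h1 : m ∣ ((Ideal.absNorm (Ideal.span {m}) : ℕ) : 𝓞 K) :=
      Ideal.mem_span_singleton.1 (Ideal.absNorm_mem _)
    have h2 : Ideal.absNorm (Ideal.span {m}) ∣ P :=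
      Finset.dvd_prod_of_mem _ (Finset.mem_erase.2 ⟨hm0, hm⟩)
    exact (h1.trans (Nat.cast_dvd_cast (h2.trans (dvd_mul_left P L)))).trans (dvd_mul_left _ _)
  let z : (Fin d → Fin P) → K := fun n =>
    ∑ i, ((n i : ℕ) / (L * P) : ℚ) • (ratBasis w).traceDual i
  let y : (Fin d → Fin P) → K := fun n => z n / (q : K) ^ (2 * μ)
  have hq0 : ∀ σ : K →+* ℂ, 0 < ‖σ (q : K)‖ := fun σ => by linarith [h.one_lt_conj σ]
  have hz : ∀ n (σ : K →+* ℂ), ‖σ (z n)‖ ≤ d * (1 / L * W) := by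
    intro n σ
    refine norm_sum_smul_traceDual_le (fun σ i => (hW σ i).2) σ (by positivity) fun i => ?_
    have h1 : ((n i : ℕ) : ℝ) ≤ P := by exact_mod_cast (n i).2.le
    push_cast
    rw [abs_of_nonneg (by positivity), div_le_div_iff₀ (by positivity) hL0]
    nlinarith
  have hzz : ∀ n n' (σ : K →+* ℂ), ‖σ (z n - z n')‖ ≤ d * (1 / L * W) := by
    intro n n' σ
    have hsub : z n - z n' =
        ∑ i, (((n i : ℕ) / (L * P) : ℚ) - ((n' i : ℕ) / (L * P) : ℚ)) •
          (ratBasis w).traceDual i := by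
      simp only [z, sub_smul, Finset.sum_sub_distrib]
    rw [hsub]
    refine norm_sum_smul_traceDual_le (fun σ i => (hW σ i).2) σ (by positivity) fun i => ?_
    have h1 : ((n i : ℕ) : ℝ) ≤ P := by exact_mod_cast (n i).2.le
    have h2 : ((n' i : ℕ) : ℝ) ≤ P := by exact_mod_cast (n' i).2.le
    have h3 : (0 : ℝ) ≤ (n i : ℕ) := by positivity
    have h4 : (0 : ℝ) ≤ (n' i : ℕ) := by positivity
    push_cast
    rw [← sub_div, abs_div, abs_of_pos (show (0 : ℝ) < L * P by positivity),
      div_le_div_iff₀ (by positivity) hL0]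
    have : |((n i : ℕ) : ℝ) - (n' i : ℕ)| ≤ P := abs_sub_le_iff.2 ⟨by linarith, by linarith⟩
    nlinarith
  have hyX : ∀ n, trChar (y n) ∈ perp (Ideal.span {X}) := by
    intro n
    rw [mem_perp_span hX]
    intro x
    rw [trChar_apply_eq_one_iff]
    have h1 : y n * ((X * x : 𝓞 K) : K) =
        (∑ i, ((n i : ℕ) : ℚ) • (ratBasis w).traceDual i) * (x : K) := by
      have h2 : (∑ i, ((n i : ℕ) : ℚ) • (ratBasis w).traceDual i) = ((L * P : ℕ) : K) * z n := by
        simp only [z, Finset.mul_sum]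
        refine Finset.sum_congr rfl fun i _ => ?_
        rw [show ((L * P : ℕ) : K) = algebraMap ℚ K ((L * P : ℕ) : ℚ) by simp,
          ← Algebra.smul_def, smul_smul]
        congr 1
        push_cast
        field_simp
      rw [h2]
      simp only [y, X]
      push_cast
      field_simp
    rw [h1, ← w.sum_repr x]
    refine ⟨∑ j, w.repr x j * (n j : ℕ), ?_⟩
    have h2 : ((∑ j, w.repr x j • w j : 𝓞 K) : K) = ∑ j, (w.repr x j : ℚ) • (w j : K) := by
      simp [Algebra.smul_def]
    rw [h2, Finset.mul_sum, map_sum]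
    push_cast
    refine Finset.sum_congr rfl fun j _ => ?_
    rw [mul_smul_comm, map_smul, trace_sum_smul_traceDual_mul, smul_eq_mul]
  have key := sum_norm_sq_le_of_disjoint_translates hX (digitSet q D (2 * μ))
    (fun u hu v hv hd => h.digitSet_unique hu hv ((dvd_mul_right _ _).trans hd))
    (sieveSet q D μ) (fun n => trChar (y n)) ?_ ?_ ?_ a
  · refine key.trans_eq ?_
    have h1 : absNorm X = absNorm q ^ (2 * μ) * ((L : ℝ) * P) ^ d := by
      rw [absNorm_mul, absNorm_pow, absNorm_natCast w]
      push_cast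
      rfl
    rw [h1]
    simp only [Fintype.card_pi, Fintype.card_fin, Finset.prod_const, Finset.card_univ]
    push_cast
    rw [mul_pow]
    field_simp
  · intro α hα n
    obtain ⟨m, hm, hm0, hαm⟩ := mem_sieveSet.1 hα
    have h1 := mem_perp_span_of_dvd hX (hmX m hm hm0) hαm
    rw [mem_perp_span hX] at h1 ⊢
    intro x
    rw [AddChar.mul_apply, h1, (mem_perp_span hX).1 (hyX n), one_mul]
  · intro α hα β hβ n n' he
    obtain ⟨m, hm, hm0, hαm⟩ := mem_sieveSet.1 hα
    obtain ⟨m', hm', hm0', hβm⟩ := mem_sieveSet.1 hβ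
    rw [mem_perp_span hm0] at hαm
    rw [mem_perp_span hm0'] at hβm
    -- On multiples of `m * m'` both `α` and `β` are trivial, so there the two small characters
    -- coincide.
    have hone : ∀ x, trChar (y n - y n') (m * m' * x) = 1 := by
      intro x
      have h1 := DFunLike.congr_fun he (m * m' * x)
      simp only [AddChar.mul_apply] at h1
      have hα1 : α (m * m' * x) = 1 := by rw [mul_assoc, hαm]
      have hβ1 : β (m * m' * x) = 1 := by rw [mul_comm m, mul_assoc, hβm]
      rw [hα1, hβ1, one_mul, one_mul, ← sub_add_cancel (y n) (y n'), trChar_add,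
        AddChar.mul_apply] at h1
      exact mul_right_cancel₀ (norm_ne_zero_iff.1 (by simp)) (h1.trans (one_mul _).symm)
    have hzero : (y n - y n') * (m * m' : K) = 0 := by
      refine eq_zero_of_forall_trace_mul_eq_zero w fun i => ?_
      obtain ⟨k, hk⟩ := (trChar_apply_eq_one_iff _ _).1 (hone (w i))
      push_cast at hk
      rw [← mul_assoc] at hk
      rw [hk]
      -- An integer of modulus less than `1` vanishes. The two factors `m` and `m'` each have the
      -- size of `q^μ`, exactly compensating the `q^(2μ)` in the denominator of `y`.
      have hlt : |(k : ℝ)| < 1 := by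
        have h1 := abs_trace_le ((y n - y n') * (m * m' : K) * (w i : K))
        rw [hk] at h1
        push_cast at h1
        refine lt_of_le_of_lt (h1.trans ?_) hbound2
        have h2 : ∀ σ ∈ (Finset.univ : Finset (K →+* ℂ)),
            ‖σ ((y n - y n') * (m * m' : K) * (w i : K))‖ ≤ d * (1 / L * W) * C ^ 2 * W := by
          intro σ _
          have e1 : (y n - y n') * (m * m' : K) * (w i : K) =
              (z n - z n') * ((m : K) / (q : K) ^ μ * ((m' : K) / (q : K) ^ μ)) * (w i : K) := by
            simp only [y]
            field_simp
            ring
          rw [e1, map_mul, map_mul, map_mul, norm_mul, norm_mul, norm_mul]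
          have e2 : ∀ m ∈ digitSet q D μ, ‖σ ((m : K) / (q : K) ^ μ)‖ ≤ C := by
            intro m hm
            rw [map_div₀, norm_div, map_pow, norm_pow, div_le_iff₀ (pow_pos (hq0 σ) _)]
            exact hC μ m hm σ
          have e3 := hzz n n' σ
          have e4 := (hW σ i).1
          have e5 := e2 m hm
          have e6 := e2 m' hm'
          rw [sq]
          gcongr
        refine (Finset.sum_le_sum h2).trans ?_
        simp [hs]
      have : k = 0 := by
        have : |k| < 1 := by exact_mod_cast hlt
        exact Int.abs_lt_one_iff.1 this
      simp [this]
    have hmm : (m * m' : K) ≠ 0 := by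
      simpa using And.intro hm0 hm0'
    have hy : y n = y n' := sub_eq_zero.1 ((mul_eq_zero.1 hzero).resolve_right hmm)
    have hzeq : z n = z n' := by
      simp only [y] at hy
      exact (div_left_inj' (pow_ne_zero _ hqK)).1 hy
    have hnn : n = n' := by
      funext i
      have h1 := trace_sum_smul_traceDual_mul w (fun i => ((n i : ℕ) / (L * P) : ℚ)) i
      have h2 := trace_sum_smul_traceDual_mul w (fun i => ((n' i : ℕ) / (L * P) : ℚ)) i
      have h3 : Algebra.trace ℚ K (z n * (w i : K)) = Algebra.trace ℚ K (z n' * (w i : K)) := by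
        rw [hzeq]
      have h4 : ((n i : ℕ) / (L * P) : ℚ) = ((n' i : ℕ) / (L * P) : ℚ) :=
        h1.symm.trans (h3.trans h2)
      have hLP : ((L : ℚ) * P) ≠ 0 := by
        exact_mod_cast mul_ne_zero hLN hP
      rw [div_left_inj' hLP] at h4
      exact Fin.ext (by exact_mod_cast h4)
    subst hnn
    exact ⟨mul_right_cancel he, rfl⟩
  · intro u hu n
    refine half_le_re_trChar ((abs_trace_le _).trans (le_trans ?_ hbound1))
    have h2 : ∀ σ ∈ (Finset.univ : Finset (K →+* ℂ)),
        ‖σ (y n * (u : K))‖ ≤ d * (1 / L * W) * C := by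
      intro σ _
      rw [show y n * (u : K) = z n * ((u : K) / (q : K) ^ (2 * μ)) by simp only [y]; field_simp,
        map_mul, norm_mul]
      have e3 := hz n σ
      have e2 : ‖σ ((u : K) / (q : K) ^ (2 * μ))‖ ≤ C := by
        rw [map_div₀, norm_div, map_pow, norm_pow, div_le_iff₀ (pow_pos (hq0 σ) _)]
        exact hC _ u hu σ
      gcongr
    refine (Finset.sum_le_sum h2).trans ?_
    simp [hs]

end LargeSieve

/-! ### Counting integers and ideals; sums of inverse norms. -/

section Counting

variable {K : Type*} [Field K] [NumberField K] {d : ℕ} {q : 𝓞 K} {D : Finset (𝓞 K)}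

theorem exists_round (K : Type*) [Field K] [NumberField K] :
    ∃ C : ℝ, 0 ≤ C ∧ ∀ y : K, ∃ n : 𝓞 K, ∀ σ : K →+* ℂ, ‖σ (y - n)‖ ≤ C := by
  let w := (RingOfIntegers.basis K)
  let b : Module.Basis _ ℚ K := w.localizationLocalization ℚ (nonZeroDivisors ℤ) K
  refine ⟨∑ i, ∑ σ : K →+* ℂ, ‖σ (w i : K)‖, by positivity, fun y => ?_⟩
  refine ⟨∑ i, ⌊b.repr y i⌋ • w i, fun σ => ?_⟩
  have h1 : y - ((∑ i, ⌊b.repr y i⌋ • w i : 𝓞 K) : K) =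
      ∑ i, (Int.fract (b.repr y i)) • (w i : K) := by
    have hb : ∀ i, b i = (w i : K) := fun i => by simp [b]
    have hy := b.sum_repr y
    have h2 : ((∑ i, ⌊b.repr y i⌋ • w i : 𝓞 K) : K) = ∑ i, (⌊b.repr y i⌋ : ℚ) • (w i : K) := by
      simp [Algebra.smul_def]
    rw [h2]
    nth_rewrite 1 [← hy]
    rw [← Finset.sum_sub_distrib]
    refine Finset.sum_congr rfl fun i _ => ?_
    rw [hb, ← sub_smul, Int.self_sub_floor]
  rw [h1, map_sum]
  refine (norm_sum_le _ _).trans (Finset.sum_le_sum fun i _ => ?_)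
  refine le_trans ?_ (Finset.single_le_sum (f := fun σ : K →+* ℂ => ‖σ (w i : K)‖)
    (fun _ _ => by positivity) (Finset.mem_univ σ))
  rw [Algebra.smul_def, map_mul, norm_mul]
  refine mul_le_of_le_one_left (norm_nonneg _) ?_
  have h3 : ‖σ (algebraMap ℚ K (Int.fract (b.repr y i)))‖ =
      |((Int.fract (b.repr y i) : ℚ) : ℝ)| := by
    simp only [eq_ratCast, map_ratCast, Complex.norm_ratCast]
  rw [h3, abs_of_nonneg (by exact_mod_cast Int.fract_nonneg _)]
  exact_mod_cast (Int.fract_lt_one _).le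

theorem exists_small_residue (K : Type*) [Field K] [NumberField K] :
    ∃ C : ℝ, 0 ≤ C ∧ ∀ m : 𝓞 K, m ≠ 0 → ∀ x : 𝓞 K, ∃ t : 𝓞 K, m ∣ x - t ∧
      ∀ σ : K →+* ℂ, ‖σ (t : K)‖ ≤ C * ‖σ (m : K)‖ := by
  obtain ⟨C, hC0, hC⟩ := exists_round K
  refine ⟨C, hC0, fun m hm x => ?_⟩
  obtain ⟨n, hn⟩ := hC ((x : K) / (m : K))
  refine ⟨x - m * n, ⟨n, by ring⟩, fun σ => ?_⟩
  have hmK : (m : K) ≠ 0 := by simpa using hm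
  have h1 : ((x - m * n : 𝓞 K) : K) = ((x : K) / (m : K) - n) * m := by
    push_cast
    field_simp
  rw [h1, map_mul, norm_mul]
  gcongr
  exact hn σ

/-- Dividing by `q^κ` with remainder in `𝒩_κ` leaves a quotient with bounded conjugates, hence
boundedly many quotients for each of the `Q^κ` remainders. -/
theorem IsFNS.card_le_of_bounded (h : IsFNS q D) (R : ℝ) :
    ∃ C : ℝ, 0 ≤ C ∧ ∀ (κ : ℕ) (S : Finset (𝓞 K)),
      (∀ x ∈ S, ∀ σ : K →+* ℂ, ‖σ (x : K)‖ ≤ R * ‖σ (q : K)‖ ^ κ) →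
      (S.card : ℝ) ≤ C * absNorm q ^ κ := by
  obtain ⟨C, hC1, hC⟩ := h.exists_norm_le
  let F := (finite_bounded (K := K) (R + C)).toFinset
  refine ⟨F.card, by positivity, fun κ S hS => ?_⟩
  rw [← h.card_digitSet, mul_comm, ← Nat.cast_mul, ← Finset.card_product, Nat.cast_le]
  choose s hs using h.dvd_sub_lowDigits κ
  refine Finset.card_le_card_of_injOn (fun x => (lowDigits q D κ x, s x)) ?_ ?_
  · intro x hx
    refine Finset.mem_coe.2 (Finset.mem_product.2 ⟨h.lowDigits_mem κ x, ?_⟩)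
    simp only [F, Set.Finite.mem_toFinset, Set.mem_ofPred_eq]
    intro σ
    have hq0 : 0 < ‖σ (q : K)‖ ^ κ := pow_pos (by linarith [h.one_lt_conj σ]) κ
    have h1 : σ (q : K) ^ κ * σ (s x : K) = σ (x : K) - σ (lowDigits q D κ x : K) := by
      rw [← map_sub, ← map_pow, ← map_mul]
      congr 1
      exact_mod_cast (hs x).symm
    have h2 : ‖σ (q : K)‖ ^ κ * ‖σ (s x : K)‖ ≤ ‖σ (q : K)‖ ^ κ * (R + C) := by
      rw [← norm_pow, ← norm_mul, h1]
      refine (norm_sub_le _ _).trans ?_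
      have := hS x hx σ
      have := hC κ _ (h.lowDigits_mem κ x) σ
      rw [norm_pow]
      linarith
    exact le_of_mul_le_mul_left h2 hq0
  · intro x _ y _ hxy
    simp only [Prod.mk.injEq] at hxy
    have h1 := hs x
    have h2 := hs y
    rw [hxy.1, hxy.2, ← h2] at h1
    exact sub_left_injective h1

/-- A packing argument. Elements of `S` are congruent modulo `m`, so adding small representatives of
`𝓞/(m)` yields `|S| N(m)` distinct integers. Since `μ ≤ κ`, their conjugates are still of size `O(‖σ
q‖^κ)`. -/
theorem IsFNS.card_filter_dvd_le (h : IsFNS q D) :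
    ∃ C : ℝ, 0 ≤ C ∧ ∀ μ κ : ℕ, μ ≤ κ → ∀ m ∈ digitSet q D μ, m ≠ 0 → ∀ a : 𝓞 K,
      ∀ S ⊆ digitSet q D κ, (∀ u ∈ S, m ∣ u + a) →
      (S.card : ℝ) ≤ C * absNorm q ^ κ / absNorm m := by
  obtain ⟨C, hC1, hC⟩ := h.exists_norm_le
  obtain ⟨C', hC0', hC'⟩ := exists_small_residue K
  obtain ⟨B, hB0, hB⟩ := h.card_le_of_bounded (C + C' * C)
  refine ⟨B, hB0, fun μ κ hμκ m hm hm0 a S hS hSm => ?_⟩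
  classical
  choose t ht hts using hC' m hm0
  have := finite_quotient (I := Ideal.span {m}) (by simpa using hm0)
  have := Fintype.ofFinite (𝓞 K ⧸ Ideal.span {m})
  have hsurj := Ideal.Quotient.mk_surjective (I := Ideal.span {m})
  let rep : (𝓞 K ⧸ Ideal.span {m}) → 𝓞 K := fun c => t (Function.surjInv hsurj c)
  have hrep : ∀ c, Ideal.Quotient.mk (Ideal.span {m}) (rep c) = c := by
    intro c
    conv_rhs => rw [← Function.surjInv_eq hsurj c]
    symm
    rw [Ideal.Quotient.mk_eq_mk_iff_sub_mem, Ideal.mem_span_singleton]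
    exact ht _
  have hinj : Set.InjOn (fun p : 𝓞 K × (𝓞 K ⧸ Ideal.span {m}) => p.1 + rep p.2)
      (S ×ˢ (Finset.univ : Finset (𝓞 K ⧸ Ideal.span {m})) : Finset _) := by
    rintro ⟨u, c⟩ hp ⟨v, c'⟩ hp' he
    have hu := (Finset.mem_product.1 (Finset.mem_coe.1 hp)).1
    have hv := (Finset.mem_product.1 (Finset.mem_coe.1 hp')).1
    simp only at hu hv he
    have h1 : c = c' := by
      rw [← hrep c, ← hrep c', Ideal.Quotient.mk_eq_mk_iff_sub_mem, Ideal.mem_span_singleton]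
      have := dvd_sub (hSm v hv) (hSm u hu)
      rwa [show v + a - (u + a) = rep c - rep c' by linear_combination -he] at this
    subst h1
    exact Prod.ext (add_right_cancel he) rfl
  have hcard := hB κ ((S ×ˢ (Finset.univ : Finset (𝓞 K ⧸ Ideal.span {m}))).image
    fun p => p.1 + rep p.2) ?_
  · rw [Finset.card_image_of_injOn hinj, Finset.card_product, Finset.card_univ,
      ← Nat.card_eq_fintype_card, Nat.cast_mul, card_quotient] at hcard
    rwa [le_div_iff₀ (absNorm_pos hm0)]
  · intro x hx σ
    obtain ⟨⟨u, c⟩, hp, rfl⟩ := Finset.mem_image.1 hx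
    have hu := hS (Finset.mem_product.1 hp).1
    have h1 := hC κ u hu σ
    have h2 : ‖σ (rep c : K)‖ ≤ C' * ‖σ (m : K)‖ := hts _ σ
    have h3 := hC μ m hm σ
    have h4 : ‖σ (q : K)‖ ^ μ ≤ ‖σ (q : K)‖ ^ κ :=
      pow_le_pow_right₀ (h.one_lt_conj σ).le hμκ
    push_cast
    rw [map_add]
    calc _ ≤ ‖σ (u : K)‖ + ‖σ (rep c : K)‖ := norm_add_le _ _
      _ ≤ C * ‖σ (q : K)‖ ^ κ + C' * (C * ‖σ (q : K)‖ ^ κ) := by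
          gcongr
          exact h2.trans (by gcongr; exact h3.trans (by gcongr))
      _ = _ := by ring

/-- Add representatives of `𝓞/I` to the elements of `S` and reduce modulo a fixed `m₀ ∈ S`. In a
fibre the representative is determined, as `S` and `m₀` lie in `I`, and the elements of `S` differ
by bounded multiples of `m₀`. So `|S| N(I)` is `O(N(m₀))`, and all norms in `S` are comparable to
`N(m₀)`. -/
theorem exists_sum_inv_absNorm_comparable_le (K : Type*) [Field K] [NumberField K] :
    ∃ C : ℝ, 0 ≤ C ∧ ∀ (I : Ideal (𝓞 K)) (S : Finset (𝓞 K)), (∀ m ∈ S, m ≠ 0 ∧ m ∈ I) →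
      (∀ m ∈ S, ∀ n ∈ S, ∀ σ : K →+* ℂ, ‖σ (m : K)‖ ≤ 2 * ‖σ (n : K)‖) →
      ∑ m ∈ S, 1 / absNorm m ≤ C / Ideal.absNorm I := by
  classical
  -- Two elements of `S` are each at most `2 ‖σ m₀‖`, so their difference is at most `4 ‖σ m₀‖` in
  -- every embedding.
  let F := (finite_bounded (K := K) 4).toFinset
  refine ⟨F.card * 2 ^ Fintype.card (K →+* ℂ), by positivity, fun I S hSI hS => ?_⟩
  rcases S.eq_empty_or_nonempty with rfl | ⟨m₀, hm₀⟩
  · simp only [Finset.sum_empty]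
    positivity
  have hm₀0 := (hSI m₀ hm₀).1
  have hm₀I := (hSI m₀ hm₀).2
  have hI : I ≠ ⊥ := by
    rintro rfl
    exact hm₀0 (by simpa using hm₀I)
  have := finite_quotient hI
  have := Fintype.ofFinite (𝓞 K ⧸ I)
  have := finite_quotient (I := Ideal.span {m₀}) (by simpa using hm₀0)
  have := Fintype.ofFinite (𝓞 K ⧸ Ideal.span {m₀})
  have hNI : (0 : ℝ) < Ideal.absNorm I := by
    have := (Ideal.absNorm_ne_zero_iff I).2 (finite_quotient hI)
    positivity
  have hsurj := Ideal.Quotient.mk_surjective (I := I)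
  let rep : (𝓞 K ⧸ I) → 𝓞 K := Function.surjInv hsurj
  have hrep : ∀ c, Ideal.Quotient.mk I (rep c) = c := Function.surjInv_eq hsurj
  have hcard := Finset.card_le_mul_card_image (s := S ×ˢ (Finset.univ : Finset (𝓞 K ⧸ I)))
    (f := fun p => Ideal.Quotient.mk (Ideal.span {m₀}) (p.1 + rep p.2)) F.card ?_
  · have hcard' : (S.card : ℝ) * Ideal.absNorm I ≤ F.card * absNorm m₀ := by
      rw [← card_quotient, Ideal.absNorm_apply, Submodule.cardQuot_apply,
        Nat.card_eq_fintype_card, Nat.card_eq_fintype_card]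
      rw [Finset.card_product, Finset.card_univ] at hcard
      exact_mod_cast hcard.trans (Nat.mul_le_mul_left _ (Finset.card_le_univ _))
    have hterm : ∀ m ∈ S, 1 / absNorm m ≤ 2 ^ Fintype.card (K →+* ℂ) / absNorm m₀ := by
      intro m hm
      rw [div_le_div_iff₀ (absNorm_pos (hSI m hm).1) (absNorm_pos hm₀0), one_mul,
        absNorm_eq_prod, absNorm_eq_prod, ← Finset.card_univ, ← Finset.prod_const,
        ← Finset.prod_mul_distrib]
      exact Finset.prod_le_prod (fun _ _ => norm_nonneg _) fun σ _ => hS m₀ hm₀ m hm σ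
    refine (Finset.sum_le_card_nsmul S _ _ hterm).trans ?_
    have h0 := absNorm_pos hm₀0
    rw [nsmul_eq_mul, mul_div_assoc', div_le_div_iff₀ h0 hNI]
    calc (S.card : ℝ) * 2 ^ Fintype.card (K →+* ℂ) * Ideal.absNorm I
        = (S.card : ℝ) * Ideal.absNorm I * 2 ^ Fintype.card (K →+* ℂ) := by ring
      _ ≤ F.card * absNorm m₀ * 2 ^ Fintype.card (K →+* ℂ) := by gcongr
      _ = _ := by ring
  · intro c hc
    obtain ⟨⟨m₁, c₁⟩, hp₁, rfl⟩ := Finset.mem_image.1 hc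
    have hm₁ : m₁ ∈ S := (Finset.mem_product.1 hp₁).1
    have key : ∀ p ∈ (S ×ˢ (Finset.univ : Finset (𝓞 K ⧸ I))).filter (fun p =>
        Ideal.Quotient.mk (Ideal.span {m₀}) (p.1 + rep p.2) =
          Ideal.Quotient.mk (Ideal.span {m₀}) (m₁ + rep c₁)),
        p.1 ∈ S ∧ p.2 = c₁ ∧ m₀ ∣ p.1 - m₁ := by
      rintro ⟨m, c⟩ hp
      rw [Finset.mem_filter, Finset.mem_product, Ideal.Quotient.mk_eq_mk_iff_sub_mem,
        Ideal.mem_span_singleton] at hp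
      obtain ⟨⟨hm, -⟩, hd⟩ := hp
      simp only at hm hd ⊢
      have hcc : c = c₁ := by
        rw [← hrep c, ← hrep c₁, Ideal.Quotient.mk_eq_mk_iff_sub_mem]
        have h1 : m + rep c - (m₁ + rep c₁) ∈ I := I.mem_of_dvd hd hm₀I
        have h2 := I.sub_mem h1 (I.sub_mem (hSI m hm).2 (hSI m₁ hm₁).2)
        rwa [show m + rep c - (m₁ + rep c₁) - (m - m₁) = rep c - rep c₁ by ring] at h2
      subst hcc
      refine ⟨hm, rfl, ?_⟩
      rwa [add_sub_add_right_eq_sub] at hd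
    have hex : ∀ p : 𝓞 K × (𝓞 K ⧸ I), ∃ n, m₀ ∣ p.1 - m₁ → p.1 - m₁ = m₀ * n := by
      intro p
      by_cases hd : m₀ ∣ p.1 - m₁
      · obtain ⟨n, hn⟩ := hd
        exact ⟨n, fun _ => hn⟩
      · exact ⟨0, fun h => absurd h hd⟩
    choose n hn using hex
    refine Finset.card_le_card_of_injOn n ?_ ?_
    · intro p hp
      obtain ⟨hm, -, hd⟩ := key p (Finset.mem_coe.1 hp)
      simp only [F, Set.Finite.coe_toFinset, Set.mem_ofPred_eq]
      intro σ
      have h1 := congrArg (fun x : 𝓞 K => ‖σ (x : K)‖) (hn p hd)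
      push_cast at h1
      rw [map_mul, norm_mul, map_sub] at h1
      have h2 := norm_sub_le (σ (p.1 : K)) (σ (m₁ : K))
      have h3 := hS p.1 hm m₀ hm₀ σ
      have h4 := hS m₁ hm₁ m₀ hm₀ σ
      have h5 : 0 < ‖σ (m₀ : K)‖ := by simpa using hm₀0
      nlinarith
    · intro p hp p' hp' he
      obtain ⟨-, hc, hd⟩ := key p (Finset.mem_coe.1 hp)
      obtain ⟨-, hc', hd'⟩ := key p' (Finset.mem_coe.1 hp')
      refine Prod.ext ?_ (hc.trans hc'.symm)
      have h1 := hn p hd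
      rw [he, ← hn p' hd'] at h1
      exact sub_left_injective h1

theorem card_embeddings_eq (w : Module.Basis (Fin d) ℤ (𝓞 K)) : Fintype.card (K →+* ℂ) = d := by
  rw [Embeddings.card, ← RingOfIntegers.rank, Module.finrank_eq_card_basis w, Fintype.card_fin]

/-- Crude bounds that are exponential in `μ`, so that dyadic decompositions use `O(μ)` ranges. -/
theorem IsFNS.exists_two_pow_bound (h : IsFNS q D) :
    ∃ A : ℕ, 1 ≤ A ∧ ∀ μ : ℕ, 1 ≤ μ → ∀ m ∈ digitSet q D μ, absNorm m ≤ 2 ^ (A * μ) ∧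
      ∀ σ : K →+* ℂ, ‖σ (m : K)‖ ≤ 2 ^ (A * μ) := by
  obtain ⟨C, hC1, hC⟩ := h.exists_norm_le
  let M : ℝ := ∑ σ : K →+* ℂ, ‖σ (q : K)‖
  have hM : ∀ σ : K →+* ℂ, ‖σ (q : K)‖ ≤ M := fun σ =>
    Finset.single_le_sum (f := fun σ : K →+* ℂ => ‖σ (q : K)‖) (fun _ _ => by positivity)
      (Finset.mem_univ σ)
  have hM0 : 0 ≤ M := by positivity
  obtain ⟨A₀, hA₀⟩ := pow_unbounded_of_one_lt (C * M) (one_lt_two (α := ℝ))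
  have hconj : ∀ μ : ℕ, 1 ≤ μ → ∀ m ∈ digitSet q D μ,
      ∀ σ : K →+* ℂ, ‖σ (m : K)‖ ≤ 2 ^ (A₀ * μ) := by
    intro μ hμ m hm σ
    calc ‖σ (m : K)‖ ≤ C * ‖σ (q : K)‖ ^ μ := hC μ m hm σ
      _ ≤ C ^ μ * M ^ μ := by
          gcongr
          · exact le_self_pow₀ hC1 (by omega)
          · exact hM σ
      _ = (C * M) ^ μ := (mul_pow _ _ _).symm
      _ ≤ (2 ^ A₀) ^ μ := by gcongr
      _ = _ := (pow_mul _ _ _).symm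
  refine ⟨A₀ * Fintype.card (K →+* ℂ) + A₀ + 1, by omega, fun μ hμ m hm => ⟨?_, fun σ => ?_⟩⟩
  · rw [absNorm_eq_prod]
    calc ∏ σ : K →+* ℂ, ‖σ (m : K)‖ ≤ ∏ σ : K →+* ℂ, 2 ^ (A₀ * μ) :=
          Finset.prod_le_prod (fun _ _ => norm_nonneg _) fun σ _ => hconj μ hμ m hm σ
      _ = 2 ^ (A₀ * Fintype.card (K →+* ℂ) * μ) := by
          rw [Finset.prod_const, Finset.card_univ, ← pow_mul]
          congr 1
          ring
      _ ≤ _ := pow_le_pow_right₀ one_le_two (Nat.mul_le_mul_right _ (by omega))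
  · exact (hconj μ hμ m hm σ).trans
      (pow_le_pow_right₀ one_le_two (Nat.mul_le_mul_right _ (by omega)))

/-- Sort `m` by the dyadic size of each of its `d` conjugates and apply the comparable case to every
box. Conjugates are at most exponential in `μ`, and also bounded below because `|N(m)| ≥ 1`; hence
there are `O(μ^d)` boxes. -/
theorem IsFNS.exists_sum_inv_absNorm_le (h : IsFNS q D) (w : Module.Basis (Fin d) ℤ (𝓞 K)) :
    ∃ C : ℝ, 0 ≤ C ∧ ∀ μ : ℕ, 1 ≤ μ → ∀ (I : Ideal (𝓞 K)) (S : Finset (𝓞 K)),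
      S ⊆ digitSet q D μ → (∀ m ∈ S, m ≠ 0 ∧ m ∈ I) →
      ∑ m ∈ S, 1 / absNorm m ≤ C * (μ : ℝ) ^ d / Ideal.absNorm I := by
  classical
  obtain ⟨C, hC0, hC⟩ := exists_sum_inv_absNorm_comparable_le K
  obtain ⟨A, hA1, hA⟩ := h.exists_two_pow_bound
  refine ⟨(2 * A * d + 3) ^ d * C, by positivity, fun μ hμ I S hS hSI => ?_⟩
  let J : 𝓞 K → (K →+* ℂ) → ℤ := fun m σ => Int.log 2 ‖σ (m : K)‖
  let M : ℕ := A * d * μ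
  let T : Finset ((K →+* ℂ) → ℤ) := Fintype.piFinset fun _ => Finset.Icc (-(M : ℤ)) M
  have hpos : ∀ m ∈ S, ∀ σ : K →+* ℂ, 0 < ‖σ (m : K)‖ := fun m hm σ => by
    simpa using (hSI m hm).1
  have hd : 1 ≤ d := by
    rw [← card_embeddings_eq w]
    exact Fintype.card_pos
  have hJ : ∀ m ∈ S, J m ∈ T := by
    intro m hm
    rw [Fintype.mem_piFinset]
    intro σ
    have hup := (hA μ hμ m (hS hm)).2
    have hlow : (2 : ℝ) ^ (-(M : ℤ)) ≤ ‖σ (m : K)‖ := by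
      have h1 := one_le_absNorm (hSI m hm).1
      rw [absNorm_eq_prod, ← Finset.mul_prod_erase _ _ (Finset.mem_univ σ)] at h1
      have h2 : ∏ τ ∈ Finset.univ.erase σ, ‖τ (m : K)‖ ≤ 2 ^ M := by
        calc ∏ τ ∈ Finset.univ.erase σ, ‖τ (m : K)‖ ≤ ∏ τ ∈ Finset.univ.erase σ, 2 ^ (A * μ) :=
              Finset.prod_le_prod (fun _ _ => norm_nonneg _) fun τ _ => hup τ
          _ = 2 ^ (A * μ * (Finset.univ.erase σ).card) := by rw [Finset.prod_const, ← pow_mul]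
          _ ≤ 2 ^ M := by
              refine pow_le_pow_right₀ one_le_two ?_
              have : (Finset.univ.erase σ).card ≤ d := by
                rw [← card_embeddings_eq w]
                exact Finset.card_le_univ _
              calc A * μ * (Finset.univ.erase σ).card ≤ A * μ * d := Nat.mul_le_mul_left _ this
                _ = M := by simp only [M]; ring
      rw [zpow_neg, zpow_natCast, inv_le_iff_one_le_mul₀ (by positivity)]
      exact h1.trans (by gcongr)
    have hup' : ‖σ (m : K)‖ ≤ (2 : ℝ) ^ (M : ℤ) := by
      rw [zpow_natCast]
      refine (hup σ).trans (pow_le_pow_right₀ one_le_two ?_)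
      calc A * μ = A * 1 * μ := by ring
        _ ≤ M := by
          simp only [M]
          gcongr
    rw [Finset.mem_Icc]
    have hlog : ∀ k : ℤ, Int.log 2 ((2 : ℝ) ^ k) = k := fun k => by
      exact_mod_cast Int.log_zpow (R := ℝ) (b := 2) one_lt_two k
    constructor
    · rw [← hlog (-(M : ℤ))]
      exact Int.log_mono_right (by positivity) hlow
    · rw [← hlog (M : ℤ)]
      exact Int.log_mono_right (hpos m hm σ) hup'
  rw [← Finset.sum_fiberwise_of_maps_to hJ]
  have hfib : ∀ j ∈ T, ∑ m ∈ S with J m = j, 1 / absNorm m ≤ C / Ideal.absNorm I := by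
    intro j _
    refine hC I _ (fun m hm => hSI m (Finset.mem_filter.1 hm).1) fun m hm n hn σ => ?_
    rw [Finset.mem_filter] at hm hn
    have h1 := Int.lt_zpow_succ_log_self (R := ℝ) (b := 2) one_lt_two ‖σ (m : K)‖
    have h2 := Int.zpow_log_le_self (R := ℝ) (b := 2) one_lt_two (hpos n hn.1 σ)
    have h3 : Int.log 2 ‖σ (m : K)‖ = Int.log 2 ‖σ (n : K)‖ :=
      (congrFun hm.2 σ).trans (congrFun hn.2 σ).symm
    rw [h3, zpow_add₀ (by norm_num), zpow_one] at h1
    push_cast at h1 h2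
    linarith
  refine (Finset.sum_le_card_nsmul T _ _ hfib).trans ?_
  have hT : (T.card : ℝ) ≤ (2 * A * d + 3) ^ d * (μ : ℝ) ^ d := by
    have h1 : T.card = (2 * M + 1) ^ d := by
      rw [Fintype.card_piFinset, Finset.prod_const, Finset.card_univ, card_embeddings_eq w,
        Int.card_Icc]
      congr 1
      omega
    rw [h1, ← mul_pow]
    push_cast
    refine pow_le_pow_left₀ (by positivity) ?_ d
    simp only [M]
    push_cast
    have : (1 : ℝ) ≤ μ := by exact_mod_cast hμ
    nlinarith
  rw [nsmul_eq_mul]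
  calc (T.card : ℝ) * (C / Ideal.absNorm I)
      ≤ ((2 * A * d + 3) ^ d * (μ : ℝ) ^ d) * (C / Ideal.absNorm I) := by gcongr
    _ = _ := by ring

/-- The asymptotic count of ideals by norm gives a linear bound for large `s`; monotonicity of the
count covers the remaining `s ≥ 1`. -/
theorem exists_card_ideal_le (K : Type*) [Field K] [NumberField K] :
    ∃ C : ℝ, 0 ≤ C ∧ ∀ s : ℝ, 1 ≤ s → ∀ S : Finset (Ideal (𝓞 K)),
      (∀ I ∈ S, (Ideal.absNorm I : ℝ) ≤ s) → (S.card : ℝ) ≤ C * s := by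
  have hfin : ∀ s : ℝ, Finite {I : Ideal (𝓞 K) // (Ideal.absNorm I : ℝ) ≤ s} := by
    intro s
    refine Set.Finite.to_subtype ((Ideal.finite_setOfPred_absNorm_le ⌊s⌋₊).subset ?_)
    intro I hI
    exact Nat.le_floor hI
  have hle : ∀ (s : ℝ) (S : Finset (Ideal (𝓞 K))),
      (∀ I ∈ S, (Ideal.absNorm I : ℝ) ≤ s) →
      S.card ≤ Nat.card {I : Ideal (𝓞 K) // (Ideal.absNorm I : ℝ) ≤ s} := by
    intro s S hS
    have := hfin s
    rw [← Fintype.card_coe, ← Nat.card_eq_fintype_card]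
    exact Nat.card_le_card_of_injective
      (fun I : S => (⟨I.1, hS I.1 I.2⟩ : {I : Ideal (𝓞 K) // (Ideal.absNorm I : ℝ) ≤ s}))
      fun I J hIJ => Subtype.ext (Subtype.mk.inj hIJ)
  have ht := NumberField.Ideal.tendsto_norm_le_div_atTop K
  set ℓ : ℝ := (2 ^ InfinitePlace.nrRealPlaces K * (2 * Real.pi) ^ InfinitePlace.nrComplexPlaces K *
    Units.regulator K * classNumber K) / (Units.torsionOrder K * Real.sqrt |discr K|)
  obtain ⟨s₀, hs₀⟩ := Filter.eventually_atTop.1 (ht.eventually (ge_mem_nhds (lt_add_one ℓ)))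
  set s₁ := max s₀ 1
  have hs₁ : 1 ≤ s₁ := le_max_right _ _
  have hbig : ∀ s, s₁ ≤ s →
      (Nat.card {I : Ideal (𝓞 K) // (Ideal.absNorm I : ℝ) ≤ s} : ℝ) ≤ (ℓ + 1) * s := by
    intro s hs
    have h1 := hs₀ s ((le_max_left _ _).trans hs)
    rwa [div_le_iff₀ (by linarith)] at h1
  have hℓ : 0 ≤ ℓ + 1 := by
    have h1 := hbig s₁ le_rfl
    have h2 : (0 : ℝ) ≤ (ℓ + 1) * s₁ := le_trans (by positivity) h1
    exact nonneg_of_mul_nonneg_left h2 (by linarith)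
  refine ⟨(ℓ + 1) * s₁, by positivity, fun s hs S hS => ?_⟩
  have h1 := hle (max s s₁) S fun I hI => (hS I hI).trans (le_max_left _ _)
  have h2 := hbig (max s s₁) (le_max_right _ _)
  have h3 : max s s₁ ≤ s₁ * s := max_le (by nlinarith) (by nlinarith)
  calc (S.card : ℝ) ≤ (ℓ + 1) * max s s₁ := le_trans (by exact_mod_cast h1) h2
    _ ≤ (ℓ + 1) * (s₁ * s) := by gcongr
    _ = _ := by ring

/-- Each of the `J + 1` dyadic ranges of norms contributes `O(1)`. -/
theorem exists_sum_inv_absNorm_ideal_le (K : Type*) [Field K] [NumberField K] :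
    ∃ C : ℝ, 0 ≤ C ∧ ∀ (J : ℕ) (S : Finset (Ideal (𝓞 K))),
      (∀ I ∈ S, I ≠ ⊥ ∧ Ideal.absNorm I ≤ 2 ^ J) →
      ∑ I ∈ S, 1 / (Ideal.absNorm I : ℝ) ≤ C * (J + 1) := by
  classical
  obtain ⟨C, hC0, hC⟩ := exists_card_ideal_le K
  refine ⟨2 * C, by positivity, fun J S hS => ?_⟩
  have hN : ∀ I ∈ S, Ideal.absNorm I ≠ 0 := fun I hI =>
    (Ideal.absNorm_ne_zero_iff I).2 (finite_quotient (hS I hI).1)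
  have hmaps : ∀ I ∈ S, Nat.log 2 (Ideal.absNorm I) ∈ Finset.range (J + 1) := by
    intro I hI
    rw [Finset.mem_range, Nat.lt_succ_iff]
    have := Nat.log_mono_right (b := 2) (hS I hI).2
    rwa [Nat.log_pow one_lt_two] at this
  rw [← Finset.sum_fiberwise_of_maps_to hmaps]
  have hfib : ∀ j ∈ Finset.range (J + 1),
      ∑ I ∈ S with Nat.log 2 (Ideal.absNorm I) = j, 1 / (Ideal.absNorm I : ℝ) ≤ 2 * C := by
    intro j _
    have hlow : ∀ I ∈ S.filter (fun I => Nat.log 2 (Ideal.absNorm I) = j),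
        1 / (Ideal.absNorm I : ℝ) ≤ 1 / 2 ^ j := by
      intro I hI
      rw [Finset.mem_filter] at hI
      have := Nat.pow_log_le_self 2 (hN I hI.1)
      rw [hI.2] at this
      refine one_div_le_one_div_of_le (by positivity) ?_
      exact_mod_cast this
    have hcard := hC (2 ^ (j + 1)) (one_le_pow₀ one_le_two)
      (S.filter (fun I => Nat.log 2 (Ideal.absNorm I) = j)) fun I hI => by
        rw [Finset.mem_filter] at hI
        have := (Nat.lt_pow_succ_log_self one_lt_two (Ideal.absNorm I)).le
        rw [hI.2] at this
        exact_mod_cast this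
    refine (Finset.sum_le_card_nsmul _ _ _ hlow).trans ?_
    rw [nsmul_eq_mul, mul_one_div, div_le_iff₀ (by positivity)]
    calc _ ≤ C * 2 ^ (j + 1) := hcard
      _ = 2 * C * 2 ^ j := by ring
  refine (Finset.sum_le_card_nsmul _ _ _ hfib).trans_eq ?_
  simp
  ring

end Counting

/-! ### Exponential sums over multiples of `m`. -/

section ExponentialSums

variable {K : Type*} [Field K] [NumberField K] {d : ℕ} {q : 𝓞 K} {D : Finset (𝓞 K)}

/-- The largest ideal on which the additive character `ψ` is trivial. -/
def conductor (ψ : AddChar (𝓞 K) ℂ) : Ideal (𝓞 K) where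
  carrier := {x | ∀ y, ψ (x * y) = 1}
  add_mem' {a b} ha hb y := by rw [add_mul, AddChar.map_add_eq_mul, ha, hb, one_mul]
  zero_mem' y := by simp
  smul_mem' c x hx y := by
    rw [smul_eq_mul, mul_comm c, mul_assoc]
    exact hx _

theorem mem_perp_span_iff_mem_conductor {m : 𝓞 K} (hm : m ≠ 0) {ψ : AddChar (𝓞 K) ℂ} :
    ψ ∈ perp (Ideal.span {m}) ↔ m ∈ conductor ψ := mem_perp_span hm

theorem mem_perp_conductor {ψ : AddChar (𝓞 K) ℂ} (h : conductor ψ ≠ ⊥) :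
    ψ ∈ perp (conductor ψ) := by
  rw [mem_perp h]
  intro x hx
  simpa using hx 1

/-- At most `N(I)` characters have conductor `I`, so the sum is at most that of `1 / N(I)` over
ideals of norm at most `2^(Aμ)`. -/
theorem IsFNS.exists_sum_inv_sq_conductor_le (h : IsFNS q D) :
    ∃ C : ℝ, 0 ≤ C ∧ ∀ μ : ℕ, 1 ≤ μ →
      ∑ ψ ∈ sieveSet q D μ, (1 / (Ideal.absNorm (conductor ψ) : ℝ)) ^ 2 ≤ C * μ := by
  classical
  obtain ⟨C, hC0, hC⟩ := exists_sum_inv_absNorm_ideal_le K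
  obtain ⟨A, hA1, hA⟩ := h.exists_two_pow_bound
  refine ⟨C * (A + 1), by positivity, fun μ hμ => ?_⟩
  have hcond : ∀ ψ ∈ sieveSet q D μ,
      conductor ψ ≠ ⊥ ∧ Ideal.absNorm (conductor ψ) ≤ 2 ^ (A * μ) := by
    intro ψ hψ
    obtain ⟨m, hm, hm0, hmψ⟩ := mem_sieveSet.1 hψ
    rw [mem_perp_span_iff_mem_conductor hm0] at hmψ
    refine ⟨fun hb => hm0 (by simpa [hb] using hmψ), ?_⟩
    have h1 : Ideal.absNorm (conductor ψ) ∣ Ideal.absNorm (Ideal.span {m}) :=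
      Ideal.absNorm_dvd_absNorm_of_le ((Ideal.span_singleton_le_iff_mem _).2 hmψ)
    have h2 := absNorm_pos hm0
    have h3 := (hA μ hμ m hm).1
    rw [absNorm_eq_ideal] at h2 h3
    exact (Nat.le_of_dvd (by exact_mod_cast h2) h1).trans (by exact_mod_cast h3)
  have hmaps : ∀ ψ ∈ sieveSet q D μ, conductor ψ ∈ (sieveSet q D μ).image conductor :=
    fun ψ hψ => Finset.mem_image_of_mem _ hψ
  rw [← Finset.sum_fiberwise_of_maps_to hmaps]
  have hfib : ∀ I ∈ (sieveSet q D μ).image conductor,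
      ∑ ψ ∈ sieveSet q D μ with conductor ψ = I,
        (1 / (Ideal.absNorm (conductor ψ) : ℝ)) ^ 2 ≤ 1 / (Ideal.absNorm I : ℝ) := by
    intro I hI
    obtain ⟨ψ₀, hψ₀, rfl⟩ := Finset.mem_image.1 hI
    have hne := (hcond ψ₀ hψ₀).1
    have hN : (0 : ℝ) < Ideal.absNorm (conductor ψ₀) := by
      have := (Ideal.absNorm_ne_zero_iff _).2 (finite_quotient hne)
      positivity
    have hcard : (((sieveSet q D μ).filter fun ψ => conductor ψ = conductor ψ₀).card : ℝ) ≤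
        Ideal.absNorm (conductor ψ₀) := by
      rw [← card_perp hne, Nat.cast_le]
      refine Finset.card_le_card fun ψ hψ => ?_
      rw [Finset.mem_filter] at hψ
      rw [← hψ.2]
      exact mem_perp_conductor (hcond ψ hψ.1).1
    rw [Finset.sum_congr rfl (g := fun _ => (1 / (Ideal.absNorm (conductor ψ₀) : ℝ)) ^ 2)
      fun ψ hψ => by rw [(Finset.mem_filter.1 hψ).2], Finset.sum_const, nsmul_eq_mul]
    calc _ ≤ (Ideal.absNorm (conductor ψ₀) : ℝ) *
          (1 / (Ideal.absNorm (conductor ψ₀) : ℝ)) ^ 2 := by gcongr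
      _ = _ := by field_simp
  refine (Finset.sum_le_sum hfib).trans ((hC (A * μ) _ ?_).trans ?_)
  · intro I hI
    obtain ⟨ψ, hψ, rfl⟩ := Finset.mem_image.1 hI
    exact hcond ψ hψ
  · have : (1 : ℝ) ≤ μ := by exact_mod_cast hμ
    rw [mul_assoc]
    gcongr
    push_cast
    linarith

/-- Exchanging the sums gives each `ψ` the weight `∑ 1/N(m)` over `m` in its conductor, which is
`O(μ^d / N(conductor))`. Cauchy–Schwarz then separates the conductors from the large sieve, each
character being counted once. -/
theorem IsFNS.exists_sum_perp_norm_le (h : IsFNS q D) (w : Module.Basis (Fin d) ℤ (𝓞 K)) :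
    ∃ C : ℝ, 0 ≤ C ∧ ∀ μ : ℕ, 1 ≤ μ → ∀ S ⊆ digitSet q D μ, (∀ m ∈ S, m ≠ 0) →
      ∀ a : 𝓞 K → ℂ, (∀ u, ‖a u‖ ≤ 1) →
      ∑ m ∈ S, 1 / absNorm m *
          ∑ ψ ∈ perp (Ideal.span {m}), ‖∑ u ∈ digitSet q D (2 * μ), a u * ψ u‖ ≤
        C * (μ : ℝ) ^ (d + 1) * absNorm q ^ (2 * μ) := by
  classical
  obtain ⟨C₁, hC₁0, hC₁⟩ := h.exists_sum_inv_absNorm_le w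
  obtain ⟨C₂, hC₂0, hC₂⟩ := h.exists_sum_inv_sq_conductor_le
  obtain ⟨C₃, hC₃0, hC₃⟩ := h.large_sieve w
  refine ⟨C₁ * √(C₂ * C₃), by positivity, fun μ hμ S hS hS0 a ha => ?_⟩
  set A : AddChar (𝓞 K) ℂ → ℝ := fun ψ => ‖∑ u ∈ digitSet q D (2 * μ), a u * ψ u‖ with hA
  have hQ := h.one_lt_absNorm
  have hμ1 : (1 : ℝ) ≤ μ := by exact_mod_cast hμ
  have hL2 : ∑ ψ ∈ sieveSet q D μ, A ψ ^ 2 ≤ C₃ * (absNorm q ^ (2 * μ)) ^ 2 := by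
    refine (hC₃ μ a).trans ?_
    rw [mul_assoc, sq]
    gcongr
    rw [← h.card_digitSet]
    calc _ ≤ ∑ u ∈ digitSet q D (2 * μ), (1 : ℝ) :=
          Finset.sum_le_sum fun u _ => pow_le_one₀ (norm_nonneg _) (ha u)
      _ = _ := by simp
  have hswap : ∑ m ∈ S, 1 / absNorm m * ∑ ψ ∈ perp (Ideal.span {m}), A ψ ≤
      ∑ ψ ∈ sieveSet q D μ, (∑ m ∈ S with m ∈ conductor ψ, 1 / absNorm m) * A ψ := by
    simp only [Finset.mul_sum, Finset.sum_mul]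
    refine le_of_eq (Finset.sum_comm' fun m ψ => ?_)
    rw [Finset.mem_filter]
    constructor
    · rintro ⟨hm, hψ⟩
      exact ⟨⟨hm, (mem_perp_span_iff_mem_conductor (hS0 m hm)).1 hψ⟩,
        mem_sieveSet.2 ⟨m, hS hm, hS0 m hm, hψ⟩⟩
    · rintro ⟨⟨hm, hψ⟩, -⟩
      exact ⟨hm, (mem_perp_span_iff_mem_conductor (hS0 m hm)).2 hψ⟩
  calc _ ≤ _ := hswap
    _ ≤ ∑ ψ ∈ sieveSet q D μ,
          C₁ * (μ : ℝ) ^ d * (1 / (Ideal.absNorm (conductor ψ) : ℝ) * A ψ) := by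
        refine Finset.sum_le_sum fun ψ _ => ?_
        have h1 := hC₁ μ hμ (conductor ψ) (S.filter fun m => m ∈ conductor ψ)
          ((Finset.filter_subset _ _).trans hS) fun m hm =>
            ⟨hS0 m (Finset.mem_filter.1 hm).1, (Finset.mem_filter.1 hm).2⟩
        calc _ ≤ C₁ * (μ : ℝ) ^ d / Ideal.absNorm (conductor ψ) * A ψ := by
              refine mul_le_mul_of_nonneg_right h1 (norm_nonneg _)
          _ = _ := by ring
    _ = C₁ * (μ : ℝ) ^ d *
          ∑ ψ ∈ sieveSet q D μ, 1 / (Ideal.absNorm (conductor ψ) : ℝ) * A ψ := by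
        rw [Finset.mul_sum]
    _ ≤ C₁ * (μ : ℝ) ^ d * (√(C₂ * μ) * √(C₃ * (absNorm q ^ (2 * μ)) ^ 2)) := by
        gcongr
        refine (Real.sum_mul_le_sqrt_mul_sqrt _ _ _).trans ?_
        gcongr
        exact hC₂ μ hμ
    _ = C₁ * √(C₂ * C₃) * ((μ : ℝ) ^ d * √μ) * absNorm q ^ (2 * μ) := by
        rw [Real.sqrt_mul hC₂0, Real.sqrt_mul hC₃0.le, Real.sqrt_sq (by positivity),
          Real.sqrt_mul hC₂0]
        ring
    _ ≤ _ := by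
        rw [pow_succ]
        gcongr
        -- The argument yields `μ^(d+1/2)`; here `√μ` is rounded up to `μ`.
        exact Real.sqrt_le_iff.2 ⟨by positivity, by nlinarith⟩

/-- The congruence `v ≡ v₀` is an average of characters modulo `q^ρ`, and each merely shifts `t`, so
restricting to the progression costs nothing. -/
theorem IsFNS.norm_sum_progression_le (h : IsFNS q D) {f : 𝓞 K → ℂ} {γ : ℕ → ℝ} {c C₂ : ℝ}
    (hf : FourierProperty q D f γ c C₂) {l κ ρ : ℕ} (hκ : (κ : ℝ) ≤ c * l) {v₀ : 𝓞 K}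
    (hv₀ : v₀ ∈ digitSet q D ρ) (t : K) [DecidablePred fun v => lowDigits q D ρ v = v₀] :
    ‖∑ v ∈ digitSet q D l with lowDigits q D ρ v = v₀, f (v * q ^ κ) * trChar t v‖ ≤
      C₂ * absNorm q ^ ((l : ℝ) - γ l) := by
  classical
  have hqρ : q ^ ρ ≠ 0 := pow_ne_zero _ h.ne_zero
  have hI : Ideal.span {q ^ ρ} ≠ ⊥ := by simpa using hqρ
  set P := perp (Ideal.span {q ^ ρ})
  have hN := absNorm_pos hqρ
  have hind : ∀ v : 𝓞 K, (if lowDigits q D ρ v = v₀ then (1 : ℂ) else 0) =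
      (absNorm (q ^ ρ) : ℂ)⁻¹ * ∑ φ ∈ P, φ (v - v₀) := by
    intro v
    rw [sum_perp_span_apply hqρ]
    have hiff : lowDigits q D ρ v = v₀ ↔ q ^ ρ ∣ v - v₀ :=
      ⟨fun he => he ▸ h.dvd_sub_lowDigits ρ v, h.lowDigits_eq hv₀⟩
    by_cases hd : q ^ ρ ∣ v - v₀
    · rw [if_pos (hiff.2 hd), if_pos hd, inv_mul_cancel₀ (by exact_mod_cast hN.ne')]
    · rw [if_neg (fun he => hd (hiff.1 he)), if_neg hd, mul_zero]
  have hsum : ∑ v ∈ digitSet q D l with lowDigits q D ρ v = v₀, f (v * q ^ κ) * trChar t v =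
      (absNorm (q ^ ρ) : ℂ)⁻¹ * ∑ φ ∈ P, φ (-v₀) *
        ∑ v ∈ digitSet q D l, f (v * q ^ κ) * (trChar t v * φ v) := by
    rw [Finset.sum_filter]
    calc _ = ∑ v ∈ digitSet q D l, f (v * q ^ κ) * trChar t v *
          (if lowDigits q D ρ v = v₀ then (1 : ℂ) else 0) :=
          Finset.sum_congr rfl fun v _ => by split_ifs <;> simp
      _ = ∑ v ∈ digitSet q D l, ∑ φ ∈ P, (absNorm (q ^ ρ) : ℂ)⁻¹ *
          (φ (-v₀) * (f (v * q ^ κ) * (trChar t v * φ v))) := by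
          refine Finset.sum_congr rfl fun v _ => ?_
          rw [hind, Finset.mul_sum, Finset.mul_sum]
          refine Finset.sum_congr rfl fun φ _ => ?_
          rw [sub_eq_add_neg, AddChar.map_add_eq_mul]
          ring
      _ = _ := by
          rw [Finset.sum_comm]
          simp only [Finset.mul_sum]
  rw [hsum, norm_mul, norm_inv, Complex.norm_real, Real.norm_of_nonneg hN.le,
    inv_mul_le_iff₀ hN, ← card_perp_span hqρ]
  refine (norm_sum_le _ _).trans ?_
  rw [← nsmul_eq_mul]
  refine Finset.sum_le_card_nsmul _ _ _ fun φ hφ => ?_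
  obtain ⟨s, rfl⟩ := exists_eq_trChar hI hφ
  rw [norm_mul, norm_trChar, one_mul]
  have h1 := hf.2.2.2 l κ (t + s) hκ
  simp only [← trChar_apply, trChar_add, AddChar.mul_apply] at h1
  exact h1

/-- The progression modulo `q^l` through `0` contains a single `v`, and that sum has modulus `1`.
This limits how far `γ l` can exceed `l`. -/
theorem IsFNS.one_le_of_fourierProperty (h : IsFNS q D) {f : 𝓞 K → ℂ} (hf1 : ∀ n, ‖f n‖ = 1)
    {γ : ℕ → ℝ} {c C₂ : ℝ} (hf : FourierProperty q D f γ c C₂) (l : ℕ) :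
    1 ≤ C₂ * absNorm q ^ ((l : ℝ) - γ l) := by
  classical
  have h0 := h.zero_mem_digitSet l
  have h1 := h.norm_sum_progression_le hf (l := l) (κ := 0) (ρ := l)
    (by have := hf.2.2.1; push_cast; positivity) h0 0
  have h2 : (digitSet q D l).filter (fun v => lowDigits q D l v = 0) = {0} := by
    ext v
    rw [Finset.mem_filter, Finset.mem_singleton]
    constructor
    · rintro ⟨hv, hv0⟩
      rw [← hv0, h.lowDigits_eq hv (by simp)]
    · rintro rfl
      exact ⟨h0, h.lowDigits_eq h0 (by simp)⟩
  rwa [h2, Finset.sum_singleton, norm_mul, hf1, norm_trChar, one_mul] at h1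

/-- The part of `f(u + v q ^ κ) / f(v q ^ κ)` that depends only on `u` and `v` modulo `q ^ ρ`. -/
def carryFactor (q : 𝓞 K) (D : Finset (𝓞 K)) (f : 𝓞 K → ℂ) (κ ρ : ℕ) (v u : 𝓞 K) : ℂ :=
  truncated q D f (κ + ρ) (u + v * q ^ κ) * star (truncated q D f (κ + ρ) (v * q ^ κ))

theorem norm_carryFactor {f : 𝓞 K → ℂ} (hf1 : ∀ n, ‖f n‖ = 1) (κ ρ : ℕ) (v u : 𝓞 K) :
    ‖carryFactor q D f κ ρ v u‖ = 1 := by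
  simp [carryFactor, truncated, hf1]

theorem IsFNS.carryFactor_lowDigits (h : IsFNS q D) (f : 𝓞 K → ℂ) (κ ρ : ℕ) (v u : 𝓞 K) :
    carryFactor q D f κ ρ (lowDigits q D ρ v) u = carryFactor q D f κ ρ v u := by
  obtain ⟨s, hs⟩ := h.dvd_sub_lowDigits ρ v
  have key : ∀ u, lowDigits q D (κ + ρ) (u + lowDigits q D ρ v * q ^ κ) =
      lowDigits q D (κ + ρ) (u + v * q ^ κ) := by
    intro u
    refine h.lowDigits_congr ⟨-s, ?_⟩
    rw [pow_add]
    linear_combination -q ^ κ * hs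
  have key0 := key 0
  rw [zero_add, zero_add] at key0
  rw [carryFactor, carryFactor, truncated, truncated, key, key0, truncated, truncated]

/-- Once the carry factor is frozen by the residue `v₀` and divisibility is expanded in characters
modulo `m`, the double sum is a product of a sum over `u` and a sum over `v`. -/
theorem IsFNS.norm_sum_filter_dvd_carryFactor_le (h : IsFNS q D) {f : 𝓞 K → ℂ} {γ : ℕ → ℝ}
    {c C₂ : ℝ} (hf : FourierProperty q D f γ c C₂) {l κ ρ : ℕ} (hκ : (κ : ℝ) ≤ c * l) (t : K)
    {m : 𝓞 K} (hm : m ≠ 0) [DecidablePred fun x => m ∣ x] :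
    ‖∑ v ∈ digitSet q D l, ∑ u ∈ digitSet q D κ, (if m ∣ u + v * q ^ κ then
        f (v * q ^ κ) * carryFactor q D f κ ρ v u * trChar t (u + v * q ^ κ) else 0)‖ ≤
      ∑ v₀ ∈ digitSet q D ρ, (1 / absNorm m * ∑ ψ ∈ perp (Ideal.span {m}),
        ‖∑ u ∈ digitSet q D κ, carryFactor q D f κ ρ v₀ u * trChar t u * ψ u‖) *
          (C₂ * absNorm q ^ ((l : ℝ) - γ l)) := by
  classical
  have hI : Ideal.span {m} ≠ ⊥ := by simpa using hm
  set P := perp (Ideal.span {m})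
  have hN := absNorm_pos hm
  have hind : ∀ x : 𝓞 K, ∀ z : ℂ, (if m ∣ x then z else 0) =
      (absNorm m : ℂ)⁻¹ * ∑ ψ ∈ P, z * ψ x := by
    intro x z
    rw [← Finset.mul_sum, sum_perp_span_apply hm]
    split_ifs
    · field_simp [hN.ne']
    · simp
  have hsum : ∑ v ∈ digitSet q D l, ∑ u ∈ digitSet q D κ, (if m ∣ u + v * q ^ κ then
        f (v * q ^ κ) * carryFactor q D f κ ρ v u * trChar t (u + v * q ^ κ) else 0) =
      ∑ v₀ ∈ digitSet q D ρ, (absNorm m : ℂ)⁻¹ * ∑ ψ ∈ P,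
        (∑ u ∈ digitSet q D κ, carryFactor q D f κ ρ v₀ u * trChar t u * ψ u) *
        ∑ v ∈ digitSet q D l with lowDigits q D ρ v = v₀,
          f (v * q ^ κ) * (trChar t (v * q ^ κ) * ψ (v * q ^ κ)) := by
    rw [← Finset.sum_fiberwise_of_maps_to (g := lowDigits q D ρ) (t := digitSet q D ρ)
      fun v _ => h.lowDigits_mem ρ v]
    refine Finset.sum_congr rfl fun v₀ _ => ?_
    have hcomm : ∀ (F G : 𝓞 K → AddChar (𝓞 K) ℂ → ℂ) (T : Finset (𝓞 K)),
        ∑ ψ ∈ P, (∑ u ∈ digitSet q D κ, F u ψ) * ∑ v ∈ T, G v ψ =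
          ∑ v ∈ T, ∑ u ∈ digitSet q D κ, ∑ ψ ∈ P, F u ψ * G v ψ := by
      intro F G T
      calc _ = ∑ ψ ∈ P, ∑ v ∈ T, ∑ u ∈ digitSet q D κ, F u ψ * G v ψ :=
            Finset.sum_congr rfl fun ψ _ => by rw [Finset.sum_mul_sum, Finset.sum_comm]
        _ = _ := by
            rw [Finset.sum_comm]
            exact Finset.sum_congr rfl fun v _ => Finset.sum_comm
    rw [hcomm (fun u ψ => carryFactor q D f κ ρ v₀ u * trChar t u * ψ u)
      (fun v ψ => f (v * q ^ κ) * (trChar t (v * q ^ κ) * ψ (v * q ^ κ))), Finset.mul_sum]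
    refine Finset.sum_congr rfl fun v hv => ?_
    rw [Finset.mul_sum]
    refine Finset.sum_congr rfl fun u _ => ?_
    rw [hind]
    congr 1
    refine Finset.sum_congr rfl fun ψ _ => ?_
    rw [← (Finset.mem_filter.1 hv).2, h.carryFactor_lowDigits, AddChar.map_add_eq_mul,
      AddChar.map_add_eq_mul]
    ring
  rw [hsum]
  refine (norm_sum_le _ _).trans (Finset.sum_le_sum fun v₀ hv₀ => ?_)
  rw [norm_mul, norm_inv, Complex.norm_real, Real.norm_of_nonneg hN.le, one_div, mul_assoc]
  gcongr
  rw [Finset.sum_mul]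
  refine (norm_sum_le _ _).trans (Finset.sum_le_sum fun ψ hψ => ?_)
  rw [norm_mul]
  gcongr
  obtain ⟨s, rfl⟩ := exists_eq_trChar hI hψ
  -- With `ψ = trChar s`, the twist evaluated at `v q^κ` is the character of frequency `(t + s) q^κ`
  -- evaluated at `v`.
  have h1 := h.norm_sum_progression_le hf hκ hv₀ ((t + s) * ((q ^ κ : 𝓞 K) : K))
  simpa only [← trChar_mul_apply, trChar_add, AddChar.mul_apply, mul_comm (q ^ κ)] using h1

/-- Replace `f(u + v q^κ)` by `f(v q^κ)` times the carry factor for all `v`, and correct on the bad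
`v` only. The main part gains from the Fourier property at the cost of `Q^ρ` classes `v₀`. The
correction is counted using `∑ 1/N(m) = O(μ^d)`. -/
theorem IsFNS.exists_sum_norm_sum_dvd_le (h : IsFNS q D) (w : Module.Basis (Fin d) ℤ (𝓞 K)) :
    ∃ C : ℝ, 0 ≤ C ∧ ∀ (f : 𝓞 K → ℂ) (η₁ C₁ C₂ : ℝ) (γ : ℕ → ℝ) (c : ℝ), (∀ n, ‖f n‖ = 1) →
      CarryProperty q D f η₁ C₁ → FourierProperty q D f γ c C₂ →
      ∀ μ l ρ : ℕ, 1 ≤ μ → ρ ≤ l → ((2 * μ : ℕ) : ℝ) ≤ c * l → ∀ t : K,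
      ∀ S ⊆ digitSet q D μ, (∀ m ∈ S, m ≠ 0) → ∀ [∀ m : 𝓞 K, DecidablePred fun x => m ∣ x],
      ∑ m ∈ S, ‖∑ n ∈ digitSet q D (2 * μ + l) with m ∣ n, f n * trChar t n‖ ≤
        C * (μ : ℝ) ^ (d + 1) * absNorm q ^ (2 * μ) *
          (absNorm q ^ ρ * (C₂ * absNorm q ^ ((l : ℝ) - γ l)) +
            C₁ * absNorm q ^ ((l : ℝ) - η₁ * ρ)) := by
  classical
  obtain ⟨B₁, hB₁0, hB₁⟩ := h.exists_sum_perp_norm_le w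
  obtain ⟨B₂, hB₂0, hB₂⟩ := h.card_filter_dvd_le
  obtain ⟨B₃, hB₃0, hB₃⟩ := h.exists_sum_inv_absNorm_le w
  refine ⟨B₁ + 2 * B₂ * B₃, by positivity, ?_⟩
  intro f η₁ C₁ C₂ γ c hf1 hcarry hfour μ l ρ hμ hρ hκ t S hS hS0 hdec
  set κ := 2 * μ
  have hQ := h.one_lt_absNorm
  have hμ1 : (1 : ℝ) ≤ μ := by exact_mod_cast hμ
  set Φ := C₂ * absNorm q ^ ((l : ℝ) - γ l) with hΦ
  have hΦ0 : 0 ≤ Φ := le_trans (by norm_num) (h.one_le_of_fourierProperty hf1 hfour l)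
  set bad := (digitSet q D l).filter fun v => ∃ u₁ ∈ digitSet q D κ, ∃ u₂ ∈ digitSet q D κ,
        f (u₁ + u₂ + v * q ^ κ) * star (f (u₁ + v * q ^ κ)) ≠
          truncated q D f (κ + ρ) (u₁ + u₂ + v * q ^ κ) *
            star (truncated q D f (κ + ρ) (u₁ + v * q ^ κ)) with hbad
  set Ψ := C₁ * absNorm q ^ ((l : ℝ) - η₁ * ρ) with hΨ
  have hbadcard : (bad.card : ℝ) ≤ Ψ := by
    have := hcarry.2 κ l ρ hρ
    convert this using 2
  have hΨ0 : 0 ≤ Ψ := le_trans (by positivity) hbadcard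
  have hgood : ∀ v ∈ digitSet q D l, v ∉ bad → ∀ u ∈ digitSet q D κ,
      f (u + v * q ^ κ) = f (v * q ^ κ) * carryFactor q D f κ ρ v u := by
    intro v hv hvb u hu
    -- The Carry property is needed only with `u₁ = 0`.
    have h1 : f (0 + u + v * q ^ κ) * star (f (0 + v * q ^ κ)) =
        truncated q D f (κ + ρ) (0 + u + v * q ^ κ) *
          star (truncated q D f (κ + ρ) (0 + v * q ^ κ)) := by
      by_contra hne
      exact hvb (Finset.mem_filter.2 ⟨hv, 0, h.zero_mem_digitSet κ, u, hu, hne⟩)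
    simp only [zero_add] at h1
    have h2 : star (f (v * q ^ κ)) * f (v * q ^ κ) = 1 := by
      rw [Complex.star_def, Complex.conj_mul', hf1]
      simp
    rw [carryFactor, ← h1]
    linear_combination -f (u + v * q ^ κ) * h2
  have hterm : ∀ m ∈ S, ‖∑ n ∈ digitSet q D (κ + l) with m ∣ n, f n * trChar t n‖ ≤
      ∑ v₀ ∈ digitSet q D ρ, (1 / absNorm m * ∑ ψ ∈ perp (Ideal.span {m}),
        ‖∑ u ∈ digitSet q D κ, carryFactor q D f κ ρ v₀ u * trChar t u * ψ u‖) * Φ +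
      Ψ * (2 * (B₂ * absNorm q ^ κ / absNorm m)) := by
    intro m hm
    have hm0 := hS0 m hm
    have hsplit : ∑ n ∈ digitSet q D (κ + l) with m ∣ n, f n * trChar t n =
        ∑ v ∈ digitSet q D l, ∑ u ∈ digitSet q D κ, (if m ∣ u + v * q ^ κ then
          f (v * q ^ κ) * carryFactor q D f κ ρ v u * trChar t (u + v * q ^ κ) else 0) +
        ∑ v ∈ bad, ∑ u ∈ digitSet q D κ with m ∣ u + v * q ^ κ,
          (f (u + v * q ^ κ) - f (v * q ^ κ) * carryFactor q D f κ ρ v u) *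
            trChar t (u + v * q ^ κ) := by
      rw [Finset.sum_filter, h.sum_digitSet_add, ← sub_eq_iff_eq_add', ← Finset.sum_sub_distrib]
      symm
      refine (Finset.sum_subset (Finset.filter_subset _ _) fun v hv hvb => ?_).trans ?_
      · refine Finset.sum_eq_zero fun u hu => ?_
        rw [hgood v hv hvb u (Finset.mem_filter.1 hu).1, sub_self, zero_mul]
      · refine Finset.sum_congr rfl fun v _ => ?_
        rw [Finset.sum_filter, ← Finset.sum_sub_distrib]
        refine Finset.sum_congr rfl fun u _ => ?_
        split_ifs
        · ring
        · simp
    rw [hsplit]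
    refine (norm_add_le _ _).trans (add_le_add
      (h.norm_sum_filter_dvd_carryFactor_le hfour hκ t hm0) ?_)
    have hN := absNorm_pos hm0
    have hin : ∀ v ∈ bad, ‖∑ u ∈ digitSet q D κ with m ∣ u + v * q ^ κ,
        (f (u + v * q ^ κ) - f (v * q ^ κ) * carryFactor q D f κ ρ v u) *
          trChar t (u + v * q ^ κ)‖ ≤ 2 * (B₂ * absNorm q ^ κ / absNorm m) := by
      intro v _
      refine (norm_sum_le _ _).trans ?_
      have h1 := hB₂ μ κ (by omega) m (hS hm) hm0 (v * q ^ κ)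
        ((digitSet q D κ).filter fun u => m ∣ u + v * q ^ κ) (Finset.filter_subset _ _)
        fun u hu => (Finset.mem_filter.1 hu).2
      refine (Finset.sum_le_card_nsmul _ _ 2 fun u _ => ?_).trans ?_
      · rw [norm_mul, norm_trChar, mul_one]
        refine (norm_sub_le _ _).trans ?_
        rw [norm_mul, norm_carryFactor hf1, hf1, hf1]
        norm_num
      · rw [nsmul_eq_mul, mul_comm]
        gcongr
    refine (norm_sum_le _ _).trans ((Finset.sum_le_card_nsmul _ _ _ hin).trans ?_)
    rw [nsmul_eq_mul]
    gcongr
  refine (Finset.sum_le_sum hterm).trans ?_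
  rw [Finset.sum_add_distrib]
  have hmain : ∑ m ∈ S, ∑ v₀ ∈ digitSet q D ρ, (1 / absNorm m * ∑ ψ ∈ perp (Ideal.span {m}),
        ‖∑ u ∈ digitSet q D κ, carryFactor q D f κ ρ v₀ u * trChar t u * ψ u‖) * Φ ≤
      B₁ * (μ : ℝ) ^ (d + 1) * absNorm q ^ κ * (absNorm q ^ ρ * Φ) := by
    rw [Finset.sum_comm]
    have h1 : ∀ v₀ ∈ digitSet q D ρ, ∑ m ∈ S, (1 / absNorm m * ∑ ψ ∈ perp (Ideal.span {m}),
        ‖∑ u ∈ digitSet q D κ, carryFactor q D f κ ρ v₀ u * trChar t u * ψ u‖) * Φ ≤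
        B₁ * (μ : ℝ) ^ (d + 1) * absNorm q ^ κ * Φ := by
      intro v₀ _
      rw [← Finset.sum_mul]
      gcongr
      exact hB₁ μ hμ S hS hS0 (fun u => carryFactor q D f κ ρ v₀ u * trChar t u) fun u => by
        rw [norm_mul, norm_carryFactor hf1, norm_trChar, one_mul]
    refine (Finset.sum_le_card_nsmul _ _ _ h1).trans_eq ?_
    rw [nsmul_eq_mul, h.card_digitSet]
    ring
  have herr : ∑ m ∈ S, Ψ * (2 * (B₂ * absNorm q ^ κ / absNorm m)) ≤
      2 * B₂ * B₃ * (μ : ℝ) ^ (d + 1) * absNorm q ^ κ * Ψ := by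
    have h1 := hB₃ μ hμ ⊤ S hS fun m hm => ⟨hS0 m hm, Submodule.mem_top⟩
    rw [Ideal.absNorm_top, Nat.cast_one, div_one] at h1
    calc _ = 2 * B₂ * absNorm q ^ κ * Ψ * ∑ m ∈ S, 1 / absNorm m := by
          rw [Finset.mul_sum]
          exact Finset.sum_congr rfl fun m _ => by ring
      _ ≤ 2 * B₂ * absNorm q ^ κ * Ψ * (B₃ * (μ : ℝ) ^ (d + 1)) := by
          gcongr
          refine h1.trans ?_
          gcongr
          omega
      _ = _ := by ring
  refine (add_le_add hmain herr).trans ?_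
  have e1 : 0 ≤ B₁ * (μ : ℝ) ^ (d + 1) * absNorm q ^ κ * Ψ := by positivity
  have e2 : 0 ≤ 2 * B₂ * B₃ * (μ : ℝ) ^ (d + 1) * absNorm q ^ κ * (absNorm q ^ ρ * Φ) := by
    positivity
  nlinarith

end ExponentialSums

/-! ### The tile and its relation to digit sets. -/

section Tile

variable {K : Type*} [Field K] [NumberField K] {d : ℕ} {q : 𝓞 K} {D : Finset (𝓞 K)}

theorem coord_apply (w : Module.Basis (Fin d) ℤ (𝓞 K)) (x : K) (i : Fin d) :
    coord w x i = (((ratBasis w).repr x i : ℚ) : ℝ) := rfl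

theorem coord_sub (w : Module.Basis (Fin d) ℤ (𝓞 K)) (x y : K) :
    coord w (x - y) = coord w x - coord w y := by
  ext i
  simp [coord_apply]

theorem coord_add (w : Module.Basis (Fin d) ℤ (𝓞 K)) (x y : K) :
    coord w (x + y) = coord w x + coord w y := by
  ext i
  simp [coord_apply]

theorem exists_norm_embedding_le (w : Module.Basis (Fin d) ℤ (𝓞 K)) :
    ∃ C : ℝ, 0 ≤ C ∧ ∀ (x : K) (σ : K →+* ℂ), ‖σ x‖ ≤ C * ‖coord w x‖ := by
  obtain ⟨W, hW0, hW⟩ := exists_basis_bound w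
  refine ⟨d * W, by positivity, fun x σ => ?_⟩
  have hx := (ratBasis w).sum_repr x
  calc ‖σ x‖ = ‖∑ i, σ ((ratBasis w).repr x i • ratBasis w i)‖ := by rw [← map_sum, hx]
    _ ≤ ∑ i, ‖σ ((ratBasis w).repr x i • ratBasis w i)‖ := norm_sum_le _ _
    _ ≤ ∑ i : Fin d, ‖coord w x‖ * W := by
        refine Finset.sum_le_sum fun i _ => ?_
        rw [Algebra.smul_def, map_mul, norm_mul, ratBasis_apply]
        refine mul_le_mul ?_ (hW σ i).1 (norm_nonneg _) (norm_nonneg _)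
        have h1 : ‖σ (algebraMap ℚ K ((ratBasis w).repr x i))‖ = ‖coord w x i‖ := by
          rw [coord_apply, Real.norm_eq_abs, eq_ratCast, map_ratCast, Complex.norm_ratCast]
        rw [h1]
        exact PiLp.norm_apply_le _ i
    _ = _ := by
        simp
        ring

theorem repr_ratBasis_eq_trace (w : Module.Basis (Fin d) ℤ (𝓞 K)) (x : K) (i : Fin d) :
    (ratBasis w).repr x i = Algebra.trace ℚ K (x * (ratBasis w).traceDual i) := by
  have h := (ratBasis w).traceDual.traceDual_repr_apply x i
  rwa [Module.Basis.traceDual_traceDual] at h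

theorem exists_norm_coord_le (w : Module.Basis (Fin d) ℤ (𝓞 K)) :
    ∃ C : ℝ, 0 ≤ C ∧ ∀ (x : K) (R : ℝ), (∀ σ : K →+* ℂ, ‖σ x‖ ≤ R) → ‖coord w x‖ ≤ C * R := by
  obtain ⟨W, hW0, hW⟩ := exists_basis_bound w
  refine ⟨d * (Fintype.card (K →+* ℂ) * W), by positivity, fun x R hR => ?_⟩
  have hR0 : 0 ≤ R := (norm_nonneg _).trans (hR (Classical.arbitrary _))
  have hi : ∀ i, ‖coord w x i‖ ≤ Fintype.card (K →+* ℂ) * W * R := by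
    intro i
    rw [coord_apply, repr_ratBasis_eq_trace, Real.norm_eq_abs]
    refine (abs_trace_le _).trans ?_
    calc _ ≤ ∑ σ : K →+* ℂ, R * W := by
          refine Finset.sum_le_sum fun σ _ => ?_
          rw [map_mul, norm_mul]
          exact mul_le_mul (hR σ) (hW σ i).2 (norm_nonneg _) hR0
      _ = _ := by
          simp
          ring
  calc ‖coord w x‖ = ‖∑ i, coord w x i • EuclideanSpace.basisFun (Fin d) ℝ i‖ := by
        conv_lhs => rw [← (EuclideanSpace.basisFun (Fin d) ℝ).sum_repr (coord w x)]
        simp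
    _ ≤ ∑ i, ‖coord w x i • EuclideanSpace.basisFun (Fin d) ℝ i‖ := norm_sum_le _ _
    _ ≤ ∑ i : Fin d, Fintype.card (K →+* ℂ) * W * R := by
        refine Finset.sum_le_sum fun i _ => ?_
        rw [norm_smul, OrthonormalBasis.norm_eq_one, mul_one]
        exact hi i
    _ = _ := by
        simp
        ring

theorem IsFNS.mem_ratTile (h : IsFNS q D) {x : K} :
    x ∈ ratTile q D ↔ ∃ r, 1 ≤ r ∧ ∃ n ∈ digitSet q D r, x = (n : K) / (q : K) ^ r := by
  have hq := h.coe_ne_zero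
  have key : ∀ (r : ℕ) (b : Fin r → D),
      ∑ j, ((b j : 𝓞 K) : K) * ((q : K) ^ ((j : ℕ) + 1))⁻¹ =
        ((∑ j : Fin r, (b j.rev : 𝓞 K) * q ^ (j : ℕ) : 𝓞 K) : K) / (q : K) ^ r := by
    intro r b
    rw [← Equiv.sum_comp Fin.revPerm]
    push_cast
    rw [Finset.sum_div]
    refine Finset.sum_congr rfl fun j _ => ?_
    have hj : (j : ℕ) + ((j.rev : ℕ) + 1) = r := by
      rw [Fin.val_rev]
      omega
    have hpow : (q : K) ^ r = (q : K) ^ (j : ℕ) * (q : K) ^ ((j.rev : ℕ) + 1) := by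
      rw [← pow_add, hj]
    rw [hpow, Fin.revPerm_apply]
    field_simp
  constructor
  · rintro ⟨r, hr, b, rfl⟩
    exact ⟨r, hr, _, mem_digitSet.2 ⟨fun j => b j.rev, rfl⟩, key r b⟩
  · rintro ⟨r, hr, n, hn, rfl⟩
    obtain ⟨b, rfl⟩ := mem_digitSet.1 hn
    refine ⟨r, hr, fun j => b j.rev, ?_⟩
    rw [key]
    simp

/-- Multiplication by `q^e` moves the first `e` digits to the integral part; the remaining
fractional part is bounded in every embedding. -/
theorem IsFNS.exists_approx_ratTile (h : IsFNS q D) :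
    ∃ C : ℝ, 0 ≤ C ∧ ∀ x ∈ ratTile q D, ∀ e : ℕ, ∃ v ∈ digitSet q D e,
      ∀ σ : K →+* ℂ, ‖σ ((q : K) ^ e * x - v)‖ ≤ C := by
  have hq := h.coe_ne_zero
  obtain ⟨C, hC1, hC⟩ := h.exists_norm_le
  refine ⟨C, by linarith, fun x hx e => ?_⟩
  obtain ⟨r, -, n, hn, rfl⟩ := h.mem_ratTile.1 hx
  rcases le_total e r with her | her
  · obtain ⟨p, rfl⟩ := Nat.exists_eq_add_of_le' her
    obtain ⟨u, hu, v, hv, rfl⟩ := mem_digitSet_add.1 hn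
    refine ⟨v, hv, fun σ => ?_⟩
    have h1 : (q : K) ^ e * (((u + v * q ^ p : 𝓞 K) : K) / (q : K) ^ (p + e)) - v =
        (u : K) / (q : K) ^ p := by
      push_cast
      rw [pow_add]
      field_simp
      ring
    rw [h1, map_div₀, norm_div, map_pow, norm_pow,
      div_le_iff₀ (pow_pos (by linarith [h.one_lt_conj σ]) _)]
    exact hC p u hu σ
  · obtain ⟨p, rfl⟩ := Nat.exists_eq_add_of_le' her
    refine ⟨n * q ^ p, mem_digitSet_add.2 ⟨0, h.zero_mem_digitSet p, n, hn, by simp⟩,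
      fun σ => ?_⟩
    have h1 : (q : K) ^ (p + r) * ((n : K) / (q : K) ^ r) - ((n * q ^ p : 𝓞 K) : K) = 0 := by
      push_cast
      rw [pow_add]
      field_simp
      ring
    rw [h1, map_zero, norm_zero]
    linarith

/-- Passing to the closure loses nothing at the points `n / q^j`. Approximate the point by the
rational tile and scale up by `p` further digits: the difference of the integers `v` and `n q^p` is
bounded, hence has at most `p` digits, with `p` independent of the approximation. Uniqueness of
digits then shows that `n` has no digit beyond index `j + k - 1`. -/
theorem IsFNS.mem_digitSet_of_coord_mem_tile (h : IsFNS q D) (w : Module.Basis (Fin d) ℤ (𝓞 K))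
    {k j : ℕ} {n : 𝓞 K} (hn : coord w ((n : K) / (q : K) ^ j) ∈ tile q D w k) :
    n ∈ digitSet q D (j + k) := by
  have hq := h.coe_ne_zero
  obtain ⟨A, hA0, hA⟩ := exists_norm_embedding_le w
  obtain ⟨C, hC0, hC⟩ := h.exists_approx_ratTile
  obtain ⟨p, hp⟩ := h.exists_mem_digitSet_of_bounded (1 + C)
  set M : ℝ := ∑ σ : K →+* ℂ, ‖σ (q : K)‖ ^ (j + p) with hM
  have hσM : ∀ σ : K →+* ℂ, ‖σ (q : K)‖ ^ (j + p) ≤ M := fun σ =>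
    Finset.single_le_sum (f := fun σ : K →+* ℂ => ‖σ (q : K)‖ ^ (j + p))
      (fun _ _ => by positivity) (Finset.mem_univ σ)
  have hM0 : 0 ≤ M := by positivity
  -- The tolerance keeps the error at most `1` in every embedding after multiplication by `q^(j+p)`.
  obtain ⟨_, ⟨x, hx, rfl⟩, hdist⟩ := Metric.mem_closure_iff.1 hn (1 / (A * M + 1)) (by positivity)
  obtain ⟨v, hv, hvσ⟩ := hC x hx (j + p + k)
  have hb : ∀ σ : K →+* ℂ, ‖σ ((v - n * q ^ p : 𝓞 K) : K)‖ ≤ 1 + C := by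
    intro σ
    have e1 : ((v - n * q ^ p : 𝓞 K) : K) =
        -((q : K) ^ (j + p) * ((n : K) / (q : K) ^ j - (q : K) ^ k * x)) -
          ((q : K) ^ (j + p + k) * x - v) := by
      push_cast
      rw [pow_add, pow_add]
      field_simp
      ring
    rw [e1, map_sub, map_neg, map_mul, map_pow]
    refine (norm_sub_le _ _).trans (add_le_add ?_ (hvσ σ))
    rw [norm_neg, norm_mul, norm_pow]
    have h1 := hA ((n : K) / (q : K) ^ j - (q : K) ^ k * x) σ
    rw [coord_sub, ← dist_eq_norm] at h1
    calc _ ≤ M * (A * (1 / (A * M + 1))) := by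
          refine mul_le_mul (hσM σ) (h1.trans ?_) (norm_nonneg _) hM0
          gcongr
      _ ≤ 1 := by
          rw [mul_one_div, mul_div_assoc', div_le_one (by positivity)]
          nlinarith
  have hbp := hp _ hb
  have hr := h.lowDigits_mem (j + k) n
  obtain ⟨s, hs⟩ := h.dvd_sub_lowDigits (j + k) n
  set r := lowDigits q D (j + k) n
  -- Replacing `n` by its low part `r` does not change the class modulo `q^(p+j+k)`, so this element
  -- must be `v`.
  have hmem : (v - n * q ^ p) + r * q ^ p ∈ digitSet q D (p + (j + k)) :=
    mem_digitSet_add.2 ⟨_, hbp, r, hr, rfl⟩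
  rw [show j + p + k = p + (j + k) by ring] at hv
  have heq := h.digitSet_unique hv hmem ⟨s, by
    rw [pow_add]
    linear_combination q ^ p * hs⟩
  have h2 : (n - r) * q ^ p = 0 := by linear_combination heq
  have h3 : n = r := sub_eq_zero.1 ((mul_eq_zero.1 h2).resolve_right (pow_ne_zero _ h.ne_zero))
  rwa [h3]

theorem exists_coord_near (w : Module.Basis (Fin d) ℤ (𝓞 K)) (x : EuclideanSpace ℝ (Fin d))
    {ε : ℝ} (hε : 0 < ε) : ∃ y : K, dist x (coord w y) < ε := by
  have h1 : DenseRange fun c : Fin d → ℚ => (fun i => ((c i : ℚ) : ℝ)) := by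
    exact DenseRange.piMap fun _ => Rat.isDenseEmbedding_coe_real.dense
  have h2 : DenseRange fun c : Fin d → ℚ => (WithLp.toLp 2 fun i => ((c i : ℚ) : ℝ) :
      EuclideanSpace ℝ (Fin d)) :=
    ((WithLp.equiv 2 (Fin d → ℝ)).symm.surjective.denseRange).comp h1
      (PiLp.continuous_toLp 2 _)
  obtain ⟨c, hc⟩ := h2.exists_dist_lt x hε
  refine ⟨∑ i, c i • ratBasis w i, ?_⟩
  refine lt_of_eq_of_lt (congrArg (dist x) ?_) hc
  ext i
  rw [coord_apply, Module.Basis.repr_sum_self]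

/-- The points `n / q^i` are dense. When such a point is near the ball, the quotient of `n` by `q^i`
has conjugates bounded in terms of `R`, hence at most `p` digits, and `n / q^(i+p)` is in the
rational tile. -/
theorem IsFNS.exists_closedBall_subset_tile (h : IsFNS q D) (w : Module.Basis (Fin d) ℤ (𝓞 K))
    (R : ℝ) : ∃ k : ℕ, Metric.closedBall 0 R ⊆ tile q D w k := by
  have hq := h.coe_ne_zero
  obtain ⟨A, hA0, hA⟩ := exists_norm_embedding_le w
  obtain ⟨A', hA0', hA'⟩ := exists_norm_coord_le w
  obtain ⟨B, hB0, hB⟩ := exists_round K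
  obtain ⟨C, hC1, hC⟩ := h.exists_norm_le
  obtain ⟨p, hp⟩ := h.exists_mem_digitSet_of_bounded (A * (R + 1) + C)
  refine ⟨p, fun x hx => Metric.mem_closure_iff.2 fun ε hε => ?_⟩
  rw [mem_closedBall_zero_iff] at hx
  set δ := min ε 1 with hδ
  have hδ0 : 0 < δ := lt_min hε one_pos
  obtain ⟨y, hy⟩ := exists_coord_near w x (half_pos hδ0)
  have hsmall : ∀ σ : K →+* ℂ, ∀ᶠ i : ℕ in Filter.atTop,
      A' * (B / ‖σ (q : K)‖ ^ i) < δ / 2 := by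
    intro σ
    have h1 : Filter.Tendsto (fun i : ℕ => A' * (B / ‖σ (q : K)‖ ^ i)) Filter.atTop
        (nhds (A' * 0)) :=
      ((tendsto_pow_atTop_atTop_of_one_lt (h.one_lt_conj σ)).const_div_atTop B).const_mul A'
    rw [mul_zero] at h1
    exact h1.eventually (gt_mem_nhds (half_pos hδ0))
  obtain ⟨i, hi1, hi⟩ := ((Filter.eventually_ge_atTop 1).and
    (Filter.eventually_all.2 hsmall)).exists
  obtain ⟨n, hn⟩ := hB ((q : K) ^ i * y)
  have hq0 : ∀ σ : K →+* ℂ, 0 < ‖σ (q : K)‖ := fun σ => by linarith [h.one_lt_conj σ]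
  have hdist : ‖coord w (y - (n : K) / (q : K) ^ i)‖ < δ / 2 := by
    have hσ : ∀ σ : K →+* ℂ, ‖σ (y - (n : K) / (q : K) ^ i)‖ ≤ B / ‖σ (q : K)‖ ^ i := by
      intro σ
      rw [le_div_iff₀ (pow_pos (hq0 σ) i), ← norm_pow, ← norm_mul, ← map_pow σ, ← map_mul σ]
      have e : (y - (n : K) / (q : K) ^ i) * (q : K) ^ i = (q : K) ^ i * y - n := by field_simp
      rw [e]
      exact hn σ
    obtain ⟨σ₀, hσ₀⟩ := Finite.exists_max fun σ : K →+* ℂ => B / ‖σ (q : K)‖ ^ i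
    exact lt_of_le_of_lt (hA' _ _ fun σ => (hσ σ).trans (hσ₀ σ)) (hi σ₀)
  have hxn : dist x (coord w ((n : K) / (q : K) ^ i)) < δ := by
    refine (dist_triangle _ (coord w y) _).trans_lt ?_
    rw [dist_eq_norm (coord w y), ← coord_sub]
    linarith
  have hnorm : ‖coord w ((n : K) / (q : K) ^ i)‖ ≤ R + 1 := by
    have h1 : δ ≤ 1 := min_le_right _ _
    have h2 := norm_sub_norm_le (coord w ((n : K) / (q : K) ^ i)) x
    rw [← dist_eq_norm, dist_comm] at h2
    linarith
  obtain ⟨s, hs⟩ := h.dvd_sub_lowDigits i n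
  have hr := h.lowDigits_mem i n
  set r := lowDigits q D i n
  have hsp : s ∈ digitSet q D p := by
    refine hp s fun σ => ?_
    have e1 : (s : K) = (n : K) / (q : K) ^ i - (r : K) / (q : K) ^ i := by
      have : (n : K) - r = (q : K) ^ i * s := by exact_mod_cast congrArg (fun x : 𝓞 K => (x : K)) hs
      rw [← sub_div, this]
      field_simp
    rw [e1, map_sub]
    refine (norm_sub_le _ _).trans (add_le_add ?_ ?_)
    · refine (hA _ σ).trans ?_
      gcongr
    · rw [map_div₀, norm_div, map_pow, norm_pow, div_le_iff₀ (pow_pos (hq0 σ) _)]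
      exact hC i r hr σ
  have hnmem : n ∈ digitSet q D (i + p) :=
    mem_digitSet_add.2 ⟨r, hr, s, hsp, by linear_combination hs⟩
  refine ⟨_, ⟨(n : K) / (q : K) ^ (i + p), h.mem_ratTile.2 ⟨i + p, by omega, n, hnmem, rfl⟩, rfl⟩,
    ?_⟩
  have e2 : (q : K) ^ p * ((n : K) / (q : K) ^ (i + p)) = (n : K) / (q : K) ^ i := by
    rw [pow_add]
    field_simp
  simp only [e2]
  exact hxn.trans_le (min_le_left _ _)

end Tile

/-! ### Periodization and Fourier series on the torus. -/

section Poisson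

open MeasureTheory
open scoped Pointwise

variable {d : ℕ}

/-- The lattice `ℤ ^ d` in `ℝ ^ d`. -/
abbrev intLattice (d : ℕ) : Submodule ℤ (Fin d → ℝ) :=
  Submodule.span ℤ (Set.range (Pi.basisFun ℝ (Fin d)))

theorem mem_intLattice {s : Fin d → ℝ} : s ∈ intLattice d ↔ ∀ i, ∃ n : ℤ, (n : ℝ) = s i := by
  rw [Module.Basis.mem_span_iff_repr_mem]
  simp

/-- The projection `ℝ ^ d → (ℝ / ℤ) ^ d`. -/
def torusMk (x : Fin d → ℝ) : UnitAddTorus (Fin d) := fun i => (x i : UnitAddCircle)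

theorem isOpenQuotientMap_torusMk : IsOpenQuotientMap (torusMk (d := d)) :=
  IsOpenQuotientMap.piMap fun _ => QuotientAddGroup.isOpenQuotientMap_mk

theorem torusMk_eq_iff {x y : Fin d → ℝ} : torusMk x = torusMk y ↔ x - y ∈ intLattice d := by
  rw [mem_intLattice, funext_iff]
  refine forall_congr' fun i => ?_
  have h : ((x i : UnitAddCircle) = (y i : UnitAddCircle)) ↔
      (((x i - y i : ℝ)) : UnitAddCircle) = 0 := by
    rw [AddCircle.coe_sub, sub_eq_zero]
  rw [torusMk, torusMk, h, AddCircle.coe_eq_zero_iff]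
  simp

theorem exists_finset_forall_notMem_eq_zero {g : (Fin d → ℝ) → ℂ} (hg : HasCompactSupport g)
    {B : Set (Fin d → ℝ)} (hB : Bornology.IsBounded B) :
    ∃ F : Finset (intLattice d), ∀ s ∉ F, ∀ x ∈ B, g ((s : Fin d → ℝ) + x) = 0 := by
  have hfin : Set.Finite ((tsupport g - B) ∩ (intLattice d : Set (Fin d → ℝ))) :=
    ZSpan.setFinite_inter _ (hg.isCompact.isBounded.sub hB)
  have hfin' : {s : intLattice d | (s : Fin d → ℝ) ∈ tsupport g - B}.Finite := by
    refine Set.Finite.of_finite_image (f := fun s : intLattice d => (s : Fin d → ℝ))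
      (hfin.subset ?_) Subtype.val_injective.injOn
    rintro _ ⟨s, hs, rfl⟩
    exact ⟨hs, s.2⟩
  refine ⟨hfin'.toFinset, fun s hs x hx => ?_⟩
  by_contra hne
  refine hs ?_
  rw [Set.Finite.mem_toFinset]
  exact ⟨(s : Fin d → ℝ) + x, subset_tsupport g hne, x, hx, by simp⟩

/-- The periodization of `g` along `ℤ ^ d`. -/
def periodization (g : (Fin d → ℝ) → ℂ) (x : Fin d → ℝ) : ℂ :=
  ∑' s : intLattice d, g ((s : Fin d → ℝ) + x)

theorem continuous_periodization {g : (Fin d → ℝ) → ℂ} (hg : Continuous g)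
    (hgc : HasCompactSupport g) : Continuous (periodization g) := by
  rw [continuous_iff_continuousAt]
  intro x
  obtain ⟨F, hF⟩ := exists_finset_forall_notMem_eq_zero hgc
    (Metric.isBounded_ball (x := x) (r := 1))
  have h1 : (fun y => ∑ s ∈ F, g ((s : Fin d → ℝ) + y)) =ᶠ[nhds x] periodization g := by
    filter_upwards [Metric.ball_mem_nhds x one_pos] with y hy
    exact (tsum_eq_sum fun s hs => hF s hs y hy).symm
  refine ContinuousAt.congr ?_ h1
  exact (by fun_prop : Continuous fun y => ∑ s ∈ F, g ((s : Fin d → ℝ) + y)).continuousAt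

theorem periodization_add (g : (Fin d → ℝ) → ℂ) (s : intLattice d) (x : Fin d → ℝ) :
    periodization g ((s : Fin d → ℝ) + x) = periodization g x := by
  rw [periodization, periodization,
    ← (Equiv.addRight s).tsum_eq fun t : intLattice d => g ((t : Fin d → ℝ) + x)]
  refine tsum_congr fun t => ?_
  simp [add_assoc]

/-- The periodization of `g`, as a continuous function on the torus. -/
def torusPeriodization {g : (Fin d → ℝ) → ℂ} (hg : Continuous g) (hgc : HasCompactSupport g) :
    C(UnitAddTorus (Fin d), ℂ) :=
  have hcomp : (fun t => periodization g
      (Function.surjInv isOpenQuotientMap_torusMk.surjective t)) ∘ torusMk = periodization g := by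
    funext x
    have h1 := torusMk_eq_iff.1
      (Function.surjInv_eq isOpenQuotientMap_torusMk.surjective (torusMk x))
    have h2 := periodization_add g ⟨_, h1⟩ x
    simpa using h2
  { toFun := fun t => periodization g (Function.surjInv isOpenQuotientMap_torusMk.surjective t)
    continuous_toFun := by
      rw [← isOpenQuotientMap_torusMk.continuous_comp_iff, hcomp]
      exact continuous_periodization hg hgc }

theorem torusPeriodization_torusMk {g : (Fin d → ℝ) → ℂ} (hg : Continuous g)
    (hgc : HasCompactSupport g) (x : Fin d → ℝ) :
    torusPeriodization hg hgc (torusMk x) = periodization g x := by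
  have h1 := torusMk_eq_iff.1
    (Function.surjInv_eq isOpenQuotientMap_torusMk.surjective (torusMk x))
  have h2 := periodization_add g ⟨_, h1⟩ x
  simp only [sub_add_cancel] at h2
  exact h2

theorem mFourier_torusMk (n : Fin d → ℤ) (x : Fin d → ℝ) :
    UnitAddTorus.mFourier n (torusMk x) =
      Complex.exp (2 * Real.pi * Complex.I * ((∑ i, (n i : ℝ) * x i : ℝ) : ℂ)) := by
  simp only [UnitAddTorus.mFourier, ContinuousMap.coe_mk, torusMk]
  simp only [fourier_coe_apply]
  rw [← Complex.exp_sum]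
  congr 1
  push_cast
  rw [Finset.mul_sum]
  exact Finset.sum_congr rfl fun i _ => by ring

theorem continuous_torusMk : Continuous (torusMk (d := d)) :=
  isOpenQuotientMap_torusMk.continuous

/-- Unfolding: the integral over `ℝ^d` is the sum of the integrals over translates of a fundamental
cube. By compact support only finitely many translates count, so sum and integral commute. -/
theorem mFourierCoeff_torusPeriodization {g : (Fin d → ℝ) → ℂ} (hg : Continuous g)
    (hgc : HasCompactSupport g) (n : Fin d → ℤ) :
    UnitAddTorus.mFourierCoeff (torusPeriodization hg hgc) n =
      ∫ x : Fin d → ℝ, UnitAddTorus.mFourier (-n) (torusMk x) * g x := by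
  rw [UnitAddTorus.mFourierCoeff_eq_integral _ n 0]
  have hcube : ({x : Fin d → ℝ | ∀ i, x i ∈ Set.Ioc ((0 : Fin d → ℝ) i) ((0 : Fin d → ℝ) i + 1)} :
      Set (Fin d → ℝ)) =ᵐ[volume] ZSpan.fundamentalDomain (Pi.basisFun ℝ (Fin d)) := by
    rw [ZSpan.fundamentalDomain_pi_basisFun]
    have h1 : ({x : Fin d → ℝ | ∀ i, x i ∈ Set.Ioc ((0 : Fin d → ℝ) i)
        ((0 : Fin d → ℝ) i + 1)} : Set (Fin d → ℝ)) =
        Set.pi Set.univ fun _ : Fin d => Set.Ioc (0 : ℝ) 1 := by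
      ext x
      simp
    rw [h1]
    exact (Measure.univ_pi_Ioc_ae_eq_Icc (f := fun _ => (0 : ℝ)) (g := fun _ => (1 : ℝ))).trans
      (Measure.univ_pi_Ico_ae_eq_Icc (f := fun _ => (0 : ℝ)) (g := fun _ => (1 : ℝ))).symm
  rw [setIntegral_congr_set hcube]
  set Ω := ZSpan.fundamentalDomain (Pi.basisFun ℝ (Fin d)) with hΩ
  have hΩb : Bornology.IsBounded Ω := ZSpan.fundamentalDomain_isBounded _
  obtain ⟨F, hF⟩ := exists_finset_forall_notMem_eq_zero hgc hΩb
  set k : (Fin d → ℝ) → ℂ := fun x => UnitAddTorus.mFourier (-n) (torusMk x) * g x with hk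
  have hkc : Continuous k :=
    ((UnitAddTorus.mFourier (-n)).continuous.comp continuous_torusMk).mul hg
  have hkcs : HasCompactSupport k := hgc.mul_left
  have hkint : Integrable k := hkc.integrable_of_hasCompactSupport hkcs
  have hΩm : MeasurableSet Ω := ZSpan.fundamentalDomain_measurableSet _
  have : VAddInvariantMeasure (intLattice d) (Fin d → ℝ) volume :=
    ⟨fun c s _ => measure_preimage_add volume (c : Fin d → ℝ) s⟩
  rw [(ZSpan.isAddFundamentalDomain (Pi.basisFun ℝ (Fin d)) volume).integral_eq_tsum'' k hkint,
    ← hΩ, tsum_eq_sum (s := F)]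
  · rw [← integral_finsetSum]
    · refine setIntegral_congr_fun hΩm fun x hx => ?_
      have h1 : (torusPeriodization hg hgc) (torusMk x) = ∑ s ∈ F, g ((s : Fin d → ℝ) + x) := by
        rw [torusPeriodization_torusMk, periodization, tsum_eq_sum fun s hs => hF s hs x hx]
      change UnitAddTorus.mFourier (-n) (torusMk x) • (torusPeriodization hg hgc) (torusMk x) = _
      rw [h1, smul_eq_mul, Finset.mul_sum]
      refine Finset.sum_congr rfl fun s _ => ?_
      have h2 : torusMk ((s : Fin d → ℝ) + x) = torusMk x :=
        torusMk_eq_iff.2 (by simp)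
      change _ = UnitAddTorus.mFourier (-n) (torusMk ((s : Fin d → ℝ) + x)) *
        g ((s : Fin d → ℝ) + x)
      rw [h2]
    · intro s _
      exact (hkint.comp_add_left (s : Fin d → ℝ)).integrableOn
  · intro s hs
    rw [setIntegral_congr_fun hΩm (g := fun _ => (0 : ℂ))]
    · simp
    · intro x hx
      change UnitAddTorus.mFourier (-n) (torusMk ((s : Fin d → ℝ) + x)) *
        g ((s : Fin d → ℝ) + x) = 0
      rw [hF s hs x hx, mul_zero]

theorem hasSum_periodization {g : (Fin d → ℝ) → ℂ} (hg : Continuous g)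
    (hgc : HasCompactSupport g)
    (hs : Summable fun n : Fin d → ℤ =>
      ∫ x : Fin d → ℝ, UnitAddTorus.mFourier (-n) (torusMk x) * g x) (x : Fin d → ℝ) :
    HasSum (fun n : Fin d → ℤ =>
      (∫ y : Fin d → ℝ, UnitAddTorus.mFourier (-n) (torusMk y) * g y) *
        UnitAddTorus.mFourier n (torusMk x)) (periodization g x) := by
  have hcoef := funext (mFourierCoeff_torusPeriodization hg hgc)
  have h1 := UnitAddTorus.hasSum_mFourier_series_apply_of_summable
    (f := torusPeriodization hg hgc) (by rw [hcoef]; exact hs) (torusMk x)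
  rw [torusPeriodization_torusMk, hcoef] at h1
  exact h1

theorem finrank_intLattice : Module.finrank ℤ (intLattice d) = d := by
  rw [ZLattice.rank ℝ (intLattice d), Module.finrank_fin_fun]

/-- The integer vector `n`, as an element of `intLattice d`. -/
def intVector (n : Fin d → ℤ) : intLattice d :=
  ⟨fun i => (n i : ℝ), mem_intLattice.2 fun i => ⟨n i, rfl⟩⟩

theorem intVector_injective : Function.Injective (intVector (d := d)) := by
  intro n m hnm
  funext i
  have h1 : ((n i : ℤ) : ℝ) = (m i : ℤ) := congrFun (congrArg Subtype.val hnm) i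
  exact_mod_cast h1

theorem summable_norm_intLattice_rpow {r : ℝ} (hr : r < -d) :
    Summable fun z : intLattice d => ‖z‖ ^ r := by
  refine ZLattice.summable_norm_rpow (intLattice d) r ?_
  rw [finrank_intLattice]
  exact hr

theorem summable_norm_int_rpow {r : ℝ} (hr : r < -d) :
    Summable fun n : Fin d → ℤ => ‖intVector n‖ ^ r :=
  (summable_norm_intLattice_rpow hr).comp_injective intVector_injective

end Poisson

/-! ### Fourier expansion of the weight on a digit set. -/

section FourierExpansion

open MeasureTheory

variable {K : Type*} [Field K] [NumberField K] {d : ℕ} {q : 𝓞 K} {D : Finset (𝓞 K)}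

/-- The matrix of the multiplication by `q ^ k` in the basis `w`. -/
def mulMatrix (w : Module.Basis (Fin d) ℤ (𝓞 K)) (q : 𝓞 K) (k : ℕ) :
    Matrix (Fin d) (Fin d) ℝ :=
  (Algebra.leftMulMatrix (ratBasis w) ((q : K) ^ k)).map (algebraMap ℚ ℝ)

theorem toLp_mulMatrix_mulVec_coord (w : Module.Basis (Fin d) ℤ (𝓞 K)) (q : 𝓞 K) (k : ℕ) (x : K) :
    WithLp.toLp 2 ((mulMatrix w q k).mulVec (coord w x).ofLp) = coord w ((q : K) ^ k * x) := by
  ext i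
  rw [coord_apply, ← Algebra.leftMulMatrix_mulVec_repr]
  simp [Matrix.mulVec, dotProduct, mulMatrix, coord_apply]

theorem abs_det_mulMatrix (w : Module.Basis (Fin d) ℤ (𝓞 K)) (q : 𝓞 K) (k : ℕ) :
    |(mulMatrix w q k).det| = absNorm q ^ k := by
  have h1 : (mulMatrix w q k).det = algebraMap ℚ ℝ (Algebra.norm ℚ ((q : K) ^ k)) := by
    rw [Algebra.norm_eq_matrix_det (ratBasis w), RingHom.map_det]
    rfl
  rw [h1, map_pow, ← Algebra.coe_norm_int, absNorm]
  simp [abs_pow]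

theorem det_mulMatrix_ne_zero (w : Module.Basis (Fin d) ℤ (𝓞 K)) (hq : q ≠ 0) (k : ℕ) :
    (mulMatrix w q k).det ≠ 0 := by
  rw [← abs_pos, abs_det_mulMatrix]
  exact pow_pos (absNorm_pos hq) k

theorem dualCoord_apply (w : Module.Basis (Fin d) ℤ (𝓞 K)) (ξ : K) (i : Fin d) :
    dualCoord w ξ i = ((Algebra.trace ℚ K (ξ * (w i : K)) : ℚ) : ℝ) := by
  change (((ratBasis w).traceDual.repr ξ i : ℚ) : ℝ) = _
  rw [Module.Basis.traceDual_repr_apply, ratBasis_apply]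
  rfl

/-- Multiplication by `q^k` is self-adjoint for the trace form. -/
theorem dualCoord_dotProduct_mulVec (w : Module.Basis (Fin d) ℤ (𝓞 K)) (q : 𝓞 K) (k : ℕ) (ξ : K)
    (x : Fin d → ℝ) :
    ∑ i, dualCoord w ξ i * (mulMatrix w q k).mulVec x i =
      ∑ j, dualCoord w ((q : K) ^ k * ξ) j * x j := by
  have h1 : ∀ j, dualCoord w ((q : K) ^ k * ξ) j =
      ∑ i, dualCoord w ξ i * mulMatrix w q k i j := by
    intro j
    have h2 : (q : K) ^ k * (w j : K) =
        ∑ i, Algebra.leftMulMatrix (ratBasis w) ((q : K) ^ k) i j • (w i : K) := by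
      conv_lhs => rw [← (ratBasis w).sum_repr ((q : K) ^ k * (w j : K))]
      refine Finset.sum_congr rfl fun i _ => ?_
      rw [Algebra.leftMulMatrix_eq_repr_mul, ratBasis_apply, ratBasis_apply]
    rw [dualCoord_apply, show (q : K) ^ k * ξ * (w j : K) = ξ * ((q : K) ^ k * (w j : K)) by ring,
      h2, Finset.mul_sum, map_sum, Rat.cast_sum]
    refine Finset.sum_congr rfl fun i _ => ?_
    rw [mul_smul_comm, map_smul, dualCoord_apply, mulMatrix, Matrix.map_apply, smul_eq_mul,
      Rat.cast_mul, mul_comm]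
    rfl
  simp only [h1, Matrix.mulVec, dotProduct, Finset.mul_sum, Finset.sum_mul]
  rw [Finset.sum_comm]
  exact Finset.sum_congr rfl fun j _ => Finset.sum_congr rfl fun i _ => by ring

/-- The element `-q ^ (-k) ∑ n_i ω_i^∨` of `q ^ (-k) 𝓞^∨`. -/
def dualVector (w : Module.Basis (Fin d) ℤ (𝓞 K)) (q : 𝓞 K) (k : ℕ) (n : Fin d → ℤ) : K :=
  ((q : K) ^ k)⁻¹ * ∑ i, (-(n i : ℚ)) • (ratBasis w).traceDual i

theorem pow_mul_dualVector (w : Module.Basis (Fin d) ℤ (𝓞 K)) (hq : q ≠ 0) (k : ℕ)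
    (n : Fin d → ℤ) :
    (q : K) ^ k * dualVector w q k n = ∑ i, (-(n i : ℚ)) • (ratBasis w).traceDual i := by
  have hqK : (q : K) ≠ 0 := by simpa using hq
  rw [dualVector, mul_inv_cancel_left₀ (pow_ne_zero k hqK)]

theorem dualCoord_pow_mul_dualVector (w : Module.Basis (Fin d) ℤ (𝓞 K)) (hq : q ≠ 0) (k : ℕ)
    (n : Fin d → ℤ) (i : Fin d) :
    dualCoord w ((q : K) ^ k * dualVector w q k n) i = -(n i : ℝ) := by
  rw [pow_mul_dualVector w hq, dualCoord_apply, trace_sum_smul_traceDual_mul]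
  push_cast
  rfl

theorem trace_pow_mul_dualVector_mul (w : Module.Basis (Fin d) ℤ (𝓞 K)) (hq : q ≠ 0) (k : ℕ)
    (n : Fin d → ℤ) (y : K) :
    Algebra.trace ℚ K ((q : K) ^ k * dualVector w q k n * y) =
      -∑ i, (n i : ℚ) * (ratBasis w).repr y i := by
  rw [pow_mul_dualVector w hq, Finset.sum_mul, map_sum, ← Finset.sum_neg_distrib]
  refine Finset.sum_congr rfl fun i _ => ?_
  rw [smul_mul_assoc, map_smul, repr_ratBasis_eq_trace, smul_eq_mul, mul_comm y]
  ring

theorem dualVector_mem (w : Module.Basis (Fin d) ℤ (𝓞 K)) (hq : q ≠ 0) (k : ℕ) (n : Fin d → ℤ) :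
    dualVector w q k n ∈ dualLattice q k := by
  change _ ∈ Submodule.traceDual ℤ ℚ (1 : Submodule (𝓞 K) K)
  rw [Submodule.mem_traceDual]
  rintro _ ha
  obtain ⟨a, rfl⟩ := Submodule.mem_one.1 ha
  refine ⟨-∑ i, n i * w.repr a i, ?_⟩
  change _ = Algebra.trace ℚ K ((q : K) ^ k * dualVector w q k n * (a : K))
  rw [trace_pow_mul_dualVector_mul w hq]
  have h1 : ∀ i, (ratBasis w).repr (a : K) i = w.repr a i := fun i => by
    exact Module.Basis.localizationLocalization_repr_algebraMap ℚ (nonZeroDivisors ℤ) K w a i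
  simp [h1]

/-- The parametrization of `q ^ (-k) 𝓞^∨` by integer vectors. -/
def dualVectorEquiv (w : Module.Basis (Fin d) ℤ (𝓞 K)) (hq : q ≠ 0) (k : ℕ) :
    (Fin d → ℤ) ≃ dualLattice q k :=
  Equiv.ofBijective (fun n => ⟨dualVector w q k n, dualVector_mem w hq k n⟩) <| by
    constructor
    · intro n m hnm
      funext i
      have h1 : dualVector w q k n = dualVector w q k m := congrArg Subtype.val hnm
      have h2 := dualCoord_pow_mul_dualVector w hq k n i
      rw [h1, dualCoord_pow_mul_dualVector w hq k m i] at h2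
      exact Int.cast_injective (neg_injective h2).symm
    · rintro ⟨ξ, hξ⟩
      change _ ∈ Submodule.traceDual ℤ ℚ (1 : Submodule (𝓞 K) K) at hξ
      rw [Submodule.mem_traceDual] at hξ
      choose n hn using fun i => hξ (w i : K) (Submodule.mem_one.2 ⟨w i, rfl⟩)
      refine ⟨fun i => -n i, Subtype.ext ?_⟩
      have hqK : (q : K) ≠ 0 := by simpa using hq
      refine mul_left_cancel₀ (pow_ne_zero k hqK) ?_
      refine sub_eq_zero.1 (eq_zero_of_forall_trace_mul_eq_zero w fun i => ?_)
      rw [sub_mul, map_sub, sub_eq_zero]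
      change Algebra.trace ℚ K ((q : K) ^ k * dualVector w q k (fun i => -n i) * (w i : K)) = _
      rw [pow_mul_dualVector w hq, trace_sum_smul_traceDual_mul]
      have := hn i
      rw [Algebra.traceForm_apply] at this
      rw [← this]
      simp

theorem dualVectorEquiv_apply (w : Module.Basis (Fin d) ℤ (𝓞 K)) (hq : q ≠ 0) (k : ℕ)
    (n : Fin d → ℤ) : (dualVectorEquiv w hq k n : K) = dualVector w q k n := rfl

/-- The function `x ↦ V₀(q ^ k x)` in coordinates. -/
def dilate (w : Module.Basis (Fin d) ℤ (𝓞 K)) (q : 𝓞 K) (k : ℕ)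
    (V₀ : EuclideanSpace ℝ (Fin d) → ℂ) (x : Fin d → ℝ) : ℂ :=
  V₀ (WithLp.toLp 2 ((mulMatrix w q k).mulVec x))

theorem isClosedEmbedding_toLp_mulVec (w : Module.Basis (Fin d) ℤ (𝓞 K)) (hq : q ≠ 0) (k : ℕ) :
    Topology.IsClosedEmbedding fun x : Fin d → ℝ =>
      (WithLp.toLp 2 ((mulMatrix w q k).mulVec x) : EuclideanSpace ℝ (Fin d)) := by
  have hinj : Function.Injective (mulMatrix w q k).mulVec :=
    Matrix.mulVec_injective_of_isUnit ((Matrix.isUnit_iff_isUnit_det _).2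
      (det_mulMatrix_ne_zero w hq k).isUnit)
  let φ : (Fin d → ℝ) →ₗ[ℝ] EuclideanSpace ℝ (Fin d) :=
    (WithLp.linearEquiv 2 ℝ (Fin d → ℝ)).symm.toLinearMap ∘ₗ Matrix.toLin' (mulMatrix w q k)
  refine LinearMap.isClosedEmbedding_of_injective (f := φ) (LinearMap.ker_eq_bot.2 ?_)
  exact (WithLp.linearEquiv 2 ℝ (Fin d → ℝ)).symm.injective.comp hinj

/-- The substitution `y = q^k x` has Jacobian `Q^k`. The sign in `dualVector` reconciles the
frequency `-n` of a Fourier coefficient with the positive exponent in `V̂`. -/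
theorem integral_mFourier_mul_dilate (w : Module.Basis (Fin d) ℤ (𝓞 K)) (hq : q ≠ 0) (k : ℕ)
    {V₀ : EuclideanSpace ℝ (Fin d) → ℂ} (hV : Continuous V₀) (n : Fin d → ℤ) :
    ∫ x : Fin d → ℝ, UnitAddTorus.mFourier (-n) (torusMk x) * dilate w q k V₀ x =
      ((absNorm q : ℂ) ^ k)⁻¹ * hatV w V₀ (dualVector w q k n) := by
  set ξ := dualVector w q k n
  set A := mulMatrix w q k
  have hA : A.det ≠ 0 := det_mulMatrix_ne_zero w hq k
  let H : (Fin d → ℝ) → ℂ := fun y =>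
    Complex.exp (2 * Real.pi * Complex.I * ((∑ i, dualCoord w ξ i * y i : ℝ) : ℂ)) *
      V₀ (WithLp.toLp 2 y)
  have hHc : Continuous H := by
    have : Continuous fun y : Fin d → ℝ => (WithLp.toLp 2 y : EuclideanSpace ℝ (Fin d)) :=
      PiLp.continuous_toLp 2 _
    fun_prop
  have h1 : ∀ x : Fin d → ℝ, UnitAddTorus.mFourier (-n) (torusMk x) * dilate w q k V₀ x =
      H (Matrix.toLin' A x) := by
    intro x
    rw [mFourier_torusMk, dilate]
    simp only [H, Matrix.toLin'_apply]
    congr 4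
    rw [dualCoord_dotProduct_mulVec]
    refine Finset.sum_congr rfl fun i _ => ?_
    rw [dualCoord_pow_mul_dualVector w hq]
    simp
  simp only [h1]
  have hmeas : Measurable (Matrix.toLin' A : (Fin d → ℝ) → Fin d → ℝ) :=
    (LinearMap.continuous_of_finiteDimensional (Matrix.toLin' A)).measurable
  rw [← integral_map hmeas.aemeasurable hHc.aestronglyMeasurable,
    Real.map_matrix_volume_pi_eq_smul_volume_pi hA, integral_smul_measure,
    ENNReal.toReal_ofReal (abs_nonneg _), abs_inv, abs_det_mulMatrix, Complex.real_smul]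
  congr 1
  · push_cast
    rfl
  · rw [hatV, Real.fourierInv_eq',
      ← (PiLp.volume_preserving_ofLp (Fin d)).integral_comp
        (MeasurableEquiv.toLp 2 (Fin d → ℝ)).symm.measurableEmbedding]
    refine integral_congr_ae (Filter.Eventually.of_forall fun v => ?_)
    simp only [H, smul_eq_mul, PiLp.inner_apply, RCLike.inner_apply, conj_trivial]
    congr 2
    push_cast
    ring

/-- `V̂₀` is a Schwartz function, and `n` is a fixed linear image of the dual coordinates of its
frequency, so the terms decay like `‖n‖^(-d-1)`. -/
theorem summable_norm_hatV_dualVector (w : Module.Basis (Fin d) ℤ (𝓞 K)) (hq : q ≠ 0) (k : ℕ)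
    {V₀ : EuclideanSpace ℝ (Fin d) → ℂ} (hV : ContDiff ℝ ∞ V₀) (hVc : HasCompactSupport V₀) :
    Summable fun n : Fin d → ℤ => ‖hatV w V₀ (dualVector w q k n)‖ := by
  let Ψ : SchwartzMap (EuclideanSpace ℝ (Fin d)) ℂ := 𝓕⁻ (hVc.toSchwartzMap hV)
  have hΨ : ∀ y, 𝓕⁻ V₀ y = Ψ y := fun y => by
    rw [SchwartzMap.fourierInv_coe]
    rfl
  obtain ⟨B, -, hB⟩ := Ψ.decay (d + 1) 0
  set a : ℝ := ∑ i, ∑ j, |mulMatrix w q k i j|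
  have hn : ∀ n : Fin d → ℤ, ‖intVector n‖ ≤ a * ‖dualCoord w (dualVector w q k n)‖ := by
    intro n
    change ‖(fun i => (n i : ℝ) : Fin d → ℝ)‖ ≤ _
    rw [pi_norm_le_iff_of_nonneg (by positivity)]
    intro j
    have h1 := dualCoord_dotProduct_mulVec w q k (dualVector w q k n) (Pi.single j 1)
    have h2 : ∑ i, dualCoord w ((q : K) ^ k * dualVector w q k n) i *
        (Pi.single j 1 : Fin d → ℝ) i = -(n j : ℝ) := by
      rw [Finset.sum_eq_single j (fun i _ hij => by simp [hij]) (by simp),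
        dualCoord_pow_mul_dualVector w hq]
      simp
    rw [h2] at h1
    rw [← norm_neg, ← h1]
    refine (norm_sum_le _ _).trans ?_
    rw [Finset.sum_mul]
    refine Finset.sum_le_sum fun i _ => ?_
    rw [norm_mul, mul_comm]
    gcongr
    · rw [Matrix.mulVec_single_one, Real.norm_eq_abs]
      exact Finset.single_le_sum (f := fun j => |mulMatrix w q k i j|)
        (fun _ _ => abs_nonneg _) (Finset.mem_univ j)
    · exact PiLp.norm_apply_le _ i
  have hsum := (summable_norm_int_rpow (d := d) (r := -((d + 1 : ℕ) : ℝ))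
    (by push_cast; linarith)).mul_left (B * a ^ (d + 1))
  refine Summable.of_norm_bounded_eventually hsum ?_
  have hfin : ∀ᶠ n : Fin d → ℤ in Filter.cofinite, n ≠ 0 :=
    (Set.finite_singleton (0 : Fin d → ℤ)).subset (by intro n hn; simpa using hn)
  filter_upwards [hfin] with n hn0
  have hpos : 0 < ‖intVector n‖ := by
    rw [norm_pos_iff]
    intro h0
    refine hn0 (intVector_injective (h0.trans ?_))
    ext i
    simp [intVector]
  have hB' := hB (dualCoord w (dualVector w q k n))
  rw [norm_iteratedFDeriv_zero] at hB'
  rw [norm_norm, hatV, hΨ, Real.rpow_neg hpos.le, Real.rpow_natCast, ← div_eq_mul_inv,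
    le_div_iff₀ (pow_pos hpos _)]
  have ha : 0 ≤ a := by positivity
  calc ‖Ψ (dualCoord w (dualVector w q k n))‖ * ‖intVector n‖ ^ (d + 1)
      ≤ ‖Ψ (dualCoord w (dualVector w q k n))‖ *
        (a * ‖dualCoord w (dualVector w q k n)‖) ^ (d + 1) := by
        gcongr
        exact hn n
    _ = a ^ (d + 1) * (‖dualCoord w (dualVector w q k n)‖ ^ (d + 1) *
        ‖Ψ (dualCoord w (dualVector w q k n))‖) := by ring
    _ ≤ a ^ (d + 1) * B := by gcongr
    _ = _ := by ring

theorem summable_norm_hatV (w : Module.Basis (Fin d) ℤ (𝓞 K)) (hq : q ≠ 0) (k : ℕ)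
    {V₀ : EuclideanSpace ℝ (Fin d) → ℂ} (hV : ContDiff ℝ ∞ V₀) (hVc : HasCompactSupport V₀) :
    Summable fun ξ : dualLattice q k => ‖hatV w V₀ ξ‖ := by
  rw [← (dualVectorEquiv w hq k).summable_iff]
  exact summable_norm_hatV_dualVector w hq k hV hVc

/-- Dilating by `q^k` reduces the `q^k 𝓞`-periodization to one over `ℤ^d`, evaluated at `n /
q^(j+k)`. Only the zero translate contributes, so its Fourier series returns the value of `V`
itself. -/
theorem IsFNS.hasSum_hatV (h : IsFNS q D) (w : Module.Basis (Fin d) ℤ (𝓞 K)) {k : ℕ}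
    {V₀ : EuclideanSpace ℝ (Fin d) → ℂ} (hV : ContDiff ℝ ∞ V₀) (hVc : HasCompactSupport V₀)
    (hVt : Function.support V₀ ⊆ tile q D w k) {j : ℕ} {n : 𝓞 K}
    (hn : n ∈ digitSet q D (j + k)) :
    HasSum (fun ξ : dualLattice q k => ((absNorm q : ℂ) ^ k)⁻¹ * hatV w V₀ ξ *
      trChar (-((ξ : K) / (q : K) ^ j)) n) (V₀ (coord w ((n : K) / (q : K) ^ j))) := by
  have hq := h.ne_zero
  have hqK := h.coe_ne_zero
  have hemb := isClosedEmbedding_toLp_mulVec w hq k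
  have hg : Continuous (dilate w q k V₀) := hV.continuous.comp hemb.continuous
  have hgc : HasCompactSupport (dilate w q k V₀) := hVc.comp_isClosedEmbedding hemb
  have hinteg := integral_mFourier_mul_dilate w hq k hV.continuous
  have hsum : Summable fun m : Fin d → ℤ =>
      ∫ x : Fin d → ℝ, UnitAddTorus.mFourier (-m) (torusMk x) * dilate w q k V₀ x := by
    simp only [hinteg]
    exact (summable_norm_hatV_dualVector w hq k hV hVc).of_norm.mul_left _
  have key := hasSum_periodization hg hgc hsum (coord w ((n : K) / (q : K) ^ (j + k))).ofLp
  have hdil : ∀ a : 𝓞 K, dilate w q k V₀ (coord w ((a : K) + (n : K) / (q : K) ^ (j + k))).ofLp =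
      V₀ (coord w (((n + q ^ (j + k) * a : 𝓞 K) : K) / (q : K) ^ j)) := by
    intro a
    rw [dilate, toLp_mulMatrix_mulVec_coord]
    congr 2
    push_cast
    rw [pow_add]
    field_simp
    ring
  have hper : periodization (dilate w q k V₀) (coord w ((n : K) / (q : K) ^ (j + k))).ofLp =
      V₀ (coord w ((n : K) / (q : K) ^ j)) := by
    rw [periodization, tsum_eq_single 0]
    · have h0 := hdil 0
      simpa using h0
    · intro s hs
      choose m hm using mem_intLattice.1 s.2
      have hsa : (s : Fin d → ℝ) = (coord w ((∑ i, m i • w i : 𝓞 K) : K)).ofLp := by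
        funext i
        have h1 : ((∑ i, m i • w i : 𝓞 K) : K) = ∑ i, (m i : ℚ) • ratBasis w i := by
          simp [Algebra.smul_def]
        rw [coord_apply, h1, Module.Basis.repr_sum_self, ← hm i]
        simp
      set a : 𝓞 K := ∑ i, m i • w i with ha
      rw [hsa, ← WithLp.ofLp_add, ← coord_add, hdil]
      by_contra hne
      -- A nonzero value would put the translate `n + q^(j+k) a` in the same digit set as `n`, in
      -- the same class, forcing `a = 0`.
      have h1 := h.mem_digitSet_of_coord_mem_tile w (hVt hne)
      have h2 := h.digitSet_unique h1 hn ⟨a, by ring⟩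
      have h3 : a = 0 := by
        have h4 : q ^ (j + k) * a = 0 := by linear_combination h2
        exact (mul_eq_zero.1 h4).resolve_left (pow_ne_zero _ hq)
      refine hs (Subtype.ext ?_)
      rw [hsa, h3]
      funext i
      simp [coord_apply]
  rw [hper] at key
  rw [← (dualVectorEquiv w hq k).hasSum_iff]
  convert key using 1
  funext m
  rw [hinteg, Function.comp_apply, dualVectorEquiv_apply, mFourier_torusMk, trChar_apply]
  congr 3
  have h1 : -(dualVector w q k m / (q : K) ^ j) * (n : K) =
      -((q : K) ^ k * dualVector w q k m * ((n : K) / (q : K) ^ (j + k))) := by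
    rw [pow_add]
    field_simp
  rw [h1, map_neg, trace_pow_mul_dualVector_mul w hq, neg_neg]
  push_cast
  rfl

end FourierExpansion

/-! ### The type I estimate. -/

section TypeI

variable {K : Type*} [Field K] [NumberField K] {d : ℕ} {q : 𝓞 K} {D : Finset (𝓞 K)}

theorem IsFNS.tsum_mul_eq_sum_filter_dvd (h : IsFNS q D) (w : Module.Basis (Fin d) ℤ (𝓞 K))
    {k : ℕ} {V₀ : EuclideanSpace ℝ (Fin d) → ℂ} (hVt : Function.support V₀ ⊆ tile q D w k)
    (f : 𝓞 K → ℂ) (J : ℕ) {m : 𝓞 K} (hm : m ≠ 0) [DecidablePred fun x => m ∣ x] :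
    ∑' n : 𝓞 K, V₀ (coord w (((m * n : 𝓞 K) : K) / (q : K) ^ J)) * f (m * n) =
      ∑ n ∈ digitSet q D (J + k) with m ∣ n, V₀ (coord w ((n : K) / (q : K) ^ J)) * f n := by
  classical
  have hinj : Function.Injective fun n : 𝓞 K => m * n := mul_right_injective₀ hm
  rw [tsum_eq_sum (s := (digitSet q D (J + k)).preimage (fun n => m * n) hinj.injOn),
    Finset.sum_preimage' (fun n => m * n) _ hinj.injOn
      fun n => V₀ (coord w ((n : K) / (q : K) ^ J)) * f n]
  · refine Finset.sum_congr (Finset.filter_congr fun n _ => ?_) fun _ _ => rfl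
    simp only [Set.mem_range, dvd_def, eq_comm]
  · intro n hn
    have h0 : V₀ (coord w (((m * n : 𝓞 K) : K) / (q : K) ^ J)) = 0 := by
      by_contra hne
      exact hn (Finset.mem_preimage.2 (h.mem_digitSet_of_coord_mem_tile w (hVt hne)))
    rw [h0, zero_mul]

/-- Inserting the Fourier expansion of `V` and exchanging sums leaves an average over `ξ` with
weights `Q^(-k) |V̂(ξ)|`, so a bound uniform in the frequency suffices. The term `m = 0` vanishes
because `V₀(0) = 0`. -/
theorem IsFNS.typeISum_le (h : IsFNS q D) (w : Module.Basis (Fin d) ℤ (𝓞 K)) {k : ℕ}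
    {V₀ : EuclideanSpace ℝ (Fin d) → ℂ} (hV : ContDiff ℝ ∞ V₀) (hVc : HasCompactSupport V₀)
    (hV0 : 0 ∉ tsupport V₀) (hVt : Function.support V₀ ⊆ tile q D w k) (f : 𝓞 K → ℂ)
    (μ ν : ℕ) [∀ m : 𝓞 K, DecidablePred fun x => m ∣ x] {B : ℝ}
    (hB : ∀ t : K, ∀ S ⊆ digitSet q D μ, (∀ m ∈ S, m ≠ 0) →
      ∑ m ∈ S, ‖∑ n ∈ digitSet q D (μ + ν + k) with m ∣ n, f n * trChar t n‖ ≤ B) :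
    typeISum q D w f V₀ μ ν ≤ (absNorm q ^ k)⁻¹ * sigmaV q w V₀ k * B := by
  classical
  set J := μ + ν
  set S := (digitSet q D μ).erase 0
  have hS0 : ∀ m ∈ S, m ≠ 0 := fun m hm => (Finset.mem_erase.1 hm).1
  have hSs : S ⊆ digitSet q D μ := Finset.erase_subset _ _
  have hQ := absNorm_pos h.ne_zero
  have hzero : V₀ 0 = 0 := by
    by_contra hne
    exact hV0 (subset_tsupport V₀ hne)
  let E : 𝓞 K → dualLattice q k → ℂ := fun m ξ =>
    ∑ n ∈ digitSet q D (J + k) with m ∣ n, f n * trChar (-((ξ : K) / (q : K) ^ J)) n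
  have hsum := summable_norm_hatV w h.ne_zero k hV hVc
  have hEsum : ∀ m, Summable fun ξ : dualLattice q k =>
      (absNorm q ^ k)⁻¹ * ‖hatV w V₀ ξ‖ * ‖E m ξ‖ := by
    intro m
    refine Summable.of_nonneg_of_le (fun ξ => by positivity) (fun ξ => ?_)
      ((hsum.mul_left (absNorm q ^ k)⁻¹).mul_right
        (∑ n ∈ digitSet q D (J + k) with m ∣ n, ‖f n‖))
    gcongr
    refine (norm_sum_le _ _).trans_eq (Finset.sum_congr rfl fun n _ => ?_)
    rw [norm_mul, norm_trChar, mul_one]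
  have hterm : ∀ m ∈ S, ‖∑' n : 𝓞 K, V₀ (coord w (((m * n : 𝓞 K) : K) / (q : K) ^ J)) *
      f (m * n)‖ ≤ ∑' ξ : dualLattice q k, (absNorm q ^ k)⁻¹ * ‖hatV w V₀ ξ‖ * ‖E m ξ‖ := by
    intro m hm
    rw [h.tsum_mul_eq_sum_filter_dvd w hVt f J (hS0 m hm)]
    have h1 : HasSum (fun ξ : dualLattice q k => ((absNorm q : ℂ) ^ k)⁻¹ * hatV w V₀ ξ * E m ξ)
        (∑ n ∈ digitSet q D (J + k) with m ∣ n, V₀ (coord w ((n : K) / (q : K) ^ J)) * f n) := by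
      have h2 := hasSum_sum (s := (digitSet q D (J + k)).filter fun n => m ∣ n)
        fun n hn => (h.hasSum_hatV w hV hVc hVt (Finset.mem_filter.1 hn).1).mul_right (f n)
      have he : (fun ξ : dualLattice q k => ((absNorm q : ℂ) ^ k)⁻¹ * hatV w V₀ ξ * E m ξ) =
          fun ξ : dualLattice q k => ∑ n ∈ digitSet q D (J + k) with m ∣ n,
            ((absNorm q : ℂ) ^ k)⁻¹ * hatV w V₀ ξ * trChar (-((ξ : K) / (q : K) ^ J)) n * f n := by
        funext ξ
        rw [Finset.mul_sum]
        exact Finset.sum_congr rfl fun n _ => by ring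
      rw [he]
      exact h2
    rw [← h1.tsum_eq]
    refine tsum_of_norm_bounded (hEsum m).hasSum fun ξ => ?_
    rw [norm_mul, norm_mul, norm_inv, norm_pow, Complex.norm_real, Real.norm_of_nonneg hQ.le]
  calc typeISum q D w f V₀ μ ν
      = ∑ m ∈ S, ‖∑' n : 𝓞 K, V₀ (coord w (((m * n : 𝓞 K) : K) / (q : K) ^ J)) * f (m * n)‖ := by
        symm
        refine Finset.sum_subset hSs fun m hm hmS => ?_
        have hm0 : m = 0 := by
          by_contra hne
          exact hmS (Finset.mem_erase.2 ⟨hne, hm⟩)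
        have hc : coord w (0 : K) = 0 := by
          ext i
          simp [coord_apply]
        subst hm0
        simp [hc, hzero]
    _ ≤ ∑ m ∈ S, ∑' ξ : dualLattice q k, (absNorm q ^ k)⁻¹ * ‖hatV w V₀ ξ‖ * ‖E m ξ‖ :=
        Finset.sum_le_sum hterm
    _ = ∑' ξ : dualLattice q k, ∑ m ∈ S, (absNorm q ^ k)⁻¹ * ‖hatV w V₀ ξ‖ * ‖E m ξ‖ :=
        (Summable.tsum_finsetSum fun m _ => hEsum m).symm
    _ ≤ ∑' ξ : dualLattice q k, (absNorm q ^ k)⁻¹ * ‖hatV w V₀ ξ‖ * B := by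
        refine Summable.tsum_le_tsum (fun ξ => ?_) (summable_sum fun m _ => hEsum m)
          ((hsum.mul_left (absNorm q ^ k)⁻¹).mul_right B)
        rw [← Finset.mul_sum]
        gcongr
        exact hB _ S hSs hS0
    _ = _ := by rw [tsum_mul_right, tsum_mul_left, sigmaV]

theorem IsFNS.exists_balance (h : IsFNS q D) {f : 𝓞 K → ℂ} {η₁ C₁ C₂ c : ℝ} {γ : ℕ → ℝ}
    (hf1 : ∀ n, ‖f n‖ = 1) (hcarry : CarryProperty q D f η₁ C₁)
    (hfour : FourierProperty q D f γ c C₂) (l : ℕ) :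
    ∃ ρ ≤ l, absNorm q ^ ρ * (C₂ * absNorm q ^ ((l : ℝ) - γ l)) +
        C₁ * absNorm q ^ ((l : ℝ) - η₁ * ρ) ≤
      (|C₂| * absNorm q + |C₁| * (1 + |C₂|)) * absNorm q ^ ((l : ℝ) - η₁ / (1 + η₁) * γ l) := by
  set Q := absNorm q
  have hQ : 1 < Q := h.one_lt_absNorm
  have hQ0 : 0 < Q := by linarith
  have hη := hcarry.1
  have hγ := hfour.2.1 l
  have hone := h.one_le_of_fourierProperty hf1 hfour l
  set x := γ l / (1 + η₁) with hx
  have hx0 : 0 ≤ x := by positivity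
  have hθ : η₁ / (1 + η₁) * γ l = γ l - x := by
    rw [hx]
    field_simp
    ring
  have hθ' : η₁ / (1 + η₁) * γ l = η₁ * x := by
    rw [hx]
    field_simp
  -- `x = γ(l)/(1+η₁)` equates the exponents `γ(l) - ρ` and `η₁ ρ`; rounding up costs one factor
  -- `Q`, and the minimum enforces `ρ ≤ l`.
  refine ⟨min l ⌈x⌉₊, min_le_left _ _, ?_⟩
  set ρ := min l ⌈x⌉₊ with hρ
  have hρx : (ρ : ℝ) ≤ x + 1 := by
    have h1 : (ρ : ℝ) ≤ (⌈x⌉₊ : ℝ) := by exact_mod_cast min_le_right l ⌈x⌉₊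
    exact h1.trans (Nat.ceil_lt_add_one hx0).le
  have hmain : Q ^ ρ * (C₂ * Q ^ ((l : ℝ) - γ l)) ≤
      |C₂| * Q * Q ^ ((l : ℝ) - η₁ / (1 + η₁) * γ l) := by
    calc Q ^ ρ * (C₂ * Q ^ ((l : ℝ) - γ l)) ≤ Q ^ ρ * (|C₂| * Q ^ ((l : ℝ) - γ l)) := by
          gcongr
          exact le_abs_self C₂
      _ = |C₂| * Q ^ ((ρ : ℝ) + ((l : ℝ) - γ l)) := by
          rw [Real.rpow_add hQ0, Real.rpow_natCast]
          ring
      _ ≤ |C₂| * Q ^ (1 + ((l : ℝ) - η₁ / (1 + η₁) * γ l)) := by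
          gcongr |C₂| * ?_
          refine Real.rpow_le_rpow_of_exponent_le hQ.le ?_
          rw [hθ]
          linarith
      _ = _ := by
          rw [Real.rpow_add hQ0, Real.rpow_one]
          ring
  have herr : Q ^ ((l : ℝ) - η₁ * ρ) ≤ (1 + |C₂|) * Q ^ ((l : ℝ) - η₁ / (1 + η₁) * γ l) := by
    have hpos : 0 < Q ^ ((l : ℝ) - η₁ / (1 + η₁) * γ l) := Real.rpow_pos_of_pos hQ0 _
    rcases le_or_gt ⌈x⌉₊ l with hle | hlt
    · have h1 : x ≤ ρ := by
        rw [hρ, min_eq_right hle]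
        exact Nat.le_ceil x
      have h2 : Q ^ ((l : ℝ) - η₁ * ρ) ≤ Q ^ ((l : ℝ) - η₁ / (1 + η₁) * γ l) := by
        refine Real.rpow_le_rpow_of_exponent_le hQ.le ?_
        rw [hθ']
        have := mul_le_mul_of_nonneg_left h1 hη.le
        linarith
      refine h2.trans (le_mul_of_one_le_left hpos.le ?_)
      linarith [abs_nonneg C₂]
    · have h1 : (l : ℝ) < x := Nat.lt_ceil.1 hlt
      have h2 : (ρ : ℝ) = l := by
        rw [hρ, min_eq_left hlt.le]
      -- When the cap `ρ = l` is active, the loss is controlled by the trivial lower bound `1 ≤ C₂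
      -- Q^(l-γ(l))`.
      have h3 : Q ^ (γ l - l) ≤ |C₂| := by
        have h4 : Q ^ (γ l - l) * Q ^ ((l : ℝ) - γ l) = 1 := by
          rw [← Real.rpow_add hQ0]
          simp
        have h5 : 0 < Q ^ ((l : ℝ) - γ l) := Real.rpow_pos_of_pos hQ0 _
        refine le_of_mul_le_mul_right ?_ h5
        rw [h4]
        refine hone.trans ?_
        gcongr
        exact le_abs_self C₂
      calc Q ^ ((l : ℝ) - η₁ * ρ)
          ≤ Q ^ ((γ l - l) + ((l : ℝ) - η₁ / (1 + η₁) * γ l)) := by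
            refine Real.rpow_le_rpow_of_exponent_le hQ.le ?_
            rw [hθ, h2]
            have : 0 ≤ η₁ * l := by positivity
            linarith
        _ = Q ^ (γ l - l) * Q ^ ((l : ℝ) - η₁ / (1 + η₁) * γ l) := Real.rpow_add hQ0 _ _
        _ ≤ (1 + |C₂|) * Q ^ ((l : ℝ) - η₁ / (1 + η₁) * γ l) := by
            gcongr
            linarith
  calc _ ≤ |C₂| * Q * Q ^ ((l : ℝ) - η₁ / (1 + η₁) * γ l) +
        |C₁| * ((1 + |C₂|) * Q ^ ((l : ℝ) - η₁ / (1 + η₁) * γ l)) := by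
        refine add_le_add hmain ?_
        exact mul_le_mul (le_abs_self C₁) herr (Real.rpow_pos_of_pos hQ0 _).le (abs_nonneg _)
    _ = _ := by ring

theorem IsFNS.exists_typeISum_le (h : IsFNS q D) (w : Module.Basis (Fin d) ℤ (𝓞 K))
    (C₁ C₂ : ℝ) : ∃ C : ℝ, 0 < C ∧
      ∀ (f : 𝓞 K → ℂ) (η₁ : ℝ) (γ : ℕ → ℝ) (c : ℝ), (∀ n, ‖f n‖ = 1) →
        CarryProperty q D f η₁ C₁ → FourierProperty q D f γ c C₂ →
      ∀ V₀ : EuclideanSpace ℝ (Fin d) → ℂ, ContDiff ℝ ∞ V₀ → HasCompactSupport V₀ →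
        0 ∉ tsupport V₀ →
      ∀ k : ℕ, Function.support V₀ ⊆ tile q D w k →
      ∀ μ ν : ℕ, (μ : ℝ) ≤ c / (c + 2) * ν →
        typeISum q D w f V₀ μ ν ≤
          C * sigmaV q w V₀ k * (μ : ℝ) ^ (d + 1) *
            absNorm q ^ ((μ : ℝ) + ν - η₁ / (1 + η₁) * γ (ν - μ)) := by
  classical
  obtain ⟨B, hB0, hB⟩ := h.exists_sum_norm_sum_dvd_le w
  set Q := absNorm q
  have hQ : 1 < Q := h.one_lt_absNorm
  have hQ0 : 0 < Q := by linarith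
  set M := |C₂| * Q + |C₁| * (1 + |C₂|)
  have hM0 : 0 ≤ M := by positivity
  refine ⟨B * M + 1, by positivity, ?_⟩
  intro f η₁ γ c hf1 hcarry hfour V₀ hV hVc hV0 k hVt μ ν hμν
  have hc := hfour.2.2.1
  have hη := hcarry.1
  have hsig0 : 0 ≤ sigmaV q w V₀ k := tsum_nonneg fun _ => norm_nonneg _
  rcases Nat.eq_zero_or_pos μ with rfl | hμ
  -- For `μ = 0` the factor `μ^(d+1)` makes the target zero, and `𝒩_0 = {0}` contains no nonzero
  -- `m`.
  · have h1 := h.typeISum_le w hV hVc hV0 hVt f 0 ν (B := 0) fun t S hS hS0 => by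
      refine le_of_eq (Finset.sum_eq_zero fun m hm => ?_)
      exact absurd (by simpa using hS hm) (hS0 m hm)
    refine h1.trans_eq ?_
    simp
  have hμc : (μ : ℝ) * (c + 2) ≤ c * ν := by
    rw [div_mul_eq_mul_div, le_div_iff₀ (by linarith)] at hμν
    exact hμν
  have hle : μ ≤ ν := by
    have h1 : (0 : ℝ) ≤ μ := by positivity
    have h2 : (μ : ℝ) ≤ ν := le_of_mul_le_mul_left (by nlinarith) hc
    exact_mod_cast h2
  set l := ν - μ + k with hl
  have hlc : ((ν - μ : ℕ) : ℝ) = ν - μ := by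
    push_cast [hle]
    ring
  have hlreal : (l : ℝ) = ν - μ + k := by
    rw [hl, Nat.cast_add, hlc]
  -- The condition `μ ≤ cν/(c+2)` is equivalent to `2μ ≤ c(ν - μ)`, the range of `κ = 2μ` in the
  -- Fourier property; the extra `k` only helps.
  have hκ : ((2 * μ : ℕ) : ℝ) ≤ c * l := by
    have h1 : (0 : ℝ) ≤ k := by positivity
    rw [hlreal]
    push_cast
    nlinarith
  obtain ⟨ρ, hρ, hbal⟩ := h.exists_balance hf1 hcarry hfour l
  have hadd : 2 * μ + l = μ + ν + k := by omega
  have hmain := h.typeISum_le w hV hVc hV0 hVt f μ ν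
    (B := B * (μ : ℝ) ^ (d + 1) * Q ^ (2 * μ) *
      (M * Q ^ ((l : ℝ) - η₁ / (1 + η₁) * γ l))) fun t S hS hS0 => by
    have h1 := hB f η₁ C₁ C₂ γ c hf1 hcarry hfour μ l ρ hμ hρ hκ t S hS hS0
    rw [hadd] at h1
    refine h1.trans ?_
    gcongr
  refine hmain.trans ?_
  have hγ : γ (ν - μ) ≤ γ l := hfour.1 (Nat.le_add_right _ _)
  -- The factor `Q^(-k)` from the Fourier coefficients cancels the `k` extra digits in `l`, since
  -- `2μ + l - k = μ + ν`.
  have hexp : (Q ^ k)⁻¹ * (Q ^ (2 * μ) * Q ^ ((l : ℝ) - η₁ / (1 + η₁) * γ l)) ≤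
      Q ^ ((μ : ℝ) + ν - η₁ / (1 + η₁) * γ (ν - μ)) := by
    rw [← Real.rpow_natCast, ← Real.rpow_natCast, ← Real.rpow_neg hQ0.le, ← Real.rpow_add hQ0,
      ← Real.rpow_add hQ0]
    refine Real.rpow_le_rpow_of_exponent_le hQ.le ?_
    have h1 : η₁ / (1 + η₁) * γ (ν - μ) ≤ η₁ / (1 + η₁) * γ l := by gcongr
    rw [hlreal]
    push_cast
    linarith
  calc (Q ^ k)⁻¹ * sigmaV q w V₀ k * (B * (μ : ℝ) ^ (d + 1) * Q ^ (2 * μ) *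
        (M * Q ^ ((l : ℝ) - η₁ / (1 + η₁) * γ l)))
      = B * M * sigmaV q w V₀ k * (μ : ℝ) ^ (d + 1) *
        ((Q ^ k)⁻¹ * (Q ^ (2 * μ) * Q ^ ((l : ℝ) - η₁ / (1 + η₁) * γ l))) := by ring
    _ ≤ B * M * sigmaV q w V₀ k * (μ : ℝ) ^ (d + 1) *
        Q ^ ((μ : ℝ) + ν - η₁ / (1 + η₁) * γ (ν - μ)) := by gcongr
    _ ≤ _ := by
        gcongr
        linarith

end TypeI

end

end DigitSystem

open DigitSystem in
theorem proposition4p1 {K : Type*} [Field K] [NumberField K] {d : ℕ}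
    (w : Module.Basis (Fin d) ℤ (𝓞 K)) (q : 𝓞 K) (D : Finset (𝓞 K)) (hqD : IsFNS q D) :
    (∀ R : ℝ, ∃ k : ℕ, Metric.closedBall 0 R ⊆ tile q D w k) ∧
    ∀ C₁ C₂ : ℝ, ∃ C : ℝ, 0 < C ∧
      ∀ (f : 𝓞 K → ℂ) (η₁ : ℝ) (γ : ℕ → ℝ) (c : ℝ), (∀ n, ‖f n‖ = 1) →
        CarryProperty q D f η₁ C₁ → FourierProperty q D f γ c C₂ →
      ∀ V₀ : EuclideanSpace ℝ (Fin d) → ℂ, ContDiff ℝ ∞ V₀ → HasCompactSupport V₀ →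
        0 ∉ tsupport V₀ →
      ∀ k : ℕ, Function.support V₀ ⊆ tile q D w k →
      ∀ μ ν : ℕ, (μ : ℝ) ≤ c / (c + 2) * ν →
        typeISum q D w f V₀ μ ν ≤
          C * sigmaV q w V₀ k * (μ : ℝ) ^ (d + 1) *
            absNorm q ^ ((μ : ℝ) + ν - η₁ / (1 + η₁) * γ (ν - μ)) := by
  exact ⟨hqD.exists_closedBall_subset_tile w, hqD.exists_typeISum_le w⟩
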